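/- For a probability density $f$ on $\mathbb{R}^n$ with finite second moments let $D(f)$ denote the relative entropy of the measure $f\,dx$ from the Gaussian measure on $\mathbb{R}^n$ with the same mean and covariance matrix. A density $f$ is log-concave if $f((1-t)x+ty)\ge f(x)^{1-t}f(y)^{t}$ for all $x,y\in\mathbb{R}^n$ and $0<t<1$. Then the following three assertions are equivalent. (1) (Hyperplane conjecture.) There is a universal constant $c>0$ such that for every $n\ge 1$ and every convex set $K\subset\mathbb{R}^n$ of volume $1$ there is a hyperplane $H$ passing through the centroid of $K$ such that the $(n-1)$-dimensional volume of $K\cap H$ is at least $c$. (2) (Entropic form.) There is a universal constant $c$ such that $D(f)\le cn$ for every $n\ge 1$ and every log-concave probability density $f$ on $\mathbb{R}^n$. (3) (Independence form.) There is a universal constant $c$ such that for every $n\ge 1$ and every log-concave probability density $f$ on $\mathbb{R}^n$ whose coordinates are uncorrelated (that is, whose covariance matrix is diagonal), the relative entropy of the measure $f\,dx$ from the product of its $n$ one-dimensional marginals is at most $cn$. -/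

import Mathlib

open MeasureTheory ProbabilityTheory InformationTheory

noncomputable section

/-- `f` is a log-concave probability density on `ℝⁿ` (with respect to Lebesgue measure).
The value of the integral being `1` includes integrability. -/
structure IsLogConcaveDensity {n : ℕ} (f : EuclideanSpace ℝ (Fin n) → ℝ) : Prop where
  measurable : Measurable f
  nonneg : ∀ x, 0 ≤ f x
  logConcave : ∀ x y : EuclideanSpace ℝ (Fin n), ∀ a b : ℝ, 0 < a → 0 < b → a + b = 1 →
    f x ^ a * f y ^ b ≤ f (a • x + b • y)
  integral_eq_one : ∫ x, f x = 1

/-- The measure on `ℝⁿ` with density `f` with respect to Lebesgue measure. -/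
def densityMeasure {n : ℕ} (f : EuclideanSpace ℝ (Fin n) → ℝ) :
    Measure (EuclideanSpace ℝ (Fin n)) :=
  volume.withDensity fun x => ENNReal.ofReal (f x)

/-- The covariance matrix of a measure on `ℝⁿ`. -/
def covarianceMatrix {n : ℕ} (μ : Measure (EuclideanSpace ℝ (Fin n))) :
    Matrix (Fin n) (Fin n) ℝ :=
  Matrix.of fun i j => cov[fun x => x i, fun x => x j; μ]

/-- The Gaussian measure on `ℝⁿ` with the same mean and covariance matrix as `μ`. -/
def matchingGaussian {n : ℕ} (μ : Measure (EuclideanSpace ℝ (Fin n))) :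
    Measure (EuclideanSpace ℝ (Fin n)) :=
  multivariateGaussian (∫ x, x ∂μ) (covarianceMatrix μ)

/-- `D(f)`: the relative entropy of the measure with density `f` from the Gaussian measure
with the same mean and covariance matrix. -/
def entropyFromGaussianity {n : ℕ} (f : EuclideanSpace ℝ (Fin n) → ℝ) : ENNReal :=
  klDiv (densityMeasure f) (matchingGaussian (densityMeasure f))

/-- The product, as a measure on `ℝⁿ`, of the `n` one-dimensional marginals of `μ`. -/
def productOfMarginals {n : ℕ} (μ : Measure (EuclideanSpace ℝ (Fin n))) :
    Measure (EuclideanSpace ℝ (Fin n)) :=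
  (Measure.pi fun i : Fin n => μ.map fun x => x i).map (WithLp.toLp 2)

/-- The entropic distance from independence of the measure with density `f`: its relative
entropy from the product of its marginals. -/
def entropyFromIndependence {n : ℕ} (f : EuclideanSpace ℝ (Fin n) → ℝ) : ENNReal :=
  klDiv (densityMeasure f) (productOfMarginals (densityMeasure f))

/-- The centroid of a set `K ⊆ ℝⁿ`. -/
def bodyCentroid {n : ℕ} (K : Set (EuclideanSpace ℝ (Fin n))) : EuclideanSpace ℝ (Fin n) :=
  ⨍ x in K, x

/-- The hyperplane conjecture (slicing problem). The `(n - 1)`-dimensional volume is the Euclidean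
Hausdorff measure `μHE[n - 1]`, which is normalized to agree with `(n - 1)`-dimensional Lebesgue
measure on hyperplanes. -/
def HyperplaneConjecture : Prop :=
  ∃ c : ℝ, 0 < c ∧ ∀ n : ℕ, 1 ≤ n → ∀ K : Set (EuclideanSpace ℝ (Fin n)),
    Convex ℝ K → volume K = 1 →
      ∃ H : AffineSubspace ℝ (EuclideanSpace ℝ (Fin n)),
        bodyCentroid K ∈ H ∧ Module.finrank ℝ H.direction + 1 = n ∧
          ENNReal.ofReal c ≤ Measure.euclideanHausdorffMeasure (n - 1)
            (K ∩ (H : Set (EuclideanSpace ℝ (Fin n))))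

/-- The entropic form of the hyperplane conjecture: `D(f) ≤ c n` for every log-concave density. -/
def EntropicHyperplaneConjecture : Prop :=
  ∃ c : ℝ, ∀ n : ℕ, 1 ≤ n → ∀ f : EuclideanSpace ℝ (Fin n) → ℝ, IsLogConcaveDensity f →
    entropyFromGaussianity f ≤ ENNReal.ofReal (c * n)

/-- The independence form: for every log-concave density whose coordinates are uncorrelated, the
relative entropy from the product of the marginals is at most `c n`. (For strongly correlated
coordinates this relative entropy is unbounded already for Gaussians in the plane.) -/
def EntropicIndependenceConjecture : Prop :=
  ∃ c : ℝ, ∀ n : ℕ, 1 ≤ n → ∀ f : EuclideanSpace ℝ (Fin n) → ℝ, IsLogConcaveDensity f →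
    (covarianceMatrix (densityMeasure f)).IsDiag →
      entropyFromIndependence f ≤ ENNReal.ofReal (c * n)

end

/-! The assertions are linked in a cycle (1) ⇒ (2) ⇒ (3) ⇒ (1), and both relative entropies are
reduced to `∫ f log f`. The logarithm of a Gaussian density is quadratic, so `D(f) = ∫ f log f + (n
log 2π + log det Cov f + n) / 2` (`entropyFromGaussianity_eq`). The distance from independence is `∫
f log f - ∑ ∫ fᵢ log fᵢ`, with `fᵢ` the marginals (`entropyFromIndependence_eq`).

(2) ⇒ (3): for a diagonal covariance matrix the two quantities differ by the sum of the distances of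
the `fᵢ` from Gaussians of equal variance, which is nonnegative by Gibbs' inequality.

(3) ⇒ (1): rotate a body of volume 1 to its principal axes and let `f` be its indicator. Then `∫ f
log f = 0`, so some marginal satisfies `∫ fᵢ log fᵢ ≥ -c`. By Prékopa's theorem `fᵢ` is log-concave,
and Jensen's inequality bounds it below by `exp (-c)` at its barycentre. That value is the volume of
a section through the centroid.

(1) ⇒ (2): it suffices to bound the isotropic constant, `det (Cov f) * (sup f) ^ 2 ≤ C ^ n`, since
this bounds `log f` pointwise and the determinant cancels in `D(f)`. The difference of two
independent copies of `f` has an even log-concave density, and passing to it costs a factor `2 ^ n`.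
An even density `φ` is replaced by Ball's convex body, cut out by a lower bound on `∫ r ^ (n + 1)
φ(r x) dr`. Its second moments are those of `φ` divided by `φ 0`, and its volume is at most a
constant over `φ 0`. In isotropic position all directions have the same second moment, and a central
section of volume at least `c` forces the second moment in its normal direction to be at most `1 /
(2 c ^ 2)`. This bounds the determinant.

Two one-dimensional facts carry the analysis. The inequality `mul_lintegral_add_mul_lintegral_le`
gives both Prékopa's theorem and the convexity of Ball's body. The comparison with exponentials
`integral_pow_add_two_mul_le` gives the volume of Ball's body and the relation between sections and
second moments. -/

noncomputable section

/-! ### Prékopa–Leindler on the line and Prékopa's theorem. -/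

open Set
open scoped ENNReal

/-- Layer cake formula for functions with values in `[0, ∞]`. -/
theorem lintegral_eq_lintegral_measure_ofReal_lt {α : Type*} [MeasurableSpace α] (μ : Measure α)
    [SFinite μ] {f : α → ℝ≥0∞} (hf : Measurable f) :
    ∫⁻ x, f x ∂μ = ∫⁻ t in Ioi (0 : ℝ), μ {x | ENNReal.ofReal t < f x} := by
  have h1 : ∀ x, f x = ∫⁻ t in Ioi (0 : ℝ), {t | ENNReal.ofReal t < f x}.indicator 1 t := by
    intro x
    have hm : MeasurableSet {t : ℝ | ENNReal.ofReal t < f x} :=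
      measurableSet_lt ENNReal.measurable_ofReal measurable_const
    rw [lintegral_indicator_one hm, Measure.restrict_apply hm]
    rcases eq_or_ne (f x) ∞ with h | h
    · simp [h]
    · have : {t : ℝ | ENNReal.ofReal t < f x} ∩ Ioi 0 = Ioo 0 (f x).toReal := by
        ext t
        simp only [mem_inter_iff, mem_ofPred_eq, mem_Ioi, mem_Ioo]
        constructor
        · rintro ⟨h1, h2⟩
          exact ⟨h2, (ENNReal.ofReal_lt_iff_lt_toReal h2.le h).1 h1⟩
        · rintro ⟨h1, h2⟩
          exact ⟨(ENNReal.ofReal_lt_iff_lt_toReal h1.le h).2 h2, h1⟩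
      rw [this, Real.volume_Ioo, sub_zero, ENNReal.ofReal_toReal h]
  calc ∫⁻ x, f x ∂μ
      = ∫⁻ x, (∫⁻ t in Ioi (0 : ℝ), {t | ENNReal.ofReal t < f x}.indicator 1 t) ∂μ :=
        lintegral_congr h1
    _ = ∫⁻ t in Ioi (0 : ℝ), (∫⁻ x, {t | ENNReal.ofReal t < f x}.indicator 1 t ∂μ) := by
        apply lintegral_lintegral_swap
        have : MeasurableSet {p : α × ℝ | ENNReal.ofReal p.2 < f p.1} :=
          measurableSet_lt (ENNReal.measurable_ofReal.comp measurable_snd)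
            (hf.comp measurable_fst)
        exact (measurable_one.indicator this).aemeasurable
    _ = ∫⁻ t in Ioi (0 : ℝ), μ {x | ENNReal.ofReal t < f x} := by
        refine lintegral_congr fun t => ?_
        have : MeasurableSet {x | ENNReal.ofReal t < f x} := measurableSet_lt measurable_const hf
        rw [← lintegral_indicator_one this]
        rfl

/-- Brunn–Minkowski inequality for convex subsets of the line. -/
theorem mul_volume_add_mul_volume_le {I J H : Set ℝ} (hI : I.OrdConnected) (hJ : J.OrdConnected)
    (hI0 : I.Nonempty) (hJ0 : J.Nonempty) {a b : ℝ} (ha : 0 < a) (hb : 0 < b)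
    (h : ∀ s ∈ I, ∀ t ∈ J, a * s + b * t ∈ H) :
    ENNReal.ofReal a * volume I + ENNReal.ofReal b * volume J ≤ volume H := by
  -- The measure of a subset of the line is at most its diameter, so it is enough to treat pairs of
  -- points in `I` and in `J`. Moving both points at once sweeps out an interval inside `H`.
  have key : ∀ s₀ ∈ I, ∀ s₁ ∈ I, ∀ t₀ ∈ J, ∀ t₁ ∈ J,
      ENNReal.ofReal a * edist s₀ s₁ + ENNReal.ofReal b * edist t₀ t₁ ≤ volume H := by
    have aux : ∀ s₀ ∈ I, ∀ s₁ ∈ I, ∀ t₀ ∈ J, ∀ t₁ ∈ J, s₀ ≤ s₁ → t₀ ≤ t₁ →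
        ENNReal.ofReal a * edist s₀ s₁ + ENNReal.ofReal b * edist t₀ t₁ ≤ volume H := by
      intro s₀ h0 s₁ h1 t₀ k0 t₁ k1 hs ht
      have hsub : Icc (a * s₀ + b * t₀) (a * s₁ + b * t₁) ⊆ H := by
        intro x hx
        have hcont : ContinuousOn (fun r : ℝ => a * (s₀ + r * (s₁ - s₀)) + b * (t₀ + r * (t₁ - t₀)))
            (Icc 0 1) := by fun_prop
        have := intermediate_value_Icc (zero_le_one' ℝ) hcont
        obtain ⟨r, hr, rfl⟩ := this ⟨by simpa using hx.1, by simpa using hx.2⟩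
        refine h _ (hI.out h0 h1 ⟨?_, ?_⟩) _ (hJ.out k0 k1 ⟨?_, ?_⟩)
        · nlinarith [hr.1]
        · nlinarith [hr.2]
        · nlinarith [hr.1]
        · nlinarith [hr.2]
      refine le_trans (le_of_eq ?_) (measure_mono hsub)
      rw [Real.volume_Icc, edist_comm, edist_comm t₀, edist_dist, edist_dist, Real.dist_eq,
        Real.dist_eq, abs_of_nonneg (sub_nonneg.2 hs), abs_of_nonneg (sub_nonneg.2 ht),
        ← ENNReal.ofReal_mul ha.le, ← ENNReal.ofReal_mul hb.le, ← ENNReal.ofReal_add]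
      · congr 1; ring
      · exact mul_nonneg ha.le (sub_nonneg.2 hs)
      · exact mul_nonneg hb.le (sub_nonneg.2 ht)
    intro s₀ h0 s₁ h1 t₀ k0 t₁ k1
    rcases le_total s₀ s₁ with hs | hs <;> rcases le_total t₀ t₁ with ht | ht
    · exact aux _ h0 _ h1 _ k0 _ k1 hs ht
    · rw [edist_comm t₀]; exact aux _ h0 _ h1 _ k1 _ k0 hs ht
    · rw [edist_comm s₀]; exact aux _ h1 _ h0 _ k0 _ k1 hs ht
    · rw [edist_comm s₀, edist_comm t₀]; exact aux _ h1 _ h0 _ k1 _ k0 hs ht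
  refine le_trans (add_le_add (mul_le_mul_right (Real.volume_le_diam I) _)
    (mul_le_mul_right (Real.volume_le_diam J) _)) ?_
  obtain ⟨s, hs⟩ := hI0
  obtain ⟨t, ht⟩ := hJ0
  simp only [Metric.ediam, ENNReal.mul_iSup]
  refine ENNReal.biSup_add_biSup_le ⟨s, hs⟩ ⟨t, ht⟩ fun s₀ h0 t₀ k0 =>
    ENNReal.biSup_add_biSup_le ⟨s, hs⟩ ⟨t, ht⟩ fun s₁ h1 t₁ k1 => key s₀ h0 s₁ h1 t₀ k0 t₁ k1

/-- A Prékopa–Leindler type inequality for quasi-concave functions with equal suprema. -/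
theorem mul_lintegral_add_mul_lintegral_le {f g h : ℝ → ℝ≥0∞} (hf : Measurable f)
    (hg : Measurable g) (hh : Measurable h) (hfq : ∀ t, {x | t < f x}.OrdConnected)
    (hgq : ∀ t, {x | t < g x}.OrdConnected) (hsup : ⨆ x, f x = ⨆ x, g x) {a b : ℝ} (ha : 0 < a)
    (hb : 0 < b) (hfg : ∀ s t, min (f s) (g t) ≤ h (a * s + b * t)) :
    ENNReal.ofReal a * (∫⁻ x, f x) + ENNReal.ofReal b * ∫⁻ x, g x ≤ ∫⁻ x, h x := by
  rw [lintegral_eq_lintegral_measure_ofReal_lt _ hf, lintegral_eq_lintegral_measure_ofReal_lt _ hg,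
    lintegral_eq_lintegral_measure_ofReal_lt _ hh]
  have mf : ∀ {f : ℝ → ℝ≥0∞}, Measurable f →
      Measurable fun t : ℝ => volume {x | ENNReal.ofReal t < f x} := by
    intro f hf
    have : MeasurableSet {p : ℝ × ℝ | ENNReal.ofReal p.1 < f p.2} :=
      measurableSet_lt (ENNReal.measurable_ofReal.comp measurable_fst) (hf.comp measurable_snd)
    exact measurable_measure_prodMk_left this
  rw [← lintegral_const_mul _ (mf hf), ← lintegral_const_mul _ (mf hg),
    ← lintegral_add_left ((mf hf).const_mul _)]
  refine lintegral_mono fun t => ?_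
  -- Because the suprema agree, the two superlevel sets at a given height are both nonempty or both
  -- empty. Brunn–Minkowski needs them nonempty.
  by_cases ht : ENNReal.ofReal t < ⨆ x, f x
  · obtain ⟨x, hx⟩ := lt_iSup_iff.1 ht
    obtain ⟨y, hy⟩ := lt_iSup_iff.1 (hsup ▸ ht)
    exact mul_volume_add_mul_volume_le (hfq _) (hgq _) ⟨x, hx⟩ ⟨y, hy⟩ ha hb
      fun s hs t ht => lt_of_lt_of_le (lt_min hs ht) (hfg s t)
  · have h1 : {x | ENNReal.ofReal t < f x} = ∅ := by
      ext x
      simpa using (le_iSup f x).trans (not_lt.1 ht)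
    have h2 : {x | ENNReal.ofReal t < g x} = ∅ := by
      ext x
      simpa using (le_iSup g x).trans (not_lt.1 (hsup ▸ ht))
    simp [h1, h2]

theorem ENNReal.rpow_mul_rpow_le_add {a b : ℝ} (ha : 0 < a) (hb : 0 < b) (hab : a + b = 1)
    (u v : ℝ≥0∞) : u ^ a * v ^ b ≤ ENNReal.ofReal a * u + ENNReal.ofReal b * v := by
  have hpq : Real.HolderConjugate a⁻¹ b⁻¹ := by
    rw [Real.holderConjugate_iff]
    exact ⟨(one_lt_inv₀ ha).2 (by linarith), by simpa using hab⟩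
  refine (ENNReal.young_inequality (u ^ a) (v ^ b) hpq).trans (le_of_eq ?_)
  rw [← ENNReal.rpow_mul, ← ENNReal.rpow_mul, mul_inv_cancel₀ ha.ne', mul_inv_cancel₀ hb.ne',
    ENNReal.rpow_one, ENNReal.rpow_one, div_eq_mul_inv, div_eq_mul_inv,
    ENNReal.ofReal_inv_of_pos ha, ENNReal.ofReal_inv_of_pos hb, inv_inv, inv_inv, mul_comm u,
    mul_comm v]

theorem ENNReal.min_le_rpow_mul_rpow {a b : ℝ} (ha : 0 < a) (hb : 0 < b) (hab : a + b = 1)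
    (u v : ℝ≥0∞) : min u v ≤ u ^ a * v ^ b := by
  calc min u v = (min u v) ^ a * (min u v) ^ b := by
        rw [← ENNReal.rpow_add_of_nonneg _ _ ha.le hb.le, hab, ENNReal.rpow_one]
    _ ≤ u ^ a * v ^ b := mul_le_mul' (ENNReal.rpow_le_rpow (min_le_left _ _) ha.le)
        (ENNReal.rpow_le_rpow (min_le_right _ _) hb.le)

/-- Prékopa–Leindler inequality on the line for bounded quasi-concave functions. -/
theorem lintegral_rpow_mul_le_of_bounded {f g h : ℝ → ℝ≥0∞} (hf : Measurable f)
    (hg : Measurable g) (hh : Measurable h) (hfq : ∀ t, {x | t < f x}.OrdConnected)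
    (hgq : ∀ t, {x | t < g x}.OrdConnected) (hfb : ⨆ x, f x ≠ ∞) (hgb : ⨆ x, g x ≠ ∞)
    {a b : ℝ} (ha : 0 < a) (hb : 0 < b) (hab : a + b = 1)
    (hfg : ∀ s t, f s ^ a * g t ^ b ≤ h (a * s + b * t)) :
    (∫⁻ x, f x) ^ a * (∫⁻ x, g x) ^ b ≤ ∫⁻ x, h x := by
  set F := ⨆ x, f x with hF
  set G := ⨆ x, g x with hG
  rcases eq_or_ne F 0 with hF0 | hF0
  · have : ∀ x, f x = 0 := fun x => le_antisymm (hF0 ▸ le_iSup f x) bot_le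
    simp [this, ha]
  rcases eq_or_ne G 0 with hG0 | hG0
  · have : ∀ x, g x = 0 := fun x => le_antisymm (hG0 ▸ le_iSup g x) bot_le
    simp [this, hb]
  have scale : ∀ {f : ℝ → ℝ≥0∞} {c : ℝ≥0∞}, c ≠ 0 → c ≠ ∞ →
      (∀ t, {x | t < f x}.OrdConnected) → ∀ t, {x | t < c⁻¹ * f x}.OrdConnected := by
    intro f c h0 h1 hq t
    have : {x | t < c⁻¹ * f x} = {x | t * c < f x} := by
      ext x
      rw [mem_ofPred_eq, mem_ofPred_eq, mul_comm, ← div_eq_mul_inv,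
        ENNReal.lt_div_iff_mul_lt (Or.inl h0) (Or.inl h1)]
    rw [this]; exact hq _
  set c := F ^ a * G ^ b with hc
  have hc0 : c ≠ 0 := mul_ne_zero (ENNReal.rpow_pos (pos_iff_ne_zero.2 hF0) hfb).ne'
    (ENNReal.rpow_pos (pos_iff_ne_zero.2 hG0) hgb).ne'
  have hc1 : c ≠ ∞ := ENNReal.mul_ne_top (ENNReal.rpow_ne_top_of_nonneg ha.le hfb)
    (ENNReal.rpow_ne_top_of_nonneg hb.le hgb)
  have hcinv : c⁻¹ = F⁻¹ ^ a * G⁻¹ ^ b := by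
    rw [hc, ENNReal.mul_inv (Or.inl (ENNReal.rpow_pos (pos_iff_ne_zero.2 hF0) hfb).ne')
      (Or.inl (ENNReal.rpow_ne_top_of_nonneg ha.le hfb)), ENNReal.inv_rpow, ENNReal.inv_rpow]
  have hsplit : ∀ u v : ℝ≥0∞, (F⁻¹ * u) ^ a * (G⁻¹ * v) ^ b = c⁻¹ * (u ^ a * v ^ b) := by
    intro u v
    rw [hcinv, ENNReal.mul_rpow_of_nonneg _ _ ha.le, ENNReal.mul_rpow_of_nonneg _ _ hb.le]
    ring
  -- Division by the suprema makes both equal to 1. The minimum lies below the geometric mean, so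
  -- the additive inequality applies, and the geometric mean of the two integrals lies below their
  -- arithmetic mean.
  have key := mul_lintegral_add_mul_lintegral_le (f := fun x => F⁻¹ * f x)
    (g := fun x => G⁻¹ * g x) (h := fun x => c⁻¹ * h x) (hf.const_mul _) (hg.const_mul _)
    (hh.const_mul _) (scale hF0 hfb hfq) (scale hG0 hgb hgq) (by
      rw [← ENNReal.mul_iSup, ← ENNReal.mul_iSup, ← hF, ← hG, ENNReal.inv_mul_cancel hF0 hfb,
        ENNReal.inv_mul_cancel hG0 hgb]) ha hb (fun s t => by
      refine (ENNReal.min_le_rpow_mul_rpow ha hb hab _ _).trans ?_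
      rw [hsplit]
      exact mul_le_mul_right (hfg s t) _)
  rw [lintegral_const_mul _ hf, lintegral_const_mul _ hg, lintegral_const_mul _ hh] at key
  have := (ENNReal.rpow_mul_rpow_le_add ha hb hab _ _).trans key
  rw [hsplit] at this
  exact (ENNReal.mul_le_mul_iff_right (ENNReal.inv_ne_zero.2 hc1)
    (ENNReal.inv_ne_top.2 hc0)).1 this

/-- Prékopa–Leindler inequality on the line for quasi-concave functions. -/
theorem lintegral_rpow_mul_le {f g h : ℝ → ℝ≥0∞} (hf : Measurable f)
    (hg : Measurable g) (hh : Measurable h) (hfq : ∀ t, {x | t < f x}.OrdConnected)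
    (hgq : ∀ t, {x | t < g x}.OrdConnected)
    {a b : ℝ} (ha : 0 < a) (hb : 0 < b) (hab : a + b = 1)
    (hfg : ∀ s t, f s ^ a * g t ^ b ≤ h (a * s + b * t)) :
    (∫⁻ x, f x) ^ a * (∫⁻ x, g x) ^ b ≤ ∫⁻ x, h x := by
  -- Truncation at a finite height keeps superlevel sets order-connected and makes the suprema
  -- finite; monotone convergence removes it at the end.
  have trunc : ∀ {f : ℝ → ℝ≥0∞}, Measurable f →
      ∫⁻ x, f x = ⨆ k : ℕ, ∫⁻ x, min (f x) k := by
    intro f hf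
    rw [← lintegral_iSup (fun k => hf.min measurable_const)]
    · refine lintegral_congr fun x => ?_
      refine le_antisymm (le_of_forall_lt fun y hy => ?_) (iSup_le fun k => min_le_left _ _)
      obtain ⟨k, hk⟩ := ENNReal.exists_nat_gt hy.ne_top
      exact lt_iSup_iff.2 ⟨k, lt_min hy hk⟩
    · intro k l hkl x
      exact min_le_min le_rfl (by exact_mod_cast hkl)
  have quasi : ∀ {f : ℝ → ℝ≥0∞} (k : ℕ), (∀ t, {x | t < f x}.OrdConnected) →
      ∀ t, {x | t < min (f x) k}.OrdConnected := by
    intro f k hq t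
    by_cases hk : t < k
    · simpa [hk] using hq t
    · simpa [hk] using ordConnected_empty
  have bdd : ∀ (f : ℝ → ℝ≥0∞) (k : ℕ), ⨆ x, min (f x) k ≠ ∞ := fun f k =>
    ne_top_of_le_ne_top (ENNReal.natCast_ne_top k) (iSup_le fun x => min_le_right _ _)
  have key : ∀ k l : ℕ, (∫⁻ x, min (f x) k) ^ a * (∫⁻ x, min (g x) l) ^ b ≤ ∫⁻ x, h x := by
    intro k l
    refine lintegral_rpow_mul_le_of_bounded (hf.min measurable_const) (hg.min measurable_const)
      hh (quasi k hfq) (quasi l hgq) (bdd f k) (bdd g l) ha hb hab fun s t => ?_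
    exact (mul_le_mul' (ENNReal.rpow_le_rpow (min_le_left _ _) ha.le)
      (ENNReal.rpow_le_rpow (min_le_left _ _) hb.le)).trans (hfg s t)
  rw [trunc hf, trunc hg]
  have h1 : ∀ (u : ℕ → ℝ≥0∞) {a : ℝ}, 0 < a → (⨆ k, u k) ^ a = ⨆ k, u k ^ a := fun u a ha =>
    (ENNReal.orderIsoRpow a ha).map_iSup u
  rw [h1 _ ha, h1 _ hb, ENNReal.iSup_mul]
  refine iSup_le fun k => ?_
  rw [ENNReal.mul_iSup]
  exact iSup_le fun l => key k l

/-- Log-concave functions with values in `[0, ∞]`. -/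
def IsLogConcave {E : Type*} [AddCommGroup E] [Module ℝ E] (F : E → ℝ≥0∞) : Prop :=
  ∀ x y : E, ∀ a b : ℝ, 0 < a → 0 < b → a + b = 1 → F x ^ a * F y ^ b ≤ F (a • x + b • y)

namespace IsLogConcave

variable {E E' : Type*} [AddCommGroup E] [Module ℝ E] [AddCommGroup E'] [Module ℝ E']

theorem comp_linearMap {F : E → ℝ≥0∞} (hF : IsLogConcave F) (L : E' →ₗ[ℝ] E) :
    IsLogConcave fun x => F (L x) := fun x y a b ha hb hab => by
  simpa using hF (L x) (L y) a b ha hb hab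

theorem comp_add {F : E → ℝ≥0∞} (hF : IsLogConcave F) (c : E) :
    IsLogConcave fun x => F (x + c) := fun x y a b ha hb hab => by
  have := hF (x + c) (y + c) a b ha hb hab
  have e : a • (x + c) + b • (y + c) = a • x + b • y + c := by
    rw [smul_add, smul_add, add_add_add_comm, ← add_smul, hab, one_smul]
  rwa [e] at this

theorem mul {F G : E → ℝ≥0∞} (hF : IsLogConcave F) (hG : IsLogConcave G) :
    IsLogConcave fun x => F x * G x := fun x y a b ha hb hab => by
  refine le_trans (le_of_eq ?_) (mul_le_mul' (hF x y a b ha hb hab) (hG x y a b ha hb hab))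
  rw [ENNReal.mul_rpow_of_nonneg _ _ ha.le, ENNReal.mul_rpow_of_nonneg _ _ hb.le]
  ring

theorem min_le {F : E → ℝ≥0∞} (hF : IsLogConcave F) (x y : E) {a b : ℝ} (ha : 0 < a) (hb : 0 < b)
    (hab : a + b = 1) : min (F x) (F y) ≤ F (a • x + b • y) :=
  (ENNReal.min_le_rpow_mul_rpow ha hb hab _ _).trans (hF x y a b ha hb hab)

theorem convex_lt {F : E → ℝ≥0∞} (hF : IsLogConcave F) (t : ℝ≥0∞) : Convex ℝ {x | t < F x} :=
  convex_iff_forall_pos.2 fun x hx y hy _ _ ha hb hab =>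
    lt_of_lt_of_le (lt_min hx hy) (hF.min_le x y ha hb hab)

/-- Prékopa's theorem for marginals along a line. -/
theorem lintegral_real {F : E × ℝ → ℝ≥0∞} (hF : IsLogConcave F)
    (hm : ∀ x, Measurable fun t => F (x, t)) : IsLogConcave fun x => ∫⁻ t, F (x, t) := by
  intro x y a b ha hb hab
  have quasi : ∀ (x : E) (t : ℝ≥0∞), {s : ℝ | t < F (x, s)}.OrdConnected := by
    intro x t
    refine Convex.ordConnected (convex_iff_forall_pos.2 fun r hr s hs a b ha hb hab => ?_)
    have := hF.convex_lt t hr hs ha.le hb.le hab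
    simpa [← add_smul, hab] using this
  refine lintegral_rpow_mul_le (hm x) (hm y) (hm _) (quasi x) (quasi y) ha hb hab fun s t => ?_
  simpa using hF (x, s) (y, t) a b ha hb hab

/-- Prékopa's theorem. -/
theorem lintegral_pi {m : ℕ} : ∀ {E : Type*} [AddCommGroup E] [Module ℝ E]
    {F : E × (Fin m → ℝ) → ℝ≥0∞}, IsLogConcave F → (∀ x, Measurable fun t => F (x, t)) →
    IsLogConcave fun x => ∫⁻ t, F (x, t) := by
  induction m with
  | zero =>
    intro E _ _ F hF _
    have : (fun x => ∫⁻ t, F (x, t)) = fun x => F (x, 0) := by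
      ext x
      rw [lintegral_unique, volume_pi, Measure.pi_univ, Finset.univ_eq_empty, Finset.prod_empty,
        mul_one]
      exact congrArg (fun t => F (x, t)) (Subsingleton.elim _ _)
    rw [this]
    exact hF.comp_linearMap (LinearMap.inl ℝ E (Fin 0 → ℝ))
  | succ m ih =>
    intro E _ _ F hF hm
    have e := volume_preserving_piFinSuccAbove (fun _ : Fin (m + 1) => ℝ) 0
    have h1 : ∀ x, ∫⁻ t, F (x, t) = ∫⁻ s : ℝ, ∫⁻ t : Fin m → ℝ, F (x, Fin.insertNth (α := fun _ => ℝ) 0 s t) := by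
      intro x
      rw [← (e.symm).lintegral_comp (hm x), Measure.volume_eq_prod, lintegral_prod]
      · rfl
      · exact ((hm x).comp (MeasurableEquiv.measurable _)).aemeasurable
    have hcons : ∀ x, Measurable fun p : ℝ × (Fin m → ℝ) => F (x, Fin.insertNth (α := fun _ => ℝ) 0 p.1 p.2) := fun x =>
      (hm x).comp (MeasurableEquiv.piFinSuccAbove (fun _ : Fin (m + 1) => ℝ) 0).symm.measurable
    simp_rw [h1]
    -- The induction hypothesis is applied with `E × ℝ` in place of `E`, which is why `E` is
    -- quantified inside the induction. One real variable then remains to be integrated out.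
    let L : (E × ℝ) × (Fin m → ℝ) →ₗ[ℝ] E × (Fin (m + 1) → ℝ) :=
      { toFun := fun p => (p.1.1, Fin.insertNth (α := fun _ => ℝ) 0 p.1.2 p.2)
        map_add' := fun p q => by
          refine Prod.ext rfl (funext fun i => ?_)
          refine Fin.cases ?_ (fun i => ?_) i <;> simp
        map_smul' := fun c p => by
          refine Prod.ext rfl (funext fun i => ?_)
          refine Fin.cases ?_ (fun i => ?_) i <;> simp [Fin.insertNth_zero'] }
    have h2 := ih (hF.comp_linearMap L) fun x =>
      (hcons x.1).comp (measurable_prodMk_left (x := x.2))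
    exact h2.lintegral_real fun x => (hcons x).lintegral_prod_right

end IsLogConcave

end

/-! ### Exponential decay of log-concave densities and integrability. -/

noncomputable section

open Set
open scoped ENNReal

namespace IsLogConcave

variable {E : Type*} [NormedAddCommGroup E] [NormedSpace ℝ E] [FiniteDimensional ℝ E]
  [MeasurableSpace E] [BorelSpace E] {μ : Measure E} [μ.IsAddHaarMeasure]

/-- A nonzero integral gives some superlevel set positive measure. A convex set with empty interior
lies in its own frontier, which is null, so this superlevel set contains a ball. -/
theorem exists_ball_le {F : E → ℝ≥0∞} (hF : IsLogConcave F) (h0 : ∫⁻ x, F x ∂μ ≠ 0) :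
    ∃ (x₀ : E) (r : ℝ) (δ : ℝ), 0 < r ∧ 0 < δ ∧
      ∀ y ∈ Metric.ball x₀ r, ENNReal.ofReal δ ≤ F y := by
  have h1 : μ (⋃ k : ℕ, {x | (k + 1 : ℝ≥0∞)⁻¹ < F x}) ≠ 0 := by
    intro h
    refine h0 ?_
    have : ∀ᵐ x ∂μ, F x = 0 := by
      filter_upwards [measure_eq_zero_iff_ae_notMem.1 h] with x hx
      by_contra hne
      obtain ⟨k, hk⟩ := ENNReal.exists_inv_nat_lt hne
      refine hx (mem_iUnion.2 ⟨k, lt_of_le_of_lt ?_ hk⟩)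
      exact ENNReal.inv_le_inv.2 (le_self_add)
    rw [lintegral_congr_ae this, lintegral_zero]
  obtain ⟨k, hk⟩ : ∃ k : ℕ, μ {x | (k + 1 : ℝ≥0∞)⁻¹ < F x} ≠ 0 := by
    by_contra! h
    exact h1 (measure_iUnion_null h)
  set S := {x | (k + 1 : ℝ≥0∞)⁻¹ < F x} with hS
  have hconv : Convex ℝ S := hF.convex_lt _
  have hne : (interior S).Nonempty := by
    by_contra h
    rw [not_nonempty_iff_eq_empty] at h
    refine hk (measure_mono_null ?_ (hconv.addHaar_frontier μ))
    rw [frontier, h, sdiff_empty]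
    exact subset_closure
  obtain ⟨x₀, hx₀⟩ := hne
  obtain ⟨r, hr, hball⟩ := Metric.isOpen_iff.1 isOpen_interior x₀ hx₀
  refine ⟨x₀, r, ((k : ℝ) + 1)⁻¹, hr, by positivity, fun y hy => ?_⟩
  have := interior_subset (hball hy)
  refine le_trans (le_of_eq ?_) this.le
  rw [ENNReal.ofReal_inv_of_pos (by positivity)]
  congr 1
  rw [ENNReal.ofReal_add (by positivity) zero_le_one]
  simp

-- The ball about `l • x` is the image of the ball about the origin under the homothety with centre
-- `x` and ratio `1 - l`, so each of its points is a convex combination of `x` and a point where `F`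
-- is at least `δ`.
omit [FiniteDimensional ℝ E] [MeasurableSpace E] [BorelSpace E] in
theorem le_on_ball {F : E → ℝ≥0∞} (hF : IsLogConcave F) {r : ℝ} {δ : ℝ≥0∞}
    (hball : ∀ y ∈ Metric.ball (0 : E) r, δ ≤ F y) (x : E) {l : ℝ} (hl0 : 0 < l) (hl1 : l < 1)
    {y : E} (hy : y ∈ Metric.ball (l • x) ((1 - l) * r)) :
    F x ^ l * δ ^ (1 - l) ≤ F y := by
  have h1 : 0 < 1 - l := by linarith
  have hz : (1 - l)⁻¹ • (y - l • x) ∈ Metric.ball (0 : E) r := by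
    rw [mem_ball_iff_norm] at hy
    rw [mem_ball_zero_iff, norm_smul, Real.norm_eq_abs, abs_of_pos (inv_pos.2 h1),
      inv_mul_lt_iff₀ h1]
    exact hy
  have := hF x ((1 - l)⁻¹ • (y - l • x)) l (1 - l) hl0 h1 (by ring)
  rw [smul_smul, mul_inv_cancel₀ h1.ne', one_smul, add_sub_cancel] at this
  exact (mul_le_mul_right (ENNReal.rpow_le_rpow (hball _ hz) h1.le) _).trans this

/-- A large value at `x` forces values of the order of its square root on a ball of fixed volume
about `x / 2`, which is incompatible with a finite integral. -/
theorem exists_le_of_ball {F : E → ℝ≥0∞} (hF : IsLogConcave F)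
    (hI : ∫⁻ x, F x ∂μ ≠ ∞) {r δ : ℝ} (hr : 0 < r) (hδ : 0 < δ)
    (hball : ∀ y ∈ Metric.ball (0 : E) r, ENNReal.ofReal δ ≤ F y) :
    ∃ B : ℝ, 0 ≤ B ∧ ∀ x, F x ≤ ENNReal.ofReal B := by
  set I := ∫⁻ x, F x ∂μ with hI'
  set v := μ (Metric.ball (0 : E) ((1 - 2⁻¹) * r)) with hv
  have hv0 : v ≠ 0 := (Metric.measure_ball_pos μ _ (by linarith)).ne'
  have hv1 : v ≠ ∞ := measure_ball_lt_top.ne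
  set d := ENNReal.ofReal δ ^ (1 - 2⁻¹ : ℝ) with hd
  have hd0 : d ≠ 0 := (ENNReal.rpow_pos (by simpa using hδ) (by simp)).ne'
  have hd1 : d ≠ ∞ := ENNReal.rpow_ne_top_of_nonneg (by norm_num) (by simp)
  have key : ∀ x, F x ≤ (I / (d * v)) ^ (2 : ℝ) := by
    intro x
    have h1 : F x ^ (2⁻¹ : ℝ) * d * v ≤ I := by
      rw [hv, ← Measure.addHaar_ball_center μ ((2⁻¹ : ℝ) • x), ← setLIntegral_const]
      refine (setLIntegral_mono_ae' measurableSet_ball (ae_of_all _ fun y hy => ?_)).trans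
        (setLIntegral_le_lintegral _ _)
      exact hF.le_on_ball hball x (by norm_num) (by norm_num) hy
    have h2 : F x ^ (2⁻¹ : ℝ) ≤ I / (d * v) := by
      rw [ENNReal.le_div_iff_mul_le (Or.inl (mul_ne_zero hd0 hv0))
        (Or.inl (ENNReal.mul_ne_top hd1 hv1)), ← mul_assoc]
      exact h1
    calc F x = (F x ^ (2⁻¹ : ℝ)) ^ (2 : ℝ) := by rw [← ENNReal.rpow_mul]; norm_num
      _ ≤ _ := ENNReal.rpow_le_rpow h2 (by norm_num)
  have hfin : (I / (d * v)) ^ (2 : ℝ) ≠ ∞ := ENNReal.rpow_ne_top_of_nonneg (by norm_num)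
    (ENNReal.div_ne_top hI (mul_ne_zero hd0 hv0))
  exact ⟨_, ENNReal.toReal_nonneg, fun x => (key x).trans (ENNReal.ofReal_toReal hfin).ge⟩

/-- If `F x ≥ ε` at a distant point, then `F ≥ ε` on many disjoint balls placed along the segment
from the origin to `x`, and their total mass exceeds the integral. -/
theorem exists_lt_of_far {F : E → ℝ≥0∞} (hF : IsLogConcave F)
    (hI : ∫⁻ x, F x ∂μ ≠ ∞) {r δ ε : ℝ} (hr : 0 < r) (hε : 0 < ε) (hεδ : ε ≤ δ)
    (hball : ∀ y ∈ Metric.ball (0 : E) r, ENNReal.ofReal δ ≤ F y) :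
    ∃ R : ℝ, 0 < R ∧ ∀ x : E, R ≤ ‖x‖ → F x < ENNReal.ofReal ε := by
  set I := ∫⁻ x, F x ∂μ with hI'
  set v := μ (Metric.ball (0 : E) (r / 2)) with hv
  have hv0 : v ≠ 0 := (Metric.measure_ball_pos μ _ (by linarith)).ne'
  have hv1 : v ≠ ∞ := measure_ball_lt_top.ne
  have he0 : ENNReal.ofReal ε ≠ 0 := by simpa using hε
  obtain ⟨N, hN⟩ := ENNReal.exists_nat_gt (ENNReal.div_ne_top hI (mul_ne_zero he0 hv0))
  rw [ENNReal.div_lt_iff (Or.inl (mul_ne_zero he0 hv0))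
    (Or.inl (ENNReal.mul_ne_top ENNReal.ofReal_ne_top hv1))] at hN
  have hNpos : 0 < N := by
    rcases Nat.eq_zero_or_pos N with h | h
    · simp [h] at hN
    · exact h
  have hNr : (0 : ℝ) < N := by exact_mod_cast hNpos
  -- The `N` balls have radius `r / 2` and centres at distances `r, 2r, …, N r` from the origin. The
  -- factor 2 keeps the ratio `l` at most `1 / 2`, so the radius `(1 - l) * r` in `le_on_ball` is at
  -- least `r / 2`.
  refine ⟨2 * r * N, by positivity, fun x hx => ?_⟩
  by_contra! hcon
  have hxpos : 0 < ‖x‖ := lt_of_lt_of_le (by positivity) hx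
  refine absurd ?_ (not_le.2 hN)
  let c : ℕ → E := fun k => ((k + 1 : ℕ) * r / ‖x‖) • x
  let B : ℕ → Set E := fun k => Metric.ball (c k) (r / 2)
  have hdist : ∀ k l : ℕ, dist (c k) (c l) = |(k : ℝ) - l| * r := by
    intro k l
    simp only [c, dist_eq_norm, ← sub_smul, norm_smul, Real.norm_eq_abs]
    rw [← sub_div, ← sub_mul, abs_div, abs_mul, abs_of_pos hr, abs_of_pos hxpos]
    push_cast
    rw [add_sub_add_right_eq_sub, div_mul_cancel₀ _ hxpos.ne']
  have hdisj : (↑(Finset.range N) : Set ℕ).PairwiseDisjoint B := by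
    intro k _ l _ hkl
    refine Metric.ball_disjoint_ball ?_
    rw [hdist]
    have : (1 : ℝ) ≤ |(k : ℝ) - l| := by
      have : (1 : ℤ) ≤ |(k : ℤ) - l| := Int.one_le_abs (sub_ne_zero.2 (by exact_mod_cast hkl))
      exact_mod_cast this
    nlinarith
  have hle : ∀ k ∈ Finset.range N, ∀ y ∈ B k, ENNReal.ofReal ε ≤ F y := by
    intro k hk y hy
    have hkN : ((k + 1 : ℕ) : ℝ) ≤ N := by exact_mod_cast Finset.mem_range.1 hk
    have hk0 : (0 : ℝ) < ((k + 1 : ℕ) : ℝ) := by positivity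
    set l := ((k + 1 : ℕ) : ℝ) * r / ‖x‖ with hl
    have hl0 : 0 < l := by positivity
    have hl2 : l ≤ 1 / 2 := by
      rw [hl, div_le_iff₀ hxpos]
      nlinarith
    have h1 := hF.le_on_ball hball x hl0 (by linarith) (y := y)
      (Metric.ball_subset_ball (by nlinarith) hy)
    refine le_trans ?_ h1
    refine le_trans ?_ (ENNReal.min_le_rpow_mul_rpow hl0 (by linarith) (by ring) _ _)
    exact le_min hcon (ENNReal.ofReal_le_ofReal hεδ)
  calc (N : ℝ≥0∞) * (ENNReal.ofReal ε * v)
      = ∑ k ∈ Finset.range N, ENNReal.ofReal ε * μ (B k) := by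
        simp [B, Measure.addHaar_ball_center μ _ (r / 2), hv]
    _ ≤ ∑ k ∈ Finset.range N, ∫⁻ y in B k, F y ∂μ := by
        refine Finset.sum_le_sum fun k hk => ?_
        rw [← setLIntegral_const]
        exact setLIntegral_mono_ae' measurableSet_ball (ae_of_all _ fun y hy => hle k hk y hy)
    _ = ∫⁻ y in ⋃ k ∈ Finset.range N, B k, F y ∂μ :=
        (lintegral_biUnion_finset hdisj (fun _ _ => measurableSet_ball) _).symm
    _ ≤ I := setLIntegral_le_lintegral _ _

/-- An integrable log-concave function decays exponentially. -/
theorem exists_le_exp {F : E → ℝ≥0∞} (hF : IsLogConcave F)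
    (h0 : ∫⁻ x, F x ∂μ ≠ 0) (hI : ∫⁻ x, F x ∂μ ≠ ∞) :
    ∃ C c : ℝ, 0 < C ∧ 0 < c ∧ ∀ x, F x ≤ ENNReal.ofReal (C * Real.exp (-c * ‖x‖)) := by
  obtain ⟨x₀, r, δ, hr, hδ, hball⟩ := hF.exists_ball_le h0
  set G : E → ℝ≥0∞ := fun x => F (x + x₀) with hG
  have hGl : IsLogConcave G := hF.comp_add x₀
  have hGI : ∫⁻ x, G x ∂μ ≠ ∞ := by rwa [hG, lintegral_add_right_eq_self]
  have hGb : ∀ y ∈ Metric.ball (0 : E) r, ENNReal.ofReal δ ≤ G y := fun y hy =>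
    hball _ (by simpa [dist_eq_norm] using hy)
  obtain ⟨B, hB0, hB⟩ := hGl.exists_le_of_ball hGI hr hδ hGb
  -- Beyond `R` the function is below `δ / e`, while at the origin it is at least `δ`. Log-concavity
  -- along a ray turns this drop over the length `R` into the bound `δ * exp (-‖x‖ / R)` further
  -- out.
  obtain ⟨R, hR, hfar⟩ := hGl.exists_lt_of_far hGI (ε := δ * Real.exp (-1)) hr (by positivity)
    (mul_le_of_le_one_right hδ.le (Real.exp_le_one_iff.2 (by norm_num))) hGb
  have key : ∀ x, G x ≤ ENNReal.ofReal ((δ + B * Real.exp 1) * Real.exp (-(1 / R) * ‖x‖)) := by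
    intro x
    rcases le_or_gt ‖x‖ R with hx | hx
    · refine (hB x).trans (ENNReal.ofReal_le_ofReal ?_)
      have h1 : Real.exp (-1) ≤ Real.exp (-(1 / R) * ‖x‖) := by
        apply Real.exp_le_exp.2
        have : 1 / R * ‖x‖ ≤ 1 := by rw [one_div, inv_mul_le_iff₀ hR]; linarith
        linarith
      calc B = B * Real.exp 1 * Real.exp (-1) := by rw [mul_assoc, ← Real.exp_add]; simp
        _ ≤ (δ + B * Real.exp 1) * Real.exp (-(1 / R) * ‖x‖) := by gcongr; linarith
    · have hxpos : 0 < ‖x‖ := hR.trans hx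
      set l := R / ‖x‖ with hl
      have hl0 : 0 < l := by positivity
      have hl1 : l < 1 := (div_lt_one hxpos).2 hx
      have hfin : G x ≠ ∞ := ((hB x).trans_lt ENNReal.ofReal_lt_top).ne
      have h1 := hGl.le_on_ball hGb x hl0 hl1 (y := l • x)
        (Metric.mem_ball_self (mul_pos (by linarith) hr))
      have h2 := hfar (l • x) (by
        rw [norm_smul, Real.norm_eq_abs, abs_of_pos hl0, hl, div_mul_cancel₀ _ hxpos.ne'])
      have h3 := h1.trans h2.le
      set u := (G x).toReal with hu
      have hu0 : 0 ≤ u := ENNReal.toReal_nonneg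
      rw [← ENNReal.ofReal_toReal hfin, ← hu, ENNReal.ofReal_rpow_of_nonneg hu0 hl0.le,
        ENNReal.ofReal_rpow_of_pos hδ, ← ENNReal.ofReal_mul (by positivity),
        ENNReal.ofReal_le_ofReal_iff (by positivity)] at h3
      rw [← ENNReal.ofReal_toReal hfin, ← hu]
      refine ENNReal.ofReal_le_ofReal ?_
      have h4 : u ^ l ≤ (δ * Real.exp (-(1 / R) * ‖x‖)) ^ l := by
        rw [Real.mul_rpow hδ.le (Real.exp_pos _).le, ← Real.exp_mul]
        have e1 : -(1 / R) * ‖x‖ * l = -1 := by rw [hl]; field_simp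
        rw [e1]
        have e2 : δ = δ ^ l * δ ^ (1 - l) := by
          rw [← Real.rpow_add hδ]; simp
        have hp : 0 < δ ^ (1 - l) := Real.rpow_pos_of_pos hδ _
        refine le_of_mul_le_mul_right (h3.trans (le_of_eq ?_)) hp
        nth_rewrite 1 [e2]
        ring
      have h5 : u ≤ δ * Real.exp (-(1 / R) * ‖x‖) :=
        (Real.rpow_le_rpow_iff hu0 (by positivity) hl0).1 h4
      refine h5.trans ?_
      gcongr
      have : 0 ≤ B * Real.exp 1 := by positivity
      linarith
  refine ⟨(δ + B * Real.exp 1) * Real.exp (1 / R * ‖x₀‖), 1 / R, by positivity, by positivity,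
    fun x => ?_⟩
  have := key (x - x₀)
  simp only [hG, sub_add_cancel] at this
  refine this.trans (ENNReal.ofReal_le_ofReal ?_)
  rw [mul_assoc, ← Real.exp_add]
  gcongr
  have h1 : ‖x‖ ≤ ‖x - x₀‖ + ‖x₀‖ := by simpa using norm_add_le (x - x₀) x₀
  have h2 : (0 : ℝ) < 1 / R := by positivity
  nlinarith

end IsLogConcave

theorem integrable_one_add_norm_pow_mul_exp {E : Type*} [NormedAddCommGroup E] [NormedSpace ℝ E]
    [FiniteDimensional ℝ E] [MeasurableSpace E] [BorelSpace E] (μ : Measure E)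
    [μ.IsAddHaarMeasure] (k : ℕ) {c : ℝ} (hc : 0 < c) :
    Integrable (fun x : E => (1 + ‖x‖) ^ k * Real.exp (-c * ‖x‖)) μ := by
  -- The power `(1 + ‖x‖) ^ (-m)` is integrable for this `m`, so the exponential is compared with
  -- the term of degree `k + m` of its series.
  set m := Module.finrank ℝ E + 1 with hm
  have h := integrable_one_add_norm (E := E) (μ := μ) (r := (m : ℝ)) (by simp [hm])
  refine (h.const_mul (Real.exp c * (k + m).factorial / c ^ (k + m))).mono'
    (Continuous.aestronglyMeasurable (by fun_prop)) (ae_of_all _ fun x => ?_)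
  have hx : 0 < 1 + ‖x‖ := by positivity
  rw [Real.norm_of_nonneg (by positivity), Real.rpow_neg hx.le, Real.rpow_natCast]
  have h1 := Real.pow_div_factorial_le_exp (c * (1 + ‖x‖)) (by positivity) (k + m)
  have h2 : Real.exp (-c * ‖x‖) = Real.exp c * (Real.exp (c * (1 + ‖x‖)))⁻¹ := by
    rw [← Real.exp_neg, ← Real.exp_add]; congr 1; ring
  have h3 : (Real.exp (c * (1 + ‖x‖)))⁻¹ ≤ ((c * (1 + ‖x‖)) ^ (k + m) / (k + m).factorial)⁻¹ :=
    inv_anti₀ (by positivity) h1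
  calc (1 + ‖x‖) ^ k * Real.exp (-c * ‖x‖)
      ≤ (1 + ‖x‖) ^ k * (Real.exp c * ((c * (1 + ‖x‖)) ^ (k + m) / (k + m).factorial)⁻¹) := by
        rw [h2]; gcongr
    _ = Real.exp c * (k + m).factorial / c ^ (k + m) * ((1 + ‖x‖) ^ m)⁻¹ := by
        rw [mul_pow, pow_add (1 + ‖x‖)]
        field_simp

/-- Log-concave probability densities on a real vector space with a volume. -/
structure LogConcaveDensity {E : Type*} [AddCommGroup E] [Module ℝ E] [MeasureSpace E]
    (f : E → ℝ) : Prop where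
  measurable : Measurable f
  nonneg : ∀ x, 0 ≤ f x
  logConcave : ∀ x y : E, ∀ a b : ℝ, 0 < a → 0 < b → a + b = 1 →
    f x ^ a * f y ^ b ≤ f (a • x + b • y)
  integral_eq_one : ∫ x, f x = 1

namespace LogConcaveDensity

section
variable {E : Type*} [AddCommGroup E] [Module ℝ E] [MeasureSpace E] {f : E → ℝ}

theorem integrable (hf : LogConcaveDensity f) : Integrable f :=
  Integrable.of_integral_ne_zero (by simp [hf.integral_eq_one])

theorem isLogConcave (hf : LogConcaveDensity f) : IsLogConcave fun x => ENNReal.ofReal (f x) := by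
  intro x y a b ha hb hab
  rw [ENNReal.ofReal_rpow_of_nonneg (hf.nonneg x) ha.le,
    ENNReal.ofReal_rpow_of_nonneg (hf.nonneg y) hb.le,
    ← ENNReal.ofReal_mul (Real.rpow_nonneg (hf.nonneg x) _)]
  exact ENNReal.ofReal_le_ofReal (hf.logConcave x y a b ha hb hab)

theorem lintegral_eq_one (hf : LogConcaveDensity f) : ∫⁻ x, ENNReal.ofReal (f x) = 1 := by
  rw [← ofReal_integral_eq_lintegral_ofReal hf.integrable (ae_of_all _ hf.nonneg),
    hf.integral_eq_one, ENNReal.ofReal_one]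

theorem of_isLogConcave {F : E → ℝ≥0∞} (hF : IsLogConcave F) (hm : Measurable F)
    (hfin : ∀ x, F x ≠ ∞) (h1 : ∫⁻ x, F x = 1) : LogConcaveDensity fun x => (F x).toReal where
  measurable := hm.ennreal_toReal
  nonneg x := ENNReal.toReal_nonneg
  logConcave x y a b ha hb hab := by
    rw [ENNReal.toReal_rpow, ENNReal.toReal_rpow, ← ENNReal.toReal_mul]
    exact ENNReal.toReal_mono (hfin _) (hF x y a b ha hb hab)
  integral_eq_one := by
    rw [integral_toReal hm.aemeasurable (ae_of_all _ fun x => (hfin x).lt_top), h1,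
      ENNReal.toReal_one]

end

variable {E : Type*} [NormedAddCommGroup E] [NormedSpace ℝ E] [FiniteDimensional ℝ E]
  [MeasureSpace E] [BorelSpace E] [(volume : Measure E).IsAddHaarMeasure] {f : E → ℝ}

theorem exists_le_exp (hf : LogConcaveDensity f) :
    ∃ C c : ℝ, 0 < C ∧ 0 < c ∧ ∀ x, f x ≤ C * Real.exp (-c * ‖x‖) := by
  obtain ⟨C, c, hC, hc, h⟩ := hf.isLogConcave.exists_le_exp (μ := volume)
    (by simp [hf.lintegral_eq_one]) (by simp [hf.lintegral_eq_one])
  exact ⟨C, c, hC, hc, fun x => (ENNReal.ofReal_le_ofReal_iff (by positivity)).1 (h x)⟩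

theorem integrable_norm_pow_mul (hf : LogConcaveDensity f) (k : ℕ) :
    Integrable fun x => ‖x‖ ^ k * f x := by
  obtain ⟨C, c, hC, hc, h⟩ := hf.exists_le_exp
  refine ((integrable_one_add_norm_pow_mul_exp volume k hc).const_mul C).mono'
    ((Measurable.mul (by fun_prop) hf.measurable).aestronglyMeasurable) (ae_of_all _ fun x => ?_)
  rw [Real.norm_of_nonneg (mul_nonneg (by positivity) (hf.nonneg x))]
  calc ‖x‖ ^ k * f x ≤ (1 + ‖x‖) ^ k * (C * Real.exp (-c * ‖x‖)) := by
        gcongr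
        · exact hf.nonneg x
        · linarith
        · exact h x
    _ = _ := by ring

/-- The domination is `|f log f| ≤ 2 √f + C f`. Where `f ≤ 1`, it follows from `log s ≥ 1 - 1 / s`
at `s = √f`; where `f ≥ 1`, from `log f ≤ f - 1 ≤ C`. Exponential decay makes `√f` integrable. -/
theorem integrable_mul_log (hf : LogConcaveDensity f) :
    Integrable fun x => f x * Real.log (f x) := by
  obtain ⟨C, c, hC, hc, h⟩ := hf.exists_le_exp
  have h1 : Integrable fun x : E => Real.sqrt (f x) := by
    refine ((integrable_one_add_norm_pow_mul_exp volume 0 (half_pos hc)).const_mul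
      (Real.sqrt C)).mono' hf.measurable.sqrt.aestronglyMeasurable (ae_of_all _ fun x => ?_)
    rw [Real.norm_of_nonneg (Real.sqrt_nonneg _), pow_zero, one_mul]
    refine (Real.sqrt_le_sqrt (h x)).trans (le_of_eq ?_)
    rw [Real.sqrt_mul hC.le, Real.sqrt_eq_rpow (Real.exp _), ← Real.exp_mul]
    congr 2; ring
  refine ((h1.const_mul 2).add (hf.integrable.const_mul C)).mono'
    (hf.measurable.mul hf.measurable.log).aestronglyMeasurable (ae_of_all _ fun x => ?_)
  have hx0 := hf.nonneg x
  have hxC : f x ≤ C := (h x).trans (mul_le_of_le_one_right hC.le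
    (Real.exp_le_one_iff.2 (by nlinarith [norm_nonneg x])))
  simp only [Pi.add_apply]
  rw [Real.norm_eq_abs, abs_mul, abs_of_nonneg hx0]
  rcases hx0.eq_or_lt with h0 | hpos
  · simp [← h0]
  rcases le_total (f x) 1 with h1 | h1
  · rw [abs_of_nonpos (Real.log_nonpos hx0 h1)]
    have hs : 0 < Real.sqrt (f x) := Real.sqrt_pos.2 hpos
    have e : Real.log (f x) = 2 * Real.log (Real.sqrt (f x)) := by
      rw [Real.log_sqrt hx0]; ring
    have h2 := Real.one_sub_inv_le_log_of_pos hs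
    have h3 : f x * (Real.sqrt (f x))⁻¹ = Real.sqrt (f x) := by
      nth_rewrite 1 [← Real.mul_self_sqrt hx0]
      field_simp
    have : 0 ≤ C * f x := by positivity
    rw [e]
    nlinarith [mul_le_mul_of_nonneg_left h2 hx0]
  · rw [abs_of_nonneg (Real.log_nonneg h1)]
    have h2 := Real.log_le_sub_one_of_pos hpos
    have h3 : 0 ≤ Real.sqrt (f x) := Real.sqrt_nonneg _
    nlinarith [mul_le_mul_of_nonneg_left (h2.trans (by linarith : f x - 1 ≤ C)) hx0]

end LogConcaveDensity

end

/-! ### Relative entropy of densities and one-dimensional marginals. -/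

noncomputable section

open Set
open scoped ENNReal

section KL

variable {α : Type*} [MeasurableSpace α] {μ : Measure α} [SigmaFinite μ] {f g : α → ℝ}

omit [SigmaFinite μ] in
theorem withDensity_eq_withDensity_div (hf : Measurable f) (hg : Measurable g)
    (hf0 : ∀ x, 0 ≤ f x) (hpos : ∀ᵐ x ∂μ, 0 < f x → 0 < g x) :
    μ.withDensity (fun x => ENNReal.ofReal (f x)) =
      (μ.withDensity fun x => ENNReal.ofReal (g x)).withDensity
        fun x => ENNReal.ofReal (f x / g x) := by
  have hdiv : Measurable fun x => ENNReal.ofReal (f x / g x) := (hf.div hg).ennreal_ofReal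
  rw [← withDensity_mul _ hg.ennreal_ofReal hdiv]
  refine withDensity_congr_ae ?_
  filter_upwards [hpos] with x hx
  simp only [Pi.mul_apply]
  rcases (hf0 x).eq_or_lt with h0 | h0
  · simp [← h0]
  · have := hx h0
    rw [← ENNReal.ofReal_mul this.le, mul_div_cancel₀ _ this.ne']

omit [SigmaFinite μ] in
theorem absolutelyContinuous_withDensity_ofReal (hf : Measurable f) (hg : Measurable g)
    (hf0 : ∀ x, 0 ≤ f x) (hpos : ∀ᵐ x ∂μ, 0 < f x → 0 < g x) :
    μ.withDensity (fun x => ENNReal.ofReal (f x)) ≪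
      μ.withDensity fun x => ENNReal.ofReal (g x) := by
  rw [withDensity_eq_withDensity_div hf hg hf0 hpos]
  exact withDensity_absolutelyContinuous _ _

omit [SigmaFinite μ] in
theorem ae_withDensity_ofReal_pos (hf : Measurable f) :
    ∀ᵐ x ∂μ.withDensity (fun x => ENNReal.ofReal (f x)), 0 < f x := by
  rw [ae_withDensity_iff hf.ennreal_ofReal]
  exact ae_of_all _ fun x hx => by simpa using hx

theorem llr_withDensity_ofReal (hf : Measurable f) (hg : Measurable g)
    (hf0 : ∀ x, 0 ≤ f x) (hpos : ∀ᵐ x ∂μ, 0 < f x → 0 < g x) :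
    llr (μ.withDensity fun x => ENNReal.ofReal (f x)) (μ.withDensity fun x => ENNReal.ofReal (g x))
      =ᵐ[μ.withDensity fun x => ENNReal.ofReal (f x)]
      fun x => Real.log (f x) - Real.log (g x) := by
  have hac := absolutelyContinuous_withDensity_ofReal hf hg hf0 hpos
  have h1 : (μ.withDensity fun x => ENNReal.ofReal (f x)).rnDeriv
      (μ.withDensity fun x => ENNReal.ofReal (g x))
      =ᵐ[μ.withDensity fun x => ENNReal.ofReal (f x)] fun x => ENNReal.ofReal (f x / g x) := by
    refine hac.ae_le ?_
    rw [withDensity_eq_withDensity_div hf hg hf0 hpos]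
    exact Measure.rnDeriv_withDensity _ (hf.div hg).ennreal_ofReal
  filter_upwards [h1, ae_withDensity_ofReal_pos hf,
    (withDensity_absolutelyContinuous _ _).ae_le hpos] with x hx hfx hgx
  have hgx := hgx hfx
  rw [llr, hx, ENNReal.toReal_ofReal (by positivity), Real.log_div hfx.ne' hgx.ne']

omit [SigmaFinite μ] in
theorem integral_withDensity_ofReal (hf : Measurable f) (hf0 : ∀ x, 0 ≤ f x) (u : α → ℝ) :
    ∫ x, u x ∂μ.withDensity (fun x => ENNReal.ofReal (f x)) = ∫ x, f x * u x ∂μ := by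
  rw [integral_withDensity_eq_integral_toReal_smul hf.ennreal_ofReal (by simp)]
  simp [ENNReal.toReal_ofReal (hf0 _)]

omit [SigmaFinite μ] in
theorem integrable_withDensity_ofReal (hf : Measurable f) (hf0 : ∀ x, 0 ≤ f x) {u : α → ℝ} :
    Integrable u (μ.withDensity fun x => ENNReal.ofReal (f x)) ↔
      Integrable (fun x => f x * u x) μ := by
  rw [integrable_withDensity_iff_integrable_smul' hf.ennreal_ofReal (by simp)]
  simp [ENNReal.toReal_ofReal (hf0 _)]

/-- Relative entropy of two probability measures given by densities. -/
theorem klDiv_withDensity_ofReal (hf : Measurable f) (hg : Measurable g)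
    (hf0 : ∀ x, 0 ≤ f x) (hpos : ∀ᵐ x ∂μ, 0 < f x → 0 < g x)
    [IsProbabilityMeasure (μ.withDensity fun x => ENNReal.ofReal (f x))]
    [IsProbabilityMeasure (μ.withDensity fun x => ENNReal.ofReal (g x))]
    (hint : Integrable (fun x => Real.log (f x) - Real.log (g x))
      (μ.withDensity fun x => ENNReal.ofReal (f x))) :
    klDiv (μ.withDensity fun x => ENNReal.ofReal (f x))
      (μ.withDensity fun x => ENNReal.ofReal (g x)) =
      ENNReal.ofReal (∫ x, (Real.log (f x) - Real.log (g x))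
        ∂μ.withDensity fun x => ENNReal.ofReal (f x)) := by
  have h := llr_withDensity_ofReal hf hg hf0 hpos
  -- The correction by total masses in `klDiv` vanishes because both measures are probability
  -- measures.
  rw [klDiv_of_ac_of_integrable (absolutelyContinuous_withDensity_ofReal hf hg hf0 hpos)
    ((integrable_congr h).2 hint), integral_congr_ae h]
  simp

end KL

theorem lintegral_pi_prod {m : ℕ} (f : Fin m → ℝ → ℝ≥0∞) (hf : ∀ i, Measurable (f i)) :
    ∫⁻ x : Fin m → ℝ, ∏ i, f i (x i) = ∏ i, ∫⁻ t, f i t := by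
  induction m with
  | zero => simp [volume_pi]
  | succ m ih =>
    have e := volume_preserving_piFinSuccAbove (fun _ : Fin (m + 1) => ℝ) 0
    have hm : Measurable fun x : Fin (m + 1) → ℝ => ∏ i, f i (x i) := by
      have := hf
      fun_prop
    rw [← (e.symm).lintegral_comp hm, Measure.volume_eq_prod, lintegral_prod
      (fun p => ∏ i, f i ((MeasurableEquiv.piFinSuccAbove (fun _ => ℝ) 0).symm p i))
      (hm.comp (MeasurableEquiv.measurable _)).aemeasurable, Fin.prod_univ_succ,
      ← ih (fun i => f i.succ) (fun i => hf _), ← lintegral_mul_const _ (hf 0)]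
    refine lintegral_congr fun s => ?_
    rw [← lintegral_const_mul]
    · refine lintegral_congr fun t => ?_
      rw [Fin.prod_univ_succ]
      simp [MeasurableEquiv.piFinSuccAbove, Fin.insertNthEquiv]
    · have := hf
      fun_prop

theorem pi_withDensity {m : ℕ} (f : Fin m → ℝ → ℝ≥0∞) (hf : ∀ i, Measurable (f i))
    [∀ i, SigmaFinite ((volume : Measure ℝ).withDensity (f i))] :
    Measure.pi (fun i => (volume : Measure ℝ).withDensity (f i)) =
      (volume : Measure (Fin m → ℝ)).withDensity fun x => ∏ i, f i (x i) := by
  refine Measure.pi_eq fun s hs => ?_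
  have h1 : ∀ i, Measurable ((s i).indicator (f i)) := fun i => (hf i).indicator (hs i)
  rw [withDensity_apply _ (MeasurableSet.univ_pi hs), ← lintegral_indicator
    (MeasurableSet.univ_pi hs)]
  have h2 : ∀ i, (volume : Measure ℝ).withDensity (f i) (s i) = ∫⁻ t, (s i).indicator (f i) t :=
    fun i => by rw [withDensity_apply _ (hs i), lintegral_indicator (hs i)]
  simp_rw [h2]
  rw [← lintegral_pi_prod _ h1]
  refine lintegral_congr fun x => ?_
  classical
  by_cases hx : x ∈ univ.pi s
  · rw [indicator_of_mem hx]
    exact Finset.prod_congr rfl fun i _ => by rw [indicator_of_mem (hx i (mem_univ i))]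
  · rw [indicator_of_notMem hx]
    simp only [mem_pi, mem_univ, forall_const, not_forall] at hx
    obtain ⟨i, hi⟩ := hx
    rw [Finset.prod_eq_zero (Finset.mem_univ i) (indicator_of_notMem hi _)]

namespace EuclideanSpace

variable {k : ℕ}

/-- The point of `ℝᵏ⁺¹` with `i`-th coordinate `t` and remaining coordinates `y`. -/
def insertCoord (i : Fin (k + 1)) (t : ℝ) (y : Fin k → ℝ) : EuclideanSpace ℝ (Fin (k + 1)) :=
  WithLp.toLp 2 (i.insertNth (α := fun _ => ℝ) t y)

@[simp]
theorem insertCoord_same (i : Fin (k + 1)) (t : ℝ) (y : Fin k → ℝ) : insertCoord i t y i = t := by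
  simp [insertCoord]

@[simp]
theorem insertCoord_succAbove (i : Fin (k + 1)) (t : ℝ) (y : Fin k → ℝ) (j : Fin k) :
    insertCoord i t y (i.succAbove j) = y j := by
  simp [insertCoord]

theorem insertCoord_coord (i : Fin (k + 1)) (x : EuclideanSpace ℝ (Fin (k + 1))) :
    insertCoord i (x i) (fun j => x (i.succAbove j)) = x := by
  ext j
  rcases Fin.eq_self_or_eq_succAbove i j with rfl | ⟨j, rfl⟩ <;> simp

/-- `insertCoord` as a linear map. -/
def insertCoordLinear (i : Fin (k + 1)) :
    ℝ × (Fin k → ℝ) →ₗ[ℝ] EuclideanSpace ℝ (Fin (k + 1)) where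
  toFun p := insertCoord i p.1 p.2
  map_add' p q := by
    ext j
    rcases Fin.eq_self_or_eq_succAbove i j with rfl | ⟨j, rfl⟩ <;> simp
  map_smul' c p := by
    ext j
    rcases Fin.eq_self_or_eq_succAbove i j with rfl | ⟨j, rfl⟩ <;> simp

theorem measurable_insertCoord (i : Fin (k + 1)) :
    Measurable fun p : ℝ × (Fin k → ℝ) => insertCoord i p.1 p.2 :=
  (insertCoordLinear i).continuous_of_finiteDimensional.measurable

theorem lintegral_eq_insertCoord (i : Fin (k + 1)) {F : EuclideanSpace ℝ (Fin (k + 1)) → ℝ≥0∞}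
    (hF : Measurable F) : ∫⁻ x, F x = ∫⁻ t : ℝ, ∫⁻ y : Fin k → ℝ, F (insertCoord i t y) := by
  have e := volume_preserving_piFinSuccAbove (fun _ : Fin (k + 1) => ℝ) i
  have hF' : Measurable fun x : Fin (k + 1) → ℝ => F (WithLp.toLp 2 x) :=
    hF.comp (WithLp.measurable_toLp 2 _)
  rw [← (PiLp.volume_preserving_toLp (Fin (k + 1))).lintegral_comp hF,
    ← (e.symm).lintegral_comp hF', Measure.volume_eq_prod, lintegral_prod
      (fun p => F (WithLp.toLp 2 ((MeasurableEquiv.piFinSuccAbove (fun _ => ℝ) i).symm p)))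
      (hF'.comp (MeasurableEquiv.measurable _)).aemeasurable]
  rfl

theorem norm_le_norm_insertCoord (i : Fin (k + 1)) (t : ℝ) (y : Fin k → ℝ) :
    ‖y‖ ≤ ‖insertCoord i t y‖ := by
  refine (pi_norm_le_iff_of_nonneg (norm_nonneg _)).2 fun j => ?_
  have := PiLp.norm_apply_le (insertCoord i t y) (i.succAbove j)
  simpa using this

end EuclideanSpace

open EuclideanSpace

/-- The density of the `i`-th one-dimensional marginal. -/
def marginalDensity {k : ℕ} (f : EuclideanSpace ℝ (Fin (k + 1)) → ℝ) (i : Fin (k + 1)) (t : ℝ) : ℝ :=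
  (∫⁻ y : Fin k → ℝ, ENNReal.ofReal (f (insertCoord i t y))).toReal

namespace IsLogConcaveDensity

theorem toLogConcaveDensity {n : ℕ} {f : EuclideanSpace ℝ (Fin n) → ℝ}
    (hf : IsLogConcaveDensity f) : LogConcaveDensity f :=
  ⟨hf.measurable, hf.nonneg, hf.logConcave, hf.integral_eq_one⟩

theorem isProbabilityMeasure {n : ℕ} {f : EuclideanSpace ℝ (Fin n) → ℝ}
    (hf : IsLogConcaveDensity f) : IsProbabilityMeasure (densityMeasure f) :=
  ⟨by rw [densityMeasure, withDensity_apply _ MeasurableSet.univ, setLIntegral_univ,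
    hf.toLogConcaveDensity.lintegral_eq_one]⟩

variable {k : ℕ} {f : EuclideanSpace ℝ (Fin (k + 1)) → ℝ}

/-- Finiteness holds at every `t`, not only almost everywhere, thanks to the exponential decay of
`f`. Hence `toReal` in `marginalDensity` loses nothing and log-concavity survives pointwise. -/
theorem lintegral_insertCoord_ne_top (hf : IsLogConcaveDensity f) (i : Fin (k + 1)) (t : ℝ) :
    ∫⁻ y : Fin k → ℝ, ENNReal.ofReal (f (insertCoord i t y)) ≠ ∞ := by
  obtain ⟨C, c, hC, hc, h⟩ := hf.toLogConcaveDensity.exists_le_exp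
  have hint := (integrable_one_add_norm_pow_mul_exp (volume : Measure (Fin k → ℝ)) 0 hc).const_mul C
  refine ne_top_of_le_ne_top hint.lintegral_lt_top.ne (lintegral_mono fun y =>
    ENNReal.ofReal_le_ofReal ((h _).trans ?_))
  have := norm_le_norm_insertCoord i t y
  rw [pow_zero, one_mul]
  exact mul_le_mul_of_nonneg_left (Real.exp_le_exp.2 (by nlinarith)) hC.le

theorem ofReal_marginalDensity (hf : IsLogConcaveDensity f) (i : Fin (k + 1)) (t : ℝ) :
    ENNReal.ofReal (marginalDensity f i t) =
      ∫⁻ y : Fin k → ℝ, ENNReal.ofReal (f (insertCoord i t y)) :=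
  ENNReal.ofReal_toReal (hf.lintegral_insertCoord_ne_top i t)

/-- Log-concavity is Prékopa's theorem, and the total mass is Fubini's. -/
theorem logConcaveDensity_marginalDensity (hf : IsLogConcaveDensity f) (i : Fin (k + 1)) :
    LogConcaveDensity (marginalDensity f i) := by
  have hm : Measurable fun p : ℝ × (Fin k → ℝ) => ENNReal.ofReal (f (insertCoord i p.1 p.2)) :=
    (hf.measurable.comp (measurable_insertCoord i)).ennreal_ofReal
  refine LogConcaveDensity.of_isLogConcave (IsLogConcave.lintegral_pi
    (F := fun p : ℝ × (Fin k → ℝ) => ENNReal.ofReal (f (insertCoord i p.1 p.2)))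
    (hf.toLogConcaveDensity.isLogConcave.comp_linearMap (insertCoordLinear i))
    fun t => hm.comp measurable_prodMk_left) hm.lintegral_prod_right'
    (hf.lintegral_insertCoord_ne_top i) ?_
  rw [← lintegral_eq_insertCoord i hf.measurable.ennreal_ofReal,
    hf.toLogConcaveDensity.lintegral_eq_one]

theorem map_densityMeasure (hf : IsLogConcaveDensity f) (i : Fin (k + 1)) :
    (densityMeasure f).map (fun x => x i) =
      volume.withDensity fun t => ENNReal.ofReal (marginalDensity f i t) := by
  ext s hs
  have hmi : Measurable fun x : EuclideanSpace ℝ (Fin (k + 1)) => x i := by fun_prop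
  rw [Measure.map_apply hmi hs, densityMeasure, withDensity_apply _ (hmi hs),
    withDensity_apply _ hs, ← lintegral_indicator (hmi hs), ← lintegral_indicator hs,
    lintegral_eq_insertCoord i (hf.measurable.ennreal_ofReal.indicator (hmi hs))]
  refine lintegral_congr fun t => ?_
  by_cases ht : t ∈ s
  · rw [indicator_of_mem ht, hf.ofReal_marginalDensity]
    refine lintegral_congr fun y => ?_
    rw [indicator_of_mem (by simpa using ht)]
  · rw [indicator_of_notMem ht]
    refine (lintegral_congr fun y => ?_).trans lintegral_zero
    rw [indicator_of_notMem (by simpa using ht)]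

theorem productOfMarginals_densityMeasure (hf : IsLogConcaveDensity f) :
    productOfMarginals (densityMeasure f) =
      volume.withDensity fun x => ENNReal.ofReal (∏ i, marginalDensity f i (x i)) := by
  have := hf.isProbabilityMeasure
  have hp : ∀ i, IsProbabilityMeasure ((volume : Measure ℝ).withDensity
      fun t => ENNReal.ofReal (marginalDensity f i t)) := fun i => by
    rw [← hf.map_densityMeasure i]
    exact Measure.isProbabilityMeasure_map (Measurable.aemeasurable (by fun_prop))
  have hmeas : ∀ i, Measurable (marginalDensity f i) := fun i =>
    (hf.logConcaveDensity_marginalDensity i).measurable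
  have hm : Measurable fun x : EuclideanSpace ℝ (Fin (k + 1)) =>
      ENNReal.ofReal (∏ i, marginalDensity f i (x i)) := by
    refine (Finset.measurable_fun_prod _ fun i _ => (hmeas i).comp ?_).ennreal_ofReal
    fun_prop
  rw [productOfMarginals]
  simp_rw [hf.map_densityMeasure]
  rw [pi_withDensity _ fun i => (hmeas i).ennreal_ofReal]
  have h1 : (fun x : Fin (k + 1) → ℝ => ∏ i, ENNReal.ofReal (marginalDensity f i (x i))) =
      fun x => ENNReal.ofReal (∏ i, marginalDensity f i ((WithLp.toLp 2 x :
        EuclideanSpace ℝ (Fin (k + 1))) i)) := by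
    ext x
    rw [ENNReal.ofReal_prod_of_nonneg fun i _ =>
      (hf.logConcaveDensity_marginalDensity i).nonneg _]
  ext s hs
  rw [Measure.map_apply (WithLp.measurable_toLp 2 _) hs,
    withDensity_apply _ (WithLp.measurable_toLp 2 _ hs), withDensity_apply _ hs, h1]
  exact (PiLp.volume_preserving_toLp (Fin (k + 1))).setLIntegral_comp_preimage hs hm

theorem integrable_log_marginalDensity (hf : IsLogConcaveDensity f) (i : Fin (k + 1)) :
    Integrable (fun x => Real.log (marginalDensity f i (x i))) (densityMeasure f) := by
  have hg := hf.logConcaveDensity_marginalDensity i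
  have h := (integrable_withDensity_ofReal hg.measurable hg.nonneg).2 hg.integrable_mul_log
  rw [← hf.map_densityMeasure] at h
  exact h.comp_measurable (by fun_prop)

theorem integral_log_marginalDensity (hf : IsLogConcaveDensity f) (i : Fin (k + 1)) :
    ∫ x, Real.log (marginalDensity f i (x i)) ∂densityMeasure f =
      ∫ t, marginalDensity f i t * Real.log (marginalDensity f i t) := by
  have hg := hf.logConcaveDensity_marginalDensity i
  rw [← integral_withDensity_ofReal hg.measurable hg.nonneg, ← hf.map_densityMeasure,
    integral_map (Measurable.aemeasurable (by fun_prop))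
      hg.measurable.log.aestronglyMeasurable]

theorem integrable_log {n : ℕ} {f : EuclideanSpace ℝ (Fin n) → ℝ} (hf : IsLogConcaveDensity f) :
    Integrable (fun x => Real.log (f x)) (densityMeasure f) :=
  (integrable_withDensity_ofReal hf.measurable hf.nonneg).2
    hf.toLogConcaveDensity.integrable_mul_log

theorem ae_marginalDensity_pos (hf : IsLogConcaveDensity f) :
    ∀ᵐ x ∂densityMeasure f, ∀ i, 0 < marginalDensity f i (x i) := by
  refine ae_all_iff.2 fun i => ?_
  have h := ae_withDensity_ofReal_pos (μ := volume)
    (hf.logConcaveDensity_marginalDensity i).measurable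
  rw [← hf.map_densityMeasure] at h
  have hm : Measurable fun x : EuclideanSpace ℝ (Fin (k + 1)) => x i := by fun_prop
  exact ae_of_ae_map hm.aemeasurable h

/-- The entropic distance from independence in terms of entropies. -/
theorem entropyFromIndependence_eq (hf : IsLogConcaveDensity f) :
    entropyFromIndependence f = ENNReal.ofReal ((∫ x, f x * Real.log (f x)) -
      ∑ i, ∫ t, marginalDensity f i t * Real.log (marginalDensity f i t)) := by
  have hmeas : ∀ i, Measurable (marginalDensity f i) := fun i =>
    (hf.logConcaveDensity_marginalDensity i).measurable
  have hgm : Measurable fun x : EuclideanSpace ℝ (Fin (k + 1)) =>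
      ∏ i, marginalDensity f i (x i) := by
    refine Finset.measurable_fun_prod _ fun i _ => (hmeas i).comp ?_
    fun_prop
  have hpos : ∀ᵐ x, 0 < f x → 0 < ∏ i, marginalDensity f i (x i) := by
    have h := hf.ae_marginalDensity_pos
    rw [densityMeasure, ae_withDensity_iff hf.measurable.ennreal_ofReal] at h
    filter_upwards [h] with x hx hfx
    exact Finset.prod_pos fun i _ => hx (by simpa using hfx) i
  have hP := hf.isProbabilityMeasure
  have hQ : IsProbabilityMeasure (productOfMarginals (densityMeasure f)) := by
    have : ∀ i : Fin (k + 1), IsProbabilityMeasure ((densityMeasure f).map fun x => x i) :=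
      fun i => Measure.isProbabilityMeasure_map (Measurable.aemeasurable (by fun_prop))
    exact Measure.isProbabilityMeasure_map (WithLp.measurable_toLp 2 _).aemeasurable
  -- The logarithm of the product splits where every marginal density is positive, which is almost
  -- everywhere for the measure `f dx`.
  have hlog : ∀ᵐ x ∂densityMeasure f, Real.log (f x) -
      Real.log (∏ i, marginalDensity f i (x i)) =
      Real.log (f x) - ∑ i, Real.log (marginalDensity f i (x i)) := by
    filter_upwards [hf.ae_marginalDensity_pos] with x hx
    rw [Real.log_prod fun i _ => (hx i).ne']
  have hsum : Integrable (fun x => ∑ i, Real.log (marginalDensity f i (x i))) (densityMeasure f) :=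
    integrable_finsetSum _ fun i _ => hf.integrable_log_marginalDensity i
  have hint : Integrable (fun x => Real.log (f x) - Real.log (∏ i, marginalDensity f i (x i)))
      (densityMeasure f) :=
    (integrable_congr hlog).2 (hf.integrable_log.sub hsum)
  rw [entropyFromIndependence]
  rw [hf.productOfMarginals_densityMeasure] at hQ ⊢
  rw [densityMeasure] at hP
  refine (klDiv_withDensity_ofReal hf.measurable hgm hf.nonneg hpos hint).trans ?_
  congr 1
  refine (integral_congr_ae hlog).trans ?_
  rw [integral_sub hf.integrable_log hsum, integral_finsetSum _ fun i _ =>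
    hf.integrable_log_marginalDensity i]
  congr 1
  · exact integral_withDensity_ofReal hf.measurable hf.nonneg _
  · exact Finset.sum_congr rfl fun i _ => hf.integral_log_marginalDensity i

end IsLogConcaveDensity

end

/-! ### Sections through the centroid: from the independence form to the hyperplane conjecture. -/

noncomputable section

open Set
open scoped ENNReal RealInnerProductSpace

namespace LogConcaveDensity

/-- Support line of the logarithm of a log-concave function of one variable. -/
theorem exists_log_le_add_mul {g : ℝ → ℝ} (hg : LogConcaveDensity g) {s m t : ℝ} (hs : 0 < g s)
    (ht : 0 < g t) (hsm : s < m) (hmt : m < t) :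
    0 < g m ∧ ∃ c : ℝ, ∀ u, 0 < g u → Real.log (g u) ≤ Real.log (g m) + c * (u - m) := by
  have hconc : ConcaveOn ℝ {u | 0 < g u} fun u => Real.log (g u) := by
    have key : ∀ x, 0 < g x → ∀ y, 0 < g y → ∀ a b : ℝ, 0 < a → 0 < b → a + b = 1 →
        0 < g (a • x + b • y) ∧
          a • Real.log (g x) + b • Real.log (g y) ≤ Real.log (g (a • x + b • y)) := by
      intro x hx y hy a b ha hb hab
      have h1 := hg.logConcave x y a b ha hb hab
      have h2 : 0 < g x ^ a * g y ^ b := by positivity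
      refine ⟨h2.trans_le h1, ?_⟩
      have h3 := Real.log_le_log h2 h1
      rwa [Real.log_mul (by positivity) (by positivity), Real.log_rpow hx, Real.log_rpow hy] at h3
    refine concaveOn_iff_forall_pos.2 ⟨convex_iff_forall_pos.2 ?_, ?_⟩
    · exact fun x hx y hy a b ha hb hab => (key x hx y hy a b ha hb hab).1
    · exact fun x hx y hy a b ha hb hab => (key x hx y hy a b ha hb hab).2
  have hm : 0 < g m := hconc.1.ordConnected.out hs ht ⟨hsm.le, hmt.le⟩
  refine ⟨hm, ?_⟩
  set φ := fun u => Real.log (g u) with hφ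
  -- The supporting slope is the supremum of the slopes to the right of `m`. Concavity bounds these
  -- by any slope to the left, so the supremum is finite and works on both sides.
  set S : Set ℝ := {r | ∃ u, 0 < g u ∧ m < u ∧ r = (φ u - φ m) / (u - m)} with hS
  have hbound : ∀ v, 0 < g v → v < m → ∀ r ∈ S, r ≤ (φ m - φ v) / (m - v) := by
    rintro v hv hvm r ⟨u, hu, hmu, rfl⟩
    exact hconc.slope_anti_adjacent hv hu hvm hmu
  have hne : S.Nonempty := ⟨_, t, ht, hmt, rfl⟩
  have hbdd : BddAbove S := ⟨_, hbound s hs hsm⟩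
  refine ⟨sSup S, fun u hu => ?_⟩
  rcases lt_trichotomy u m with h | rfl | h
  · have h1 := csSup_le hne (hbound u hu h)
    rw [le_div_iff₀ (by linarith)] at h1
    simp only [hφ] at h1
    linarith
  · simp
  · have h1 := le_csSup hbdd ⟨u, hu, h, rfl⟩
    rw [div_le_iff₀ (by linarith)] at h1
    simp only [hφ] at h1
    linarith

/-- Jensen's inequality: the logarithm of a log-concave density at its barycentre is at least
the mean of its logarithm. -/
theorem integral_mul_log_le_log {g : ℝ → ℝ} (hg : LogConcaveDensity g) :
    0 < g (∫ t, t * g t) ∧ ∫ t, g t * Real.log (g t) ≤ Real.log (g (∫ t, t * g t)) := by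
  set m := ∫ t, t * g t with hm
  have hi1 : Integrable fun t => t * g t := by
    refine (hg.integrable_norm_pow_mul 1).mono'
      (measurable_id.mul hg.measurable).aestronglyMeasurable (ae_of_all _ fun t => ?_)
    rw [norm_mul, pow_one, Real.norm_of_nonneg (hg.nonneg t)]
  have hi2 : Integrable fun t => (t - m) * g t := by
    simp_rw [sub_mul]
    exact hi1.sub (hg.integrable.const_mul m)
  have hz : ∫ t, (t - m) * g t = 0 := by
    simp_rw [sub_mul]
    rw [integral_sub hi1 (hg.integrable.const_mul m), integral_const_mul, hg.integral_eq_one,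
      ← hm, mul_one, sub_self]
  -- As `(t - m) * g t` has integral zero without vanishing almost everywhere, `g` is positive at
  -- points on both sides of `m`, which is what the existence of a support line requires.
  have hae : ¬ (∀ᵐ t, (t - m) * g t = 0) := by
    intro h
    have hne : ∀ᵐ t : ℝ, t ≠ m := by
      rw [ae_iff]; simp
    have h0 : ∀ᵐ t, g t = 0 := by
      filter_upwards [h, hne] with t ht htm
      exact (mul_eq_zero.1 ht).resolve_left (sub_ne_zero.2 htm)
    have := hg.integral_eq_one
    rw [integral_congr_ae h0] at this
    simp at this
  obtain ⟨s, hs, hsm⟩ : ∃ s, 0 < g s ∧ s < m := by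
    by_contra! hcon
    refine hae ((integral_eq_zero_iff_of_nonneg (fun t => ?_) hi2).1 hz)
    rcases (hg.nonneg t).eq_or_lt with h | h
    · simp [← h]
    · exact mul_nonneg (sub_nonneg.2 (hcon t h)) h.le
  obtain ⟨t, ht, hmt⟩ : ∃ t, 0 < g t ∧ m < t := by
    by_contra! hcon
    have hz' : ∫ t, -((t - m) * g t) = 0 := by rw [integral_neg, hz, neg_zero]
    have := (integral_eq_zero_iff_of_nonneg (fun t => ?_) hi2.neg).1 hz'
    · refine hae (this.mono fun t ht => ?_)
      simpa using ht
    · rcases (hg.nonneg t).eq_or_lt with h | h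
      · simp [← h]
      · simp only [Pi.zero_apply, Pi.neg_apply]
        nlinarith [hcon t h]
  obtain ⟨hgm, c, hc⟩ := hg.exists_log_le_add_mul hs ht hsm hmt
  refine ⟨hgm, ?_⟩
  calc ∫ t, g t * Real.log (g t)
      ≤ ∫ t, (Real.log (g m) * g t + c * ((t - m) * g t)) := by
        refine integral_mono hg.integrable_mul_log
          ((hg.integrable.const_mul _).add (hi2.const_mul _)) fun t => ?_
        rcases (hg.nonneg t).eq_or_lt with h | h
        · simp [← h]
        · have := mul_le_mul_of_nonneg_left (hc t h) h.le
          simp only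
          linarith
    _ = Real.log (g m) := by
        rw [integral_add (hg.integrable.const_mul _) (hi2.const_mul _), integral_const_mul,
          integral_const_mul, hz, hg.integral_eq_one]
        simp

end LogConcaveDensity

namespace EuclideanSpace

variable {k : ℕ}

/-- The embedding of `ℝᵏ` as a hyperplane `{x | ⟪b i, x⟫ = t}` of `ℝᵏ⁺¹`. -/
def hyperplaneEmbedding (b : OrthonormalBasis (Fin (k + 1)) ℝ (EuclideanSpace ℝ (Fin (k + 1))))
    (i : Fin (k + 1)) (t : ℝ) (y : EuclideanSpace ℝ (Fin k)) : EuclideanSpace ℝ (Fin (k + 1)) :=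
  b.repr.symm (insertCoord i t y)

theorem isometry_hyperplaneEmbedding
    (b : OrthonormalBasis (Fin (k + 1)) ℝ (EuclideanSpace ℝ (Fin (k + 1))))
    (i : Fin (k + 1)) (t : ℝ) : Isometry (hyperplaneEmbedding b i t) := by
  refine b.repr.symm.isometry.comp (Isometry.of_dist_eq fun y z => ?_)
  rw [EuclideanSpace.dist_eq, EuclideanSpace.dist_eq, Fin.sum_univ_succAbove _ i]
  simp

/-- The volume of a hyperplane section in coordinates. -/
theorem volume_insertCoord_mem (b : OrthonormalBasis (Fin (k + 1)) ℝ
    (EuclideanSpace ℝ (Fin (k + 1)))) (i : Fin (k + 1)) (t : ℝ)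
    (K : Set (EuclideanSpace ℝ (Fin (k + 1)))) :
    volume {y : Fin k → ℝ | b.repr.symm (insertCoord i t y) ∈ K} =
      Measure.euclideanHausdorffMeasure k (K ∩ {x | ⟪b i, x⟫ = t}) := by
  have h1 : K ∩ {x | ⟪b i, x⟫ = t} =
      hyperplaneEmbedding b i t '' (hyperplaneEmbedding b i t ⁻¹' K) := by
    ext x
    constructor
    · rintro ⟨hx, hxt⟩
      have e : hyperplaneEmbedding b i t (WithLp.toLp 2 fun j => b.repr x (i.succAbove j)) = x := by
        have h := insertCoord_coord i (b.repr x)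
        rw [b.repr_apply_apply, show ⟪b i, x⟫ = t from hxt] at h
        simp only [hyperplaneEmbedding]
        rw [h, LinearIsometryEquiv.symm_apply_apply]
      exact ⟨_, by rw [mem_preimage, e]; exact hx, e⟩
    · rintro ⟨y, hy, rfl⟩
      refine ⟨hy, ?_⟩
      rw [mem_ofPred_eq, ← b.repr_apply_apply, hyperplaneEmbedding,
        LinearIsometryEquiv.apply_symm_apply, insertCoord_same]
  rw [h1, (isometry_hyperplaneEmbedding b i t).euclideanHausdorffMeasure_image,
    EuclideanSpace.euclideanHausdorffMeasure_eq_volume,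
    ← (EuclideanSpace.volume_preserving_symm_measurableEquiv_toLp (Fin k)).measure_preimage_equiv]
  rfl

end EuclideanSpace

open EuclideanSpace

theorem isLogConcaveDensity_indicator {n : ℕ} {K : Set (EuclideanSpace ℝ (Fin n))}
    (hK : Convex ℝ K) (hm : MeasurableSet K) (hv : volume K = 1) :
    IsLogConcaveDensity (K.indicator 1) where
  measurable := measurable_one.indicator hm
  nonneg x := indicator_nonneg (by simp) x
  logConcave x y a b ha hb hab := by
    by_cases hx : x ∈ K
    · by_cases hy : y ∈ K
      · simp [hx, hy, hK hx hy ha.le hb.le hab]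
      · simp only [hy, not_false_eq_true, indicator_of_notMem, Real.zero_rpow hb.ne', mul_zero]
        exact indicator_nonneg (by simp) _
    · simp only [hx, not_false_eq_true, indicator_of_notMem, Real.zero_rpow ha.ne', zero_mul]
      exact indicator_nonneg (by simp) _
  integral_eq_one := by
    rw [integral_indicator_one hm, Measure.real, hv, ENNReal.toReal_one]

theorem densityMeasure_indicator {n : ℕ} {K : Set (EuclideanSpace ℝ (Fin n))}
    (hm : MeasurableSet K) : densityMeasure (K.indicator 1) = volume.restrict K := by
  rw [densityMeasure, ← withDensity_indicator_one hm]
  congr 1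
  ext x
  by_cases hx : x ∈ K <;> simp [hx]

namespace IsLogConcaveDensity

variable {n : ℕ} {f : EuclideanSpace ℝ (Fin n) → ℝ}

theorem memLp_id (hf : IsLogConcaveDensity f) : MemLp id 2 (densityMeasure f) := by
  refine (memLp_two_iff_integrable_sq_norm measurable_id.aestronglyMeasurable).2 ?_
  refine (integrable_withDensity_ofReal hf.measurable hf.nonneg).2 ?_
  simpa [mul_comm] using hf.toLogConcaveDensity.integrable_norm_pow_mul 2

theorem memLp_coord (hf : IsLogConcaveDensity f) (i : Fin n) :
    MemLp (fun x => x i) 2 (densityMeasure f) :=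
  hf.memLp_id.of_le (Measurable.aestronglyMeasurable (by fun_prop))
    (ae_of_all _ fun x => PiLp.norm_apply_le x i)

theorem covariance_inner (hf : IsLogConcaveDensity f) (u v : EuclideanSpace ℝ (Fin n)) :
    cov[fun x => ⟪u, x⟫, fun x => ⟪v, x⟫; densityMeasure f] =
      u.ofLp ⬝ᵥ (covarianceMatrix (densityMeasure f)).mulVec v.ofLp := by
  have := hf.isProbabilityMeasure
  have e : ∀ u : EuclideanSpace ℝ (Fin n), (fun x : EuclideanSpace ℝ (Fin n) => ⟪u, x⟫) =
      fun x => ∑ i, u i * x i := by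
    intro u
    ext x
    simp [PiLp.inner_apply, mul_comm]
  rw [e u, e v, covariance_fun_sum_fun_sum (fun i => (hf.memLp_coord i).const_mul _)
    (fun i => (hf.memLp_coord i).const_mul _)]
  simp only [covariance_const_mul_left, covariance_const_mul_right, dotProduct, Matrix.mulVec,
    covarianceMatrix, Matrix.of_apply, Finset.mul_sum]
  refine Finset.sum_congr rfl fun i _ => Finset.sum_congr rfl fun j _ => ?_
  ring

end IsLogConcaveDensity

theorem covarianceMatrix_isHermitian {n : ℕ} (μ : Measure (EuclideanSpace ℝ (Fin n))) :
    (covarianceMatrix μ).IsHermitian := by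
  ext i j
  simp [covarianceMatrix, covariance_comm]

/-- The image of a density under an orthogonal change of coordinates. -/
theorem covarianceMatrix_indicator_image {n : ℕ} {K : Set (EuclideanSpace ℝ (Fin n))}
    (hK : MeasurableSet K)
    (b : OrthonormalBasis (Fin n) ℝ (EuclideanSpace ℝ (Fin n))) (i j : Fin n) :
    covarianceMatrix (densityMeasure ((b.repr.symm ⁻¹' K).indicator 1)) i j =
      cov[fun x => ⟪b i, x⟫, fun x => ⟪b j, x⟫; densityMeasure (K.indicator 1)] := by
  have hmp := b.measurePreserving_repr_symm
  have hmp' := b.measurePreserving_repr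
  have hmap : densityMeasure ((b.repr.symm ⁻¹' K).indicator 1) =
      (densityMeasure (K.indicator 1)).map b.repr := by
    rw [densityMeasure_indicator hK, densityMeasure_indicator (hmp.measurable hK)]
    have h := hmp'.restrict_preimage (hmp.measurable hK)
    rw [← h.map_eq]
    congr 2
    ext x
    simp
  rw [hmap, covarianceMatrix, Matrix.of_apply, covariance_map_fun
    (Measurable.aestronglyMeasurable (by fun_prop)) (Measurable.aestronglyMeasurable (by fun_prop))
    hmp'.measurable.aemeasurable]
  simp_rw [b.repr_apply_apply]

theorem exists_hyperplane_of_basis {k : ℕ}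
    (b : OrthonormalBasis (Fin (k + 1)) ℝ (EuclideanSpace ℝ (Fin (k + 1)))) (i : Fin (k + 1))
    (p : EuclideanSpace ℝ (Fin (k + 1))) :
    ∃ H : AffineSubspace ℝ (EuclideanSpace ℝ (Fin (k + 1))), p ∈ H ∧
      Module.finrank ℝ H.direction + 1 = k + 1 ∧
        (H : Set (EuclideanSpace ℝ (Fin (k + 1)))) = {x | ⟪b i, x⟫ = ⟪b i, p⟫} := by
  refine ⟨AffineSubspace.mk' p (ℝ ∙ b i)ᗮ, AffineSubspace.self_mem_mk' _ _, ?_, ?_⟩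
  · have : Fact (Module.finrank ℝ (EuclideanSpace ℝ (Fin (k + 1))) = k + 1) := ⟨by simp⟩
    rw [AffineSubspace.direction_mk', Submodule.finrank_orthogonal_span_singleton
      (n := k) (b.orthonormal.ne_zero i)]
  · ext x
    rw [SetLike.mem_coe, AffineSubspace.mem_mk', Submodule.mem_orthogonal_singleton_iff_inner_right,
      vsub_eq_sub, inner_sub_right, sub_eq_zero]
    rfl

/-- For the indicator of a body of volume 1 the term `∫ f log f` is zero, so the independence form
bounds the sum of the marginal entropies. One marginal must then be large at its barycentre, and its
value there is the volume of a section. -/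
theorem hyperplaneConjecture_of_entropicIndependenceConjecture
    (h : EntropicIndependenceConjecture) : HyperplaneConjecture := by
  obtain ⟨c, hc⟩ := h
  -- A negative `c` would be truncated to zero by `ENNReal.ofReal`; `max c 0` covers this case too.
  refine ⟨Real.exp (-max c 0), Real.exp_pos _, fun n hn K hK hv => ?_⟩
  obtain ⟨k, rfl⟩ : ∃ k, n = k + 1 := ⟨n - 1, by omega⟩
  -- `K` need not be Borel. Its interior is, differs from `K` by a null set, and has sections
  -- contained in those of `K`.
  set U := interior K with hU
  have hUK : U =ᵐ[volume] K := interior_ae_eq_of_null_frontier (hK.addHaar_frontier volume)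
  have hUv : volume U = 1 := by rw [measure_congr hUK, hv]
  have hUm : MeasurableSet U := isOpen_interior.measurableSet
  have hUc : Convex ℝ U := hK.interior
  have hU1 := isLogConcaveDensity_indicator hUc hUm hUv
  set S := covarianceMatrix (densityMeasure (U.indicator 1)) with hS
  have hSH : S.IsHermitian := covarianceMatrix_isHermitian _
  -- In the principal axes the coordinates are uncorrelated, and the orthogonal change of variables
  -- preserves convexity and volume.
  set b := hSH.eigenvectorBasis with hb
  set W := b.repr.symm ⁻¹' U with hW
  have hWm : MeasurableSet W := b.measurePreserving_repr_symm.measurable hUm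
  have hWv : volume W = 1 := by
    rw [hW, b.measurePreserving_repr_symm.measure_preimage hUm.nullMeasurableSet, hUv]
  have hWc : Convex ℝ W := hUc.linear_preimage b.repr.symm.toLinearMap
  have hf := isLogConcaveDensity_indicator hWc hWm hWv
  set f : EuclideanSpace ℝ (Fin (k + 1)) → ℝ := W.indicator 1 with hfdef
  have hdiag : (covarianceMatrix (densityMeasure f)).IsDiag := by
    intro i j hij
    rw [hfdef, hW, covarianceMatrix_indicator_image hUm, hU1.covariance_inner, ← hS,
      hSH.mulVec_eigenvectorBasis, dotProduct_smul]
    have h2 : ⟪b j, b i⟫ = 0 := b.orthonormal.2 hij.symm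
    rw [EuclideanSpace.inner_eq_star_dotProduct] at h2
    simp only [star_trivial] at h2
    rw [h2, smul_zero]
  have hent := hc (k + 1) hn f hf hdiag
  rw [hf.entropyFromIndependence_eq] at hent
  have hzero : ∫ x, f x * Real.log (f x) = 0 := by
    refine (integral_congr_ae (ae_of_all _ fun x => ?_)).trans (integral_zero _ _)
    by_cases hx : x ∈ W <;> simp [hfdef, hx]
  -- The `k + 1` marginal entropies sum to at most `max c 0 * (k + 1)`, so one of them is at most
  -- the average bound.
  obtain ⟨i, hi⟩ : ∃ i, -max c 0 ≤ ∫ t, marginalDensity f i t * Real.log (marginalDensity f i t) := by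
    by_contra! hcon
    have h1 := Finset.sum_lt_sum_of_nonempty (Finset.univ_nonempty (α := Fin (k + 1)))
      fun i _ => hcon i
    simp only [Finset.sum_const, Finset.card_univ, Fintype.card_fin, nsmul_eq_mul] at h1
    rw [hzero, zero_sub] at hent
    have h2 : ENNReal.ofReal (c * ((k + 1 : ℕ) : ℝ)) ≤ ENNReal.ofReal (max c 0 * ((k + 1 : ℕ) : ℝ)) :=
      ENNReal.ofReal_le_ofReal (by gcongr; exact le_max_left _ _)
    have h3 := (ENNReal.ofReal_le_ofReal_iff
      (mul_nonneg (le_max_right _ _) (Nat.cast_nonneg _))).1 (hent.trans h2)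
    linarith
  set g := marginalDensity f i with hg
  have hgl : LogConcaveDensity g := hf.logConcaveDensity_marginalDensity i
  obtain ⟨hgpos, hjen⟩ := hgl.integral_mul_log_le_log
  have hlow : Real.exp (-max c 0) ≤ g (∫ t, t * g t) := by
    rw [← Real.exp_log hgpos]
    exact Real.exp_le_exp.2 (hi.trans hjen)
  -- The barycentre of the marginal is the coordinate of the centroid along `b i`, so the section
  -- found by Jensen's inequality passes through the centroid.
  have hmean : ∫ t, t * g t = ⟪b i, bodyCentroid K⟫ := by
    have hint : IntegrableOn (fun x => x) U := by
      have := hU1.isProbabilityMeasure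
      have := hU1.memLp_id.integrable one_le_two
      rwa [densityMeasure_indicator hUm] at this
    have e1 : bodyCentroid K = ∫ x in U, x := by
      rw [bodyCentroid, setAverage_eq, Measure.real, hv]
      simp only [ENNReal.toReal_one, inv_one, one_smul]
      exact (setIntegral_congr_set hUK).symm
    have e2 : ⟪b i, ∫ x in U, x⟫ = ∫ x in U, ⟪b i, x⟫ := (integral_inner hint _).symm
    rw [e1, e2]
    have e3 : ∫ t, t * g t = ∫ x, x i ∂densityMeasure f := by
      have := hf.map_densityMeasure i
      rw [← integral_map (φ := fun x : EuclideanSpace ℝ (Fin (k + 1)) => x i) (f := fun t => t)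
        (Measurable.aemeasurable (by fun_prop)) measurable_id.aestronglyMeasurable, this,
        integral_withDensity_ofReal hgl.measurable hgl.nonneg]
      simp_rw [mul_comm]
    rw [e3, hfdef, densityMeasure_indicator hWm, hW,
      ← b.measurePreserving_repr_symm.setIntegral_preimage_emb
        b.repr.symm.toHomeomorph.measurableEmbedding (fun x => ⟪b i, x⟫)]
    simp only [← b.repr_apply_apply, LinearIsometryEquiv.apply_symm_apply]
  obtain ⟨H, hH1, hH2, hH3⟩ := exists_hyperplane_of_basis b i (bodyCentroid K)
  refine ⟨H, hH1, hH2, (ENNReal.ofReal_le_ofReal hlow).trans ?_⟩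
  rw [hmean, hg, hf.ofReal_marginalDensity, hH3, Nat.add_sub_cancel,
    ← EuclideanSpace.volume_insertCoord_mem]
  have hms : MeasurableSet {y : Fin k → ℝ | insertCoord i ⟪b i, bodyCentroid K⟫ y ∈ W} :=
    ((measurable_insertCoord i).comp measurable_prodMk_left) hWm
  calc ∫⁻ y : Fin k → ℝ, ENNReal.ofReal (f (insertCoord i ⟪b i, bodyCentroid K⟫ y))
      = ∫⁻ y : Fin k → ℝ, {y : Fin k → ℝ | insertCoord i ⟪b i, bodyCentroid K⟫ y ∈ W}.indicator 1 y := by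
        refine lintegral_congr fun y => ?_
        by_cases hy : insertCoord i ⟪b i, bodyCentroid K⟫ y ∈ W <;> simp [hfdef, hy]
    _ = volume {y : Fin k → ℝ | insertCoord i ⟪b i, bodyCentroid K⟫ y ∈ W} :=
        lintegral_indicator_one hms
    _ ≤ _ := measure_mono fun y hy => interior_subset (s := K) hy

end

/-! ### Gaussian densities and entropy maximization: from the entropic to the independence form. -/

noncomputable section

open Set
open scoped ENNReal RealInnerProductSpace MatrixOrder

section AffineMap

variable {n : ℕ}

theorem Matrix.det_toEuclideanCLM (A : Matrix (Fin n) (Fin n) ℝ) :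
    LinearMap.det (Matrix.toEuclideanCLM (𝕜 := ℝ) A : EuclideanSpace ℝ (Fin n) →ₗ[ℝ]
      EuclideanSpace ℝ (Fin n)) = A.det := by
  rw [Matrix.coe_toEuclideanCLM_eq_toEuclideanLin, Matrix.toEuclideanLin_eq_toLin_orthonormal,
    LinearMap.det_toLin]

theorem Matrix.toEuclideanCLM_inv_apply_self {A : Matrix (Fin n) (Fin n) ℝ} (hA : A.det ≠ 0)
    (x : EuclideanSpace ℝ (Fin n)) :
    Matrix.toEuclideanCLM (𝕜 := ℝ) A⁻¹ (Matrix.toEuclideanCLM (𝕜 := ℝ) A x) = x := by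
  rw [← ContinuousLinearMap.comp_apply, ← ContinuousLinearMap.mul_def, ← map_mul,
    Matrix.nonsing_inv_mul _ (isUnit_iff_ne_zero.2 hA), map_one, one_apply_eq_self]

theorem lintegral_comp_toEuclideanCLM {A : Matrix (Fin n) (Fin n) ℝ} (hA : A.det ≠ 0)
    {F : EuclideanSpace ℝ (Fin n) → ℝ≥0∞} (hF : Measurable F) :
    ∫⁻ x, F (Matrix.toEuclideanCLM (𝕜 := ℝ) A x) = ENNReal.ofReal |A.det⁻¹| * ∫⁻ x, F x := by
  have h := Measure.map_linearMap_addHaar_eq_smul_addHaar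
    (volume : Measure (EuclideanSpace ℝ (Fin n)))
    (f := (Matrix.toEuclideanCLM (𝕜 := ℝ) A : EuclideanSpace ℝ (Fin n) →ₗ[ℝ]
      EuclideanSpace ℝ (Fin n))) (by rwa [Matrix.det_toEuclideanCLM])
  rw [Matrix.det_toEuclideanCLM] at h
  rw [← smul_eq_mul, ← lintegral_smul_measure, ← h, lintegral_map hF]
  · rfl
  · exact (Matrix.toEuclideanCLM (𝕜 := ℝ) A).measurable

theorem map_affine_withDensity {A : Matrix (Fin n) (Fin n) ℝ} (hA : A.det ≠ 0)
    (m : EuclideanSpace ℝ (Fin n)) {φ : EuclideanSpace ℝ (Fin n) → ℝ≥0∞} (hφ : Measurable φ) :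
    (volume.withDensity φ).map (fun x => m + Matrix.toEuclideanCLM (𝕜 := ℝ) A x) =
      volume.withDensity fun x => ENNReal.ofReal |A.det⁻¹| *
        φ (Matrix.toEuclideanCLM (𝕜 := ℝ) A⁻¹ (x - m)) := by
  ext s hs
  have hT : Measurable fun x => m + Matrix.toEuclideanCLM (𝕜 := ℝ) A x := by fun_prop
  have hφ' : Measurable fun x => φ (Matrix.toEuclideanCLM (𝕜 := ℝ) A⁻¹ (x - m)) :=
    hφ.comp (by fun_prop)
  have hG : Measurable fun x => (s.indicator fun x =>
      φ (Matrix.toEuclideanCLM (𝕜 := ℝ) A⁻¹ (x - m))) (m + x) :=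
    (hφ'.indicator hs).comp (measurable_const_add m)
  rw [Measure.map_apply hT hs, withDensity_apply _ (hT hs), withDensity_apply _ hs,
    lintegral_const_mul _ hφ', ← lintegral_indicator hs,
    ← lintegral_add_left_eq_self (s.indicator _) m, ← lintegral_comp_toEuclideanCLM hA hG, ← lintegral_indicator (hT hs)]
  refine lintegral_congr fun x => ?_
  by_cases hx : m + Matrix.toEuclideanCLM (𝕜 := ℝ) A x ∈ s
  · rw [indicator_of_mem (show x ∈ _ from hx), indicator_of_mem hx,
      add_sub_cancel_left, Matrix.toEuclideanCLM_inv_apply_self hA]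
  · rw [indicator_of_notMem (show x ∉ _ from hx), indicator_of_notMem hx]

end AffineMap

section Gaussian

variable {n : ℕ}

/-- The density of the standard Gaussian measure. -/
def stdGaussianDensity (x : EuclideanSpace ℝ (Fin n)) : ℝ :=
  (Real.sqrt (2 * Real.pi))⁻¹ ^ n * Real.exp (-‖x‖ ^ 2 / 2)

theorem measurable_stdGaussianDensity : Measurable (stdGaussianDensity (n := n)) := by
  unfold stdGaussianDensity
  fun_prop

theorem stdGaussianDensity_pos (x : EuclideanSpace ℝ (Fin n)) : 0 < stdGaussianDensity x := by
  have := Real.pi_pos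
  unfold stdGaussianDensity
  positivity

theorem stdGaussian_eq_withDensity :
    stdGaussian (EuclideanSpace ℝ (Fin n)) =
      volume.withDensity fun x => ENNReal.ofReal (stdGaussianDensity x) := by
  have h0 : gaussianReal 0 1 = volume.withDensity (gaussianPDF 0 1) :=
    gaussianReal_of_var_ne_zero 0 one_ne_zero
  have : SigmaFinite ((volume : Measure ℝ).withDensity (gaussianPDF 0 1)) := by
    rw [← h0]; infer_instance
  rw [← map_pi_eq_stdGaussian, h0, pi_withDensity _ fun _ => measurable_gaussianPDF 0 1]
  have h1 : (fun x : Fin n → ℝ => ∏ i, gaussianPDF 0 1 (x i)) =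
      fun x => ENNReal.ofReal (stdGaussianDensity (WithLp.toLp 2 x)) := by
    ext x
    simp only [gaussianPDF]
    rw [← ENNReal.ofReal_prod_of_nonneg fun i _ => gaussianPDFReal_nonneg 0 1 _]
    congr 1
    simp only [gaussianPDFReal_def, Finset.prod_mul_distrib, Finset.prod_const, Finset.card_univ,
      Fintype.card_fin, stdGaussianDensity, EuclideanSpace.real_norm_sq_eq, ← Real.exp_sum]
    congr 2
    · simp
    · rw [← Finset.sum_neg_distrib, Finset.sum_div]
      simp
  ext s hs
  rw [Measure.map_apply (WithLp.measurable_toLp 2 _) hs,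
    withDensity_apply _ (WithLp.measurable_toLp 2 _ hs), withDensity_apply _ hs, h1]
  exact (PiLp.volume_preserving_toLp (Fin n)).setLIntegral_comp_preimage hs
    measurable_stdGaussianDensity.ennreal_ofReal

theorem multivariateGaussian_eq_withDensity (m : EuclideanSpace ℝ (Fin n))
    (S : Matrix (Fin n) (Fin n) ℝ) (hdet : (CFC.sqrt S).det ≠ 0) :
    multivariateGaussian m S = volume.withDensity fun x => ENNReal.ofReal
      (|(CFC.sqrt S).det⁻¹| *
        stdGaussianDensity (Matrix.toEuclideanCLM (𝕜 := ℝ) (CFC.sqrt S)⁻¹ (x - m))) := by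
  rw [multivariateGaussian, stdGaussian_eq_withDensity, map_affine_withDensity hdet _
    measurable_stdGaussianDensity.ennreal_ofReal]
  simp_rw [ENNReal.ofReal_mul (abs_nonneg _)]

end Gaussian

namespace IsLogConcaveDensity

variable {n : ℕ} {f : EuclideanSpace ℝ (Fin n) → ℝ}

/-- A direction of zero variance would concentrate the whole measure on an affine hyperplane, which
is null for an absolutely continuous measure. -/
theorem posDef_covarianceMatrix (hf : IsLogConcaveDensity f) :
    (covarianceMatrix (densityMeasure f)).PosDef := by
  have := hf.isProbabilityMeasure
  refine Matrix.PosDef.of_dotProduct_mulVec_pos (covarianceMatrix_isHermitian _) fun v hv => ?_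
  set w : EuclideanSpace ℝ (Fin n) := WithLp.toLp 2 v with hw
  have hw0 : w ≠ 0 := by
    intro h
    apply hv
    have := congrArg WithLp.ofLp h
    simpa [hw] using this
  have hX : MemLp (fun x => ⟪w, x⟫) 2 (densityMeasure f) := hf.memLp_id.const_inner w
  have h1 := hf.covariance_inner w w
  rw [covariance_self hX.aestronglyMeasurable.aemeasurable] at h1
  rw [star_trivial, ← show w.ofLp = v from rfl, ← h1]
  refine lt_of_le_of_ne (variance_nonneg _ _) fun h0 => ?_
  have h2 := ae_eq_integral_of_variance_eq_zero hX h0.symm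
  set c := ∫ x, ⟪w, x⟫ ∂densityMeasure f with hc
  have hnull : volume {x : EuclideanSpace ℝ (Fin n) | ⟪w, x⟫ = c} = 0 := by
    have hs : {x : EuclideanSpace ℝ (Fin n) | ⟪w, x⟫ = c} =
        (AffineSubspace.mk' ((c / ‖w‖ ^ 2) • w) (ℝ ∙ w)ᗮ : AffineSubspace ℝ _) := by
      ext x
      have hne : ‖w‖ ^ 2 ≠ 0 := by simpa using hw0
      rw [SetLike.mem_coe, AffineSubspace.mem_mk',
        Submodule.mem_orthogonal_singleton_iff_inner_right, vsub_eq_sub, inner_sub_right,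
        inner_smul_right, real_inner_self_eq_norm_sq, div_mul_cancel₀ _ hne, sub_eq_zero]
      rfl
    rw [hs]
    refine Measure.addHaar_affineSubspace _ _ fun htop => ?_
    have h3 := congrArg AffineSubspace.direction htop
    rw [AffineSubspace.direction_mk', AffineSubspace.direction_top] at h3
    have h4 : w ∈ (ℝ ∙ w)ᗮ := h3 ▸ Submodule.mem_top
    rw [Submodule.mem_orthogonal_singleton_iff_inner_right, inner_self_eq_zero] at h4
    exact hw0 h4
  have h5 : densityMeasure f {x | ⟪w, x⟫ = c} = 0 := withDensity_absolutelyContinuous _ _ hnull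
  have h6 : ∀ᵐ x ∂densityMeasure f, False := by
    filter_upwards [h2, measure_eq_zero_iff_ae_notMem.1 h5] with x hx hx'
    exact hx' hx
  exact IsProbabilityMeasure.ne_zero (densityMeasure f) (by simpa using h6)

/-- The mean of the quadratic form given by the inverse covariance matrix. -/
theorem integral_norm_sq_whitened (hf : IsLogConcaveDensity f) {A : Matrix (Fin n) (Fin n) ℝ}
    (hA : A.IsHermitian) (hdet : A.det ≠ 0) (hAA : A * A = covarianceMatrix (densityMeasure f)) :
    Integrable (fun x => ‖Matrix.toEuclideanCLM (𝕜 := ℝ) A⁻¹ (x - ∫ x, x ∂densityMeasure f)‖ ^ 2)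
      (densityMeasure f) ∧
    ∫ x, ‖Matrix.toEuclideanCLM (𝕜 := ℝ) A⁻¹ (x - ∫ x, x ∂densityMeasure f)‖ ^ 2
      ∂densityMeasure f = n := by
  have := hf.isProbabilityMeasure
  have hid : Integrable (fun x => x) (densityMeasure f) := hf.memLp_id.integrable one_le_two
  set m := ∫ x, x ∂densityMeasure f with hm
  let r : Fin n → EuclideanSpace ℝ (Fin n) := fun i => WithLp.toLp 2 (A⁻¹ i)
  have hcoord : ∀ i x, Matrix.toEuclideanCLM (𝕜 := ℝ) A⁻¹ (x - m) i = ⟪r i, x⟫ - ⟪r i, m⟫ := by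
    intro i x
    rw [← inner_sub_right, Matrix.ofLp_toEuclideanCLM, EuclideanSpace.inner_eq_star_dotProduct,
      dotProduct_comm]
    simp [r, Matrix.mulVec]
  have hmean : ∀ i, ⟪r i, m⟫ = ∫ x, ⟪r i, x⟫ ∂densityMeasure f := fun i =>
    (integral_inner hid _).symm
  have hX : ∀ i, MemLp (fun x => ⟪r i, x⟫) 2 (densityMeasure f) := fun i =>
    hf.memLp_id.const_inner _
  have hXi : ∀ i, Integrable (fun x => (⟪r i, x⟫ - ⟪r i, m⟫) ^ 2) (densityMeasure f) := fun i =>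
    ((hX i).sub (memLp_const _)).integrable_sq
  have hunit : IsUnit A.det := isUnit_iff_ne_zero.2 hdet
  have hinv : A⁻¹.IsHermitian := hA.inv
  -- Row `i` of `A⁻¹` defines a linear form of variance `eᵢ A⁻¹ (A A) A⁻¹ eᵢ = 1`. The whitened
  -- vector thus has `n` coordinates of unit variance.
  have hone : ∀ i, ∫ x, (⟪r i, x⟫ - ⟪r i, m⟫) ^ 2 ∂densityMeasure f = 1 := by
    intro i
    have h1 : ∫ x, (⟪r i, x⟫ - ⟪r i, m⟫) ^ 2 ∂densityMeasure f =
        cov[fun x => ⟪r i, x⟫, fun x => ⟪r i, x⟫; densityMeasure f] := by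
      rw [covariance, ← hmean]
      simp_rw [sq]
    rw [h1, hf.covariance_inner, ← hAA, ← Matrix.mulVec_mulVec]
    have h2 : A.mulVec (r i).ofLp = Pi.single i 1 := by
      ext j
      have : (A * A⁻¹) j i = (1 : Matrix (Fin n) (Fin n) ℝ) j i := by
        rw [Matrix.mul_nonsing_inv _ hunit]
      rw [Matrix.mul_apply] at this
      simp only [Matrix.mulVec, dotProduct, r]
      calc ∑ l, A j l * A⁻¹ i l = ∑ l, A j l * A⁻¹ l i :=
            Finset.sum_congr rfl fun l _ => by rw [← hinv.apply l i, star_trivial]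
        _ = Pi.single (M := fun _ => ℝ) i 1 j := by
            rw [this, Matrix.one_apply, Pi.single_apply]
    rw [h2]
    have : (A⁻¹ * A) i i = (1 : Matrix (Fin n) (Fin n) ℝ) i i := by
      rw [Matrix.nonsing_inv_mul _ hunit]
    rw [Matrix.mul_apply, Matrix.one_apply_eq] at this
    simpa [dotProduct, r] using this
  simp_rw [EuclideanSpace.real_norm_sq_eq, hcoord]
  refine ⟨integrable_finsetSum _ fun i _ => hXi i, ?_⟩
  rw [integral_finsetSum _ fun i _ => hXi i]
  simp [hone]

/-- `D(f)` in terms of the entropy and the covariance matrix. -/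
theorem entropyFromGaussianity_eq (hf : IsLogConcaveDensity f) :
    entropyFromGaussianity f = ENNReal.ofReal ((∫ x, f x * Real.log (f x)) +
      (n / 2 * Real.log (2 * Real.pi) +
        Real.log (covarianceMatrix (densityMeasure f)).det / 2 + n / 2)) := by
  have hP := hf.isProbabilityMeasure
  have hpos := hf.posDef_covarianceMatrix
  set S := covarianceMatrix (densityMeasure f) with hS
  set A := CFC.sqrt S with hA
  have hAA : A * A = S := CFC.sqrt_mul_sqrt_self S hpos.posSemidef.nonneg
  have hdetsq : A.det * A.det = S.det := by rw [← Matrix.det_mul, hAA]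
  have hdet : A.det ≠ 0 := by
    intro h
    have := hpos.det_pos
    rw [← hdetsq, h, zero_mul] at this
    exact lt_irrefl _ this
  have hAH : A.IsHermitian := (CFC.sqrt_nonneg S).isSelfAdjoint
  obtain ⟨hint, hval⟩ := hf.integral_norm_sq_whitened hAH hdet hAA
  set m := ∫ x, x ∂densityMeasure f with hm
  set g : EuclideanSpace ℝ (Fin n) → ℝ := fun x => |A.det⁻¹| *
    stdGaussianDensity (Matrix.toEuclideanCLM (𝕜 := ℝ) A⁻¹ (x - m)) with hg
  have hgpos : ∀ x, 0 < g x := fun x =>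
    mul_pos (abs_pos.2 (inv_ne_zero hdet)) (stdGaussianDensity_pos _)
  have hgm : Measurable g :=
    (measurable_stdGaussianDensity.comp (by fun_prop)).const_mul _
  have hG : matchingGaussian (densityMeasure f) =
      volume.withDensity fun x => ENNReal.ofReal (g x) := by
    rw [matchingGaussian, multivariateGaussian_eq_withDensity _ _ hdet]
  -- `log g` is a constant minus half of a quadratic form with mean `n`, so the cross term `∫ f log
  -- g` depends on `f` only through its covariance matrix.
  have hlog : ∀ x, Real.log (g x) = -(n / 2 * Real.log (2 * Real.pi) + Real.log S.det / 2) -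
      ‖Matrix.toEuclideanCLM (𝕜 := ℝ) A⁻¹ (x - m)‖ ^ 2 / 2 := by
    intro x
    have h2 : 0 < Real.sqrt (2 * Real.pi) := by have := Real.pi_pos; positivity
    simp only [hg, stdGaussianDensity]
    rw [Real.log_mul (abs_pos.2 (inv_ne_zero hdet)).ne' (by positivity),
      Real.log_mul (by positivity) (Real.exp_pos _).ne', Real.log_exp, Real.log_pow, Real.log_inv,
      Real.log_sqrt (by have := Real.pi_pos; positivity), Real.log_abs, Real.log_inv, ← hdetsq,
      Real.log_mul hdet hdet]
    ring
  have hgint : Integrable (fun x => Real.log (g x)) (densityMeasure f) := by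
    simp_rw [hlog]
    exact (integrable_const _).sub (hint.div_const 2)
  have hQ : IsProbabilityMeasure (matchingGaussian (densityMeasure f)) := by
    rw [matchingGaussian]; infer_instance
  rw [entropyFromGaussianity]
  rw [hG] at hQ ⊢
  have hP' := hP
  rw [densityMeasure] at hP'
  refine (klDiv_withDensity_ofReal hf.measurable hgm hf.nonneg
    (ae_of_all _ fun x _ => hgpos x) (hf.integrable_log.sub hgint)).trans ?_
  congr 1
  have h1 : ∫ x, Real.log (g x) ∂densityMeasure f =
      -(n / 2 * Real.log (2 * Real.pi) + Real.log S.det / 2 + n / 2) := by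
    simp_rw [hlog]
    rw [integral_sub (integrable_const _) (hint.div_const 2), integral_const, integral_div, hval]
    simp
    ring
  refine (integral_sub hf.integrable_log hgint).trans ?_
  rw [h1, sub_neg_eq_add]
  congr 1
  exact integral_withDensity_ofReal hf.measurable hf.nonneg _

end IsLogConcaveDensity

/-- Gibbs' inequality. -/
theorem integral_log_sub_log_nonneg {α : Type*} [MeasurableSpace α] {μ : Measure α}
    [SigmaFinite μ] {f g : α → ℝ} (hf : Measurable f) (hg : Measurable g)
    (hf0 : ∀ x, 0 ≤ f x) (hpos : ∀ᵐ x ∂μ, 0 < f x → 0 < g x)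
    [IsProbabilityMeasure (μ.withDensity fun x => ENNReal.ofReal (f x))]
    [IsProbabilityMeasure (μ.withDensity fun x => ENNReal.ofReal (g x))]
    (hint : Integrable (fun x => Real.log (f x) - Real.log (g x))
      (μ.withDensity fun x => ENNReal.ofReal (f x))) :
    0 ≤ ∫ x, (Real.log (f x) - Real.log (g x)) ∂μ.withDensity fun x => ENNReal.ofReal (f x) := by
  have h := llr_withDensity_ofReal hf hg hf0 hpos
  have := integral_llr_add_sub_measure_univ_nonneg
    (absolutelyContinuous_withDensity_ofReal hf hg hf0 hpos) ((integrable_congr h).2 hint)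
  rw [integral_congr_ae h] at this
  simpa using this

namespace IsLogConcaveDensity

variable {k : ℕ} {f : EuclideanSpace ℝ (Fin (k + 1)) → ℝ}

/-- Among measures with given variance the Gaussian maximizes the entropy. -/
theorem neg_entropy_marginalDensity_le (hf : IsLogConcaveDensity f) (i : Fin (k + 1)) :
    -∫ t, marginalDensity f i t * Real.log (marginalDensity f i t) ≤
      Real.log (2 * Real.pi) / 2 +
        Real.log (covarianceMatrix (densityMeasure f) i i) / 2 + 1 / 2 := by
  have hP := hf.isProbabilityMeasure
  set v := covarianceMatrix (densityMeasure f) i i with hv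
  have hvpos : 0 < v := hf.posDef_covarianceMatrix.diag_pos
  set m := ∫ x, x i ∂densityMeasure f with hm
  set w : NNReal := ⟨v, hvpos.le⟩ with hw
  have hw0 : w ≠ 0 := by
    intro h
    exact hvpos.ne' (congrArg NNReal.toReal h)
  have hgl := hf.logConcaveDensity_marginalDensity i
  have hmc : Measurable fun x : EuclideanSpace ℝ (Fin (k + 1)) => x i := by fun_prop
  have hmap := hf.map_densityMeasure i
  have h1 : IsProbabilityMeasure (volume.withDensity fun t =>
      ENNReal.ofReal (marginalDensity f i t)) := by
    rw [← hmap]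
    exact Measure.isProbabilityMeasure_map hmc.aemeasurable
  have h2 : IsProbabilityMeasure (volume.withDensity fun t =>
      ENNReal.ofReal (gaussianPDFReal m w t)) := by
    have : IsProbabilityMeasure (gaussianReal m w) := inferInstance
    rwa [gaussianReal_of_var_ne_zero m hw0] at this
  have hlog : ∀ t, Real.log (gaussianPDFReal m w t) =
      -(Real.log (2 * Real.pi) / 2 + Real.log v / 2) - (t - m) ^ 2 / (2 * v) := by
    intro t
    have hp := Real.pi_pos
    have h2 : 0 < Real.sqrt (2 * Real.pi * v) := by positivity
    have e : (w : ℝ) = v := rfl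
    rw [gaussianPDFReal_def]
    simp only [e]
    rw [Real.log_mul (by positivity) (Real.exp_pos _).ne', Real.log_exp, Real.log_inv,
      Real.log_sqrt (by positivity), Real.log_mul (by positivity) hvpos.ne']
    ring
  have hsq : Integrable (fun t => (t - m) ^ 2)
      (volume.withDensity fun t => ENNReal.ofReal (marginalDensity f i t)) := by
    rw [← hmap, integrable_map_measure (by fun_prop) hmc.aemeasurable]
    exact ((hf.memLp_coord i).sub (memLp_const m)).integrable_sq
  have hsqv : ∫ t, (t - m) ^ 2
      ∂(volume.withDensity fun t => ENNReal.ofReal (marginalDensity f i t)) = v := by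
    rw [← hmap, integral_map hmc.aemeasurable (by fun_prop), hv, covarianceMatrix,
      Matrix.of_apply, covariance]
    simp_rw [sq]
    rfl
  have hgint : Integrable (fun t => Real.log (gaussianPDFReal m w t))
      (volume.withDensity fun t => ENNReal.ofReal (marginalDensity f i t)) := by
    simp_rw [hlog]
    exact (integrable_const _).sub (hsq.div_const _)
  have hfint := (integrable_withDensity_ofReal hgl.measurable hgl.nonneg).2 hgl.integrable_mul_log
  have key := integral_log_sub_log_nonneg hgl.measurable (measurable_gaussianPDFReal m w)
    hgl.nonneg (ae_of_all _ fun t _ => gaussianPDFReal_pos m w t hw0) (hfint.sub hgint)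
  rw [integral_sub hfint hgint, integral_withDensity_ofReal hgl.measurable hgl.nonneg] at key
  have h3 : ∫ t, Real.log (gaussianPDFReal m w t)
      ∂(volume.withDensity fun t => ENNReal.ofReal (marginalDensity f i t)) =
      -(Real.log (2 * Real.pi) / 2 + Real.log v / 2) - 1 / 2 := by
    simp_rw [hlog]
    rw [integral_sub (integrable_const _) (hsq.div_const _), integral_const, integral_div, hsqv]
    simp only [probReal_univ, one_smul]
    congr 1
    field_simp
  rw [h3] at key
  linarith

/-- For a diagonal covariance matrix `log det` is the sum of the logarithms of the variances. The
Gaussian term of `D(f)` therefore splits into the Gaussian bounds for the individual marginals. -/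
theorem entropyFromIndependence_le (hf : IsLogConcaveDensity f)
    (hdiag : (covarianceMatrix (densityMeasure f)).IsDiag) :
    entropyFromIndependence f ≤ entropyFromGaussianity f := by
  rw [hf.entropyFromIndependence_eq, hf.entropyFromGaussianity_eq]
  refine ENNReal.ofReal_le_ofReal ?_
  have h := Finset.sum_le_sum fun i (_ : i ∈ Finset.univ) => hf.neg_entropy_marginalDensity_le i
  have hdet : (covarianceMatrix (densityMeasure f)).det =
      ∏ i, covarianceMatrix (densityMeasure f) i i := by
    conv_lhs => rw [← hdiag.diagonal_diag]
    rw [Matrix.det_diagonal]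
    rfl
  rw [hdet, Real.log_prod fun i _ => hf.posDef_covarianceMatrix.diag_pos.ne']
  rw [Finset.sum_neg_distrib, Finset.sum_add_distrib, Finset.sum_add_distrib] at h
  simp only [Finset.sum_const, Finset.card_univ, Fintype.card_fin, nsmul_eq_mul] at h
  rw [← Finset.sum_div] at h
  linarith

end IsLogConcaveDensity

theorem entropicIndependenceConjecture_of_entropicHyperplaneConjecture
    (h : EntropicHyperplaneConjecture) : EntropicIndependenceConjecture := by
  obtain ⟨c, hc⟩ := h
  refine ⟨c, fun n hn f hf hdiag => ?_⟩
  obtain ⟨k, rfl⟩ : ∃ k, n = k + 1 := ⟨n - 1, by omega⟩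
  exact (hf.entropyFromIndependence_le hdiag).trans (hc _ hn f hf)

end

/-! ### Moments on the half-line and along rays. -/

noncomputable section

open Set
open scoped ENNReal RealInnerProductSpace

section HalfLine

theorem lintegral_Ioi_comp_mul {l : ℝ} (hl : 0 < l) (G : ℝ → ℝ≥0∞) :
    ∫⁻ r in Ioi (0 : ℝ), G r = ∫⁻ r in Ioi (0 : ℝ), ENNReal.ofReal l * G (l * r) := by
  have himg : (fun r : ℝ => l * r) '' Ioi 0 = Ioi 0 := by
    rw [image_mul_left_Ioi hl, mul_zero]
  have h := lintegral_image_eq_lintegral_abs_deriv_mul (s := Ioi (0 : ℝ)) measurableSet_Ioi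
    (f := fun r => l * r) (f' := fun _ => l)
    (fun x _ => by simpa using ((hasDerivAt_id x).const_mul l).hasDerivWithinAt)
    (fun x _ y _ h => mul_left_cancel₀ hl.ne' h) G
  rw [himg] at h
  simpa [abs_of_pos hl] using h

theorem lintegral_Ioi_comp_inv (G : ℝ → ℝ≥0∞) :
    ∫⁻ r in Ioi (0 : ℝ), G r = ∫⁻ u in Ioi (0 : ℝ), ENNReal.ofReal (u⁻¹ ^ 2) * G u⁻¹ := by
  have himg : (fun r : ℝ => r⁻¹) '' Ioi 0 = Ioi 0 := by
    ext x
    constructor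
    · rintro ⟨r, hr, rfl⟩
      exact inv_pos.2 (mem_Ioi.1 hr)
    · intro hx
      exact ⟨x⁻¹, inv_pos.2 (mem_Ioi.1 hx), inv_inv x⟩
  have h := lintegral_image_eq_lintegral_abs_deriv_mul (s := Ioi (0 : ℝ)) measurableSet_Ioi
    (f := fun r => r⁻¹) (f' := fun r => -(r ^ 2)⁻¹)
    (fun x hx => (hasDerivAt_inv (ne_of_gt hx)).hasDerivWithinAt)
    (fun x _ y _ h => inv_injective h) G
  rw [himg] at h
  rw [h]
  refine lintegral_congr fun u => ?_
  rw [abs_neg, abs_of_nonneg (by positivity), inv_pow]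

theorem integral_pow_mul_exp_Ioi (p : ℕ) {a : ℝ} (ha : 0 < a) :
    IntegrableOn (fun r : ℝ => r ^ p * Real.exp (-(a * r))) (Ioi 0) ∧
      ∫ r in Ioi (0 : ℝ), r ^ p * Real.exp (-(a * r)) = p.factorial / a ^ (p + 1) := by
  have h := Real.integral_rpow_mul_exp_neg_mul_Ioi (a := (p + 1 : ℝ)) (r := a) (by positivity) ha
  have h1 : ∫ r in Ioi (0 : ℝ), r ^ p * Real.exp (-(a * r)) = p.factorial / a ^ (p + 1) := by
    rw [Real.Gamma_nat_eq_factorial] at h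
    simp only [add_sub_cancel_right, Real.rpow_natCast] at h
    rw [h]
    have e : ((p : ℝ) + 1) = ((p + 1 : ℕ) : ℝ) := by push_cast; ring
    rw [e, Real.rpow_natCast, one_div, inv_pow]
    field_simp
  refine ⟨?_, h1⟩
  -- A function that is not integrable has Bochner integral `0` by convention, which contradicts the
  -- positive value just computed.
  by_contra hcon
  have h2 := integral_undef hcon
  rw [h1] at h2
  have : (0 : ℝ) < p.factorial / a ^ (p + 1) := by positivity
  linarith

/-- Comparison of moments of a log-concave function on the half-line with those of an
exponential function. -/
theorem integral_pow_add_two_mul_le {g : ℝ → ℝ} (p : ℕ)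
    (hg : ∀ r, 0 < r → ∀ θ, 0 < θ → θ < 1 → g r ^ θ ≤ g (θ * r))
    (hi : IntegrableOn (fun r => r ^ p * g r) (Ioi 0))
    (hi2 : IntegrableOn (fun r => r ^ (p + 2) * g r) (Ioi 0)) {a : ℝ} (ha : 0 < a)
    (hJ : ∫ r in Ioi (0 : ℝ), r ^ p * g r = p.factorial / a ^ (p + 1)) :
    ∫ r in Ioi (0 : ℝ), r ^ (p + 2) * g r ≤ (p + 2).factorial / a ^ (p + 3) := by
  obtain ⟨hei, hev⟩ := integral_pow_mul_exp_Ioi p ha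
  obtain ⟨hei2, hev2⟩ := integral_pow_mul_exp_Ioi (p + 2) ha
  rw [show p + 3 = p + 2 + 1 from rfl, ← hev2]
  set d : ℝ → ℝ := fun r => g r - Real.exp (-(a * r)) with hd
  have hdi : IntegrableOn (fun r => r ^ p * d r) (Ioi 0) := by
    simp only [hd, mul_sub]
    exact hi.sub hei
  have hdi2 : IntegrableOn (fun r => r ^ (p + 2) * d r) (Ioi 0) := by
    simp only [hd, mul_sub]
    exact hi2.sub hei2
  have hd0 : ∫ r in Ioi (0 : ℝ), r ^ p * d r = 0 := by
    simp only [hd, mul_sub]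
    rw [integral_sub hi hei, hJ, hev, sub_self]
  suffices h : ∫ r in Ioi (0 : ℝ), r ^ (p + 2) * d r ≤ 0 by
    simp only [hd, mul_sub] at h
    rw [integral_sub hi2 hei2] at h
    linarith
  -- The hypothesis on `g` is log-concavity from the value 1 at the origin, and the exponential
  -- satisfies it with equality. Hence, if `g` is above the exponential at `r`, it is above at all
  -- smaller points, and `d` passes at most once from nonnegative to nonpositive.
  have hdown : ∀ r s, 0 < s → s < r → 0 ≤ d r → 0 ≤ d s := by
    intro r s hs hsr hr
    have hr0 : 0 < r := hs.trans hsr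
    have h1 := hg r hr0 (s / r) (by positivity) ((div_lt_one hr0).2 hsr)
    rw [div_mul_cancel₀ _ hr0.ne'] at h1
    have h2 : Real.exp (-(a * r)) ^ (s / r) ≤ g r ^ (s / r) :=
      Real.rpow_le_rpow (Real.exp_pos _).le (sub_nonneg.1 hr) (by positivity)
    rw [← Real.exp_mul] at h2
    have e : -(a * r) * (s / r) = -(a * s) := by field_simp
    rw [e] at h2
    exact sub_nonneg.2 (h2.trans h1)
  by_cases hbdd : ∃ B, ∀ r, 0 < r → 0 ≤ d r → r ≤ B
  · obtain ⟨ρ, hρ0, hρ1, hρ2⟩ : ∃ ρ : ℝ, 0 ≤ ρ ∧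
        (∀ r, 0 < r → r < ρ → 0 ≤ d r) ∧ ∀ r, 0 < r → ρ < r → d r ≤ 0 := by
      by_cases hne : ∃ r, 0 < r ∧ 0 ≤ d r
      · obtain ⟨B, hB⟩ := hbdd
        set P : Set ℝ := {r | 0 < r ∧ 0 ≤ d r} with hP
        have hPb : BddAbove P := ⟨B, fun r hr => hB r hr.1 hr.2⟩
        obtain ⟨r₀, hr₀⟩ := hne
        have hne : P.Nonempty := ⟨r₀, hr₀⟩
        refine ⟨sSup P, hr₀.1.le.trans (le_csSup hPb hr₀), fun r hr hr2 => ?_, fun r hr hr2 => ?_⟩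
        · obtain ⟨s, hs, hrs⟩ := exists_lt_of_lt_csSup hne hr2
          exact hdown s r hr hrs hs.2
        · by_contra! hcon
          exact absurd (le_csSup hPb ⟨hr, hcon.le⟩) (not_le.2 hr2)
      · push Not at hne
        exact ⟨0, le_rfl, fun r h1 h2 => absurd h1 h2.not_gt, fun r hr _ => (hne r hr).le⟩
    -- With `ρ` the place of the sign change, `(r ^ 2 - ρ ^ 2) * d r ≤ 0` everywhere. After
    -- integration against `r ^ p` the `ρ ^ 2` term drops out, because the moments of order `p`
    -- agree.
    have hle : ∀ r ∈ Ioi (0 : ℝ), r ^ (p + 2) * d r ≤ ρ ^ 2 * (r ^ p * d r) := by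
      intro r hr
      have hr0 : (0 : ℝ) < r := hr
      have hrp : 0 < r ^ p := pow_pos hr0 p
      have hkey : (r ^ 2 - ρ ^ 2) * d r ≤ 0 := by
        rcases lt_trichotomy r ρ with h | h | h
        · exact mul_nonpos_of_nonpos_of_nonneg (by nlinarith) (hρ1 r hr0 h)
        · simp [h]
        · have h3 := hρ2 r hr0 h
          exact mul_nonpos_of_nonneg_of_nonpos (by nlinarith) h3
      calc r ^ (p + 2) * d r = r ^ p * ((r ^ 2 - ρ ^ 2) * d r) + ρ ^ 2 * (r ^ p * d r) := by ring
        _ ≤ 0 + ρ ^ 2 * (r ^ p * d r) := by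
            gcongr
            exact mul_nonpos_of_nonneg_of_nonpos hrp.le hkey
        _ = _ := zero_add _
    calc ∫ r in Ioi (0 : ℝ), r ^ (p + 2) * d r
        ≤ ∫ r in Ioi (0 : ℝ), ρ ^ 2 * (r ^ p * d r) :=
          setIntegral_mono_on hdi2 (hdi.const_mul _) measurableSet_Ioi hle
      _ = 0 := by rw [integral_const_mul, hd0, mul_zero]
  -- If `d` is nonnegative arbitrarily far out, it is nonnegative everywhere; the equality of the
  -- moments of order `p` then makes it vanish almost everywhere.
  · push Not at hbdd
    have hall : ∀ r ∈ Ioi (0 : ℝ), 0 ≤ d r := by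
      intro r hr
      obtain ⟨s, hs0, hs, hrs⟩ := hbdd r
      exact hdown s r hr hrs hs
    have h1 : (fun r => r ^ p * d r) =ᵐ[volume.restrict (Ioi 0)] 0 :=
      (setIntegral_eq_zero_iff_of_nonneg_ae (by
        refine (ae_restrict_iff' measurableSet_Ioi).2 (ae_of_all _ fun r hr => ?_)
        exact mul_nonneg (pow_nonneg (le_of_lt hr) _) (hall r hr)) hdi).1 hd0
    refine le_of_eq ((integral_congr_ae (h1.mono fun r hr => ?_)).trans (integral_zero _ _))
    have : r ^ p * d r = 0 := hr
    rw [pow_add, mul_right_comm, this, zero_mul]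

end HalfLine

/-- The moment of order `p` of a function along the ray spanned by `x`. -/
def rayMoment {E : Type*} [AddCommGroup E] [Module ℝ E] (φ : E → ℝ) (p : ℕ) (x : E) : ℝ≥0∞ :=
  ∫⁻ r in Ioi (0 : ℝ), ENNReal.ofReal (r ^ p * φ (r • x))

section RayMoment

variable {E : Type*} [AddCommGroup E] [Module ℝ E] {φ : E → ℝ}

theorem rayMoment_smul (p : ℕ) {l : ℝ} (hl : 0 < l) (x : E) :
    rayMoment φ p x = ENNReal.ofReal (l ^ (p + 1)) * rayMoment φ p (l • x) := by
  rw [rayMoment, lintegral_Ioi_comp_mul hl, rayMoment,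
    ← lintegral_const_mul' _ _ ENNReal.ofReal_ne_top]
  refine lintegral_congr fun r => ?_
  rw [← ENNReal.ofReal_mul hl.le, ← ENNReal.ofReal_mul (by positivity), smul_smul, mul_comm r l]
  congr 1
  ring

/-- The integrand of `rayMoment` in the inverse variable. -/
def invRay (φ : E → ℝ) (p : ℕ) (x : E) : ℝ → ℝ≥0∞ :=
  (Ioi (0 : ℝ)).indicator fun u => ENNReal.ofReal (u⁻¹ ^ (p + 2) * φ (u⁻¹ • x))

/-- The substitution `u = 1 / r` contributes the two extra powers in `invRay`. In this variable the
parameters on the rays of `x` and `y` combine linearly, as the one-dimensional inequality requires.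
-/
theorem lintegral_invRay (p : ℕ) (x : E) : ∫⁻ u, invRay φ p x u = rayMoment φ p x := by
  rw [rayMoment, lintegral_Ioi_comp_inv, invRay, lintegral_indicator measurableSet_Ioi]
  refine lintegral_congr fun u => ?_
  rw [← ENNReal.ofReal_mul (by positivity)]
  congr 1
  ring

theorem invRay_smul (p : ℕ) {l : ℝ} (hl : 0 < l) (x : E) (u : ℝ) :
    invRay φ p x u = ENNReal.ofReal (l ^ (p + 2)) * invRay φ p (l • x) (l * u) := by
  rcases lt_or_ge 0 u with hu | hu
  · rw [invRay, indicator_of_mem (mem_Ioi.2 hu), invRay,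
      indicator_of_mem (mem_Ioi.2 (mul_pos hl hu)), ← ENNReal.ofReal_mul (by positivity),
      smul_smul]
    have e : (l * u)⁻¹ * l = u⁻¹ := by field_simp
    rw [e]
    congr 1
    rw [← mul_assoc, ← mul_pow]
    congr 2
    field_simp
  · rw [invRay, indicator_of_notMem (by simpa using hu), invRay,
      indicator_of_notMem (by simpa using mul_nonpos_of_nonneg_of_nonpos hl.le hu), mul_zero]

theorem iSup_invRay_smul (p : ℕ) {l : ℝ} (hl : 0 < l) (x : E) :
    ⨆ u, invRay φ p x u = ENNReal.ofReal (l ^ (p + 2)) * ⨆ u, invRay φ p (l • x) u := by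
  rw [ENNReal.mul_iSup]
  refine le_antisymm (iSup_le fun u => ?_) (iSup_le fun u => ?_)
  · rw [invRay_smul p hl]
    exact le_iSup (fun u => ENNReal.ofReal (l ^ (p + 2)) * invRay φ p (l • x) u) (l * u)
  · have h := invRay_smul (φ := φ) p hl x (l⁻¹ * u)
    rw [mul_inv_cancel_left₀ hl.ne'] at h
    rw [← h]
    exact le_iSup (invRay φ p x) _

theorem Real.min_le_rpow_mul_rpow {a b u v : ℝ} (ha : 0 < a) (hb : 0 < b) (hab : a + b = 1)
    (hu : 0 ≤ u) (hv : 0 ≤ v) : min u v ≤ u ^ a * v ^ b := by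
  calc min u v = (min u v) ^ a * (min u v) ^ b := by
        rw [← Real.rpow_add_of_nonneg (le_min hu hv) ha.le hb.le, hab, Real.rpow_one]
    _ ≤ u ^ a * v ^ b := mul_le_mul (Real.rpow_le_rpow (le_min hu hv) (min_le_left _ _) ha.le)
        (Real.rpow_le_rpow (le_min hu hv) (min_le_right _ _) hb.le) (by
          have := le_min hu hv; positivity) (by positivity)

/-- With `w = a s + b t`, the point `(a x + b y) / w` is the convex combination of `x / s` and `y /
t` with weights `a s / w` and `b t / w`. Log-concavity handles `φ`. The arithmetic–geometric mean
inequality handles the powers, since the weighted mean of `1 / s` and `1 / t` is exactly `1 / w`. -/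
theorem min_invRay_le (hφ0 : ∀ x, 0 ≤ φ x) (hφ : ∀ x y : E, ∀ a b : ℝ, 0 < a → 0 < b → a + b = 1 →
    φ x ^ a * φ y ^ b ≤ φ (a • x + b • y)) (p : ℕ) (x y : E) {a b : ℝ} (ha : 0 < a) (hb : 0 < b)
    (hab : a + b = 1) (s t : ℝ) :
    min (invRay φ p x s) (invRay φ p y t) ≤ invRay φ p (a • x + b • y) (a * s + b * t) := by
  rcases le_or_gt s 0 with hs | hs
  · rw [invRay, indicator_of_notMem (by simpa using hs)]
    simp
  rcases le_or_gt t 0 with ht | ht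
  · rw [invRay, invRay, indicator_of_notMem (s := Ioi (0 : ℝ)) (a := t) (by simpa using ht)]
    simp
  set w := a * s + b * t with hw
  have hw0 : 0 < w := by positivity
  rw [invRay, indicator_of_mem (mem_Ioi.2 hs), invRay, indicator_of_mem (mem_Ioi.2 ht), invRay,
    indicator_of_mem (mem_Ioi.2 hw0)]
  rw [← ENNReal.ofReal_min]
  refine ENNReal.ofReal_le_ofReal ?_
  set α := a * s / w with hα
  set β := b * t / w with hβ
  have hα0 : 0 < α := by positivity
  have hβ0 : 0 < β := by positivity
  have hαβ : α + β = 1 := by rw [hα, hβ, ← add_div, ← hw, div_self hw0.ne']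
  have h1 := hφ0 (s⁻¹ • x)
  have h2 := hφ0 (t⁻¹ • y)
  refine (Real.min_le_rpow_mul_rpow hα0 hβ0 hαβ (by positivity) (by positivity)).trans ?_
  rw [Real.mul_rpow (by positivity) h1, Real.mul_rpow (by positivity) h2]
  have h3 : φ (s⁻¹ • x) ^ α * φ (t⁻¹ • y) ^ β ≤ φ (w⁻¹ • (a • x + b • y)) := by
    refine (hφ _ _ α β hα0 hβ0 hαβ).trans (le_of_eq ?_)
    congr 1
    rw [smul_add, smul_smul, smul_smul, smul_smul, smul_smul]
    congr 2
    · rw [hα]; field_simp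
    · rw [hβ]; field_simp
  have h4 : (s⁻¹ ^ (p + 2)) ^ α * (t⁻¹ ^ (p + 2)) ^ β ≤ w⁻¹ ^ (p + 2) := by
    have h5 : s⁻¹ ^ α * t⁻¹ ^ β ≤ w⁻¹ := by
      refine (Real.geom_mean_le_arith_mean2_weighted hα0.le hβ0.le (by positivity) (by positivity)
        hαβ).trans (le_of_eq ?_)
      have : a = 1 - b := by linarith
      rw [hα, hβ, this]
      field_simp
      ring
    calc (s⁻¹ ^ (p + 2)) ^ α * (t⁻¹ ^ (p + 2)) ^ β = (s⁻¹ ^ α * t⁻¹ ^ β) ^ (p + 2) := by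
          rw [mul_pow, ← Real.rpow_natCast, ← Real.rpow_mul (by positivity), ← Real.rpow_natCast,
            ← Real.rpow_mul (by positivity), ← Real.rpow_natCast, ← Real.rpow_mul (by positivity),
            ← Real.rpow_natCast, ← Real.rpow_mul (by positivity), mul_comm α, mul_comm β]
      _ ≤ _ := pow_le_pow_left₀ (by positivity) h5 _
  calc (s⁻¹ ^ (p + 2)) ^ α * φ (s⁻¹ • x) ^ α * ((t⁻¹ ^ (p + 2)) ^ β * φ (t⁻¹ • y) ^ β)
      = ((s⁻¹ ^ (p + 2)) ^ α * (t⁻¹ ^ (p + 2)) ^ β) * (φ (s⁻¹ • x) ^ α * φ (t⁻¹ • y) ^ β) := by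
        ring
    _ ≤ _ := mul_le_mul h4 h3 (by positivity) (by positivity)

theorem ordConnected_lt_invRay (hφ0 : ∀ x, 0 ≤ φ x) (hφ : ∀ x y : E, ∀ a b : ℝ, 0 < a → 0 < b →
    a + b = 1 → φ x ^ a * φ y ^ b ≤ φ (a • x + b • y)) (p : ℕ) (x : E) (t : ℝ≥0∞) :
    {u | t < invRay φ p x u}.OrdConnected := by
  refine Convex.ordConnected (convex_iff_forall_pos.2 fun r hr s hs a b ha hb hab => ?_)
  have h := min_invRay_le hφ0 hφ p x x ha hb hab r s
  rw [← add_smul, hab, one_smul] at h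
  exact lt_of_lt_of_le (lt_min hr hs) h

end RayMoment

end

/-! ### Ball's convexity theorem and integration over Ball's bodies. -/

noncomputable section

open Set
open scoped ENNReal RealInnerProductSpace

namespace LogConcaveDensity

section

variable {E : Type*} [NormedAddCommGroup E] [NormedSpace ℝ E] [FiniteDimensional ℝ E]
  [MeasureSpace E] [BorelSpace E] {φ : E → ℝ}

theorem measurable_rayIntegrand (hφ : LogConcaveDensity φ) (p : ℕ) :
    Measurable fun z : E × ℝ => ENNReal.ofReal (z.2 ^ p * φ (z.2 • z.1)) := by
  have h1 : Measurable fun z : E × ℝ => z.2 • z.1 := by fun_prop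
  exact ((measurable_snd.pow_const p).mul (hφ.measurable.comp h1)).ennreal_ofReal

theorem measurable_rayIntegrand_apply (hφ : LogConcaveDensity φ) (p : ℕ) (x : E) :
    Measurable fun r : ℝ => ENNReal.ofReal (r ^ p * φ (r • x)) :=
  (hφ.measurable_rayIntegrand p).comp (measurable_prodMk_left (x := x))

theorem measurable_rayMoment (hφ : LogConcaveDensity φ) (p : ℕ) : Measurable (rayMoment φ p) :=
  (hφ.measurable_rayIntegrand p).lintegral_prod_right'

omit [FiniteDimensional ℝ E] in
theorem measurable_invRay (hφ : LogConcaveDensity φ) (p : ℕ) (x : E) :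
    Measurable (invRay φ p x) := by
  have h1 : Measurable fun u : ℝ => u⁻¹ • x := by fun_prop
  exact ((measurable_inv.pow_const (p + 2)).mul
    (hφ.measurable.comp h1)).ennreal_ofReal.indicator measurableSet_Ioi

variable [(volume : Measure E).IsAddHaarMeasure]

theorem integrableOn_pow_mul_smul (hφ : LogConcaveDensity φ) (p : ℕ) {x : E} (hx : x ≠ 0) :
    IntegrableOn (fun r : ℝ => r ^ p * φ (r • x)) (Ioi 0) := by
  obtain ⟨C, c, hC, hc, h⟩ := hφ.exists_le_exp
  have hx0 : 0 < ‖x‖ := norm_pos_iff.2 hx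
  have hint := ((integral_pow_mul_exp_Ioi p (mul_pos hc hx0)).1).const_mul C
  have h1 : Measurable fun r : ℝ => r • x := by fun_prop
  refine Integrable.mono' hint ((measurable_id.pow_const p).mul
    (hφ.measurable.comp h1)).aestronglyMeasurable
    ((ae_restrict_iff' measurableSet_Ioi).2 (ae_of_all _ fun r hr => ?_))
  have hr0 : (0 : ℝ) < r := hr
  rw [Real.norm_of_nonneg (mul_nonneg (by positivity) (hφ.nonneg _))]
  calc r ^ p * φ (r • x) ≤ r ^ p * (C * Real.exp (-c * ‖r • x‖)) := by gcongr; exact h _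
    _ = C * (r ^ p * Real.exp (-(c * ‖x‖ * r))) := by
        rw [norm_smul, Real.norm_of_nonneg hr0.le]
        ring_nf

theorem rayMoment_ne_top (hφ : LogConcaveDensity φ) (p : ℕ) {x : E} (hx : x ≠ 0) :
    rayMoment φ p x ≠ ∞ :=
  (hφ.integrableOn_pow_mul_smul p hx).lintegral_lt_top.ne

theorem iSup_invRay_ne_top (hφ : LogConcaveDensity φ) (p : ℕ) {x : E} (hx : x ≠ 0) :
    ⨆ u, invRay φ p x u ≠ ∞ := by
  obtain ⟨C, c, hC, hc, h⟩ := hφ.exists_le_exp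
  have hx0 : 0 < ‖x‖ := norm_pos_iff.2 hx
  refine ne_top_of_le_ne_top (b := ENNReal.ofReal (C * ((p + 2).factorial / (c * ‖x‖) ^ (p + 2))))
    ENNReal.ofReal_ne_top (iSup_le fun u => ?_)
  rw [invRay]
  by_cases hu : u ∈ Ioi (0 : ℝ)
  · rw [indicator_of_mem hu]
    refine ENNReal.ofReal_le_ofReal ?_
    have hr0 : 0 < u⁻¹ := inv_pos.2 hu
    set r := u⁻¹
    have h1 := Real.pow_div_factorial_le_exp (c * ‖x‖ * r) (by positivity) (p + 2)
    rw [div_le_iff₀ (by positivity)] at h1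
    calc r ^ (p + 2) * φ (r • x) ≤ r ^ (p + 2) * (C * Real.exp (-c * ‖r • x‖)) := by
          gcongr; exact h _
      _ = C * (r ^ (p + 2) * (Real.exp (c * ‖x‖ * r))⁻¹) := by
        rw [norm_smul, Real.norm_of_nonneg hr0.le, ← Real.exp_neg]
        ring_nf
      _ ≤ _ := by
        gcongr
        rw [le_div_iff₀ (by positivity)]
        rw [mul_right_comm, ← mul_pow, mul_comm r, ← div_eq_mul_inv, div_le_iff₀ (Real.exp_pos _),
          mul_comm _ (Real.exp _)]
        exact h1
  · rw [indicator_of_notMem hu]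
    exact zero_le

theorem exists_smul_iSup_invRay_eq_one (hφ : LogConcaveDensity φ) (p : ℕ) {x : E} (hx : x ≠ 0)
    (h0 : rayMoment φ p x ≠ 0) : ∃ l : ℝ, 0 < l ∧ ⨆ u, invRay φ p (l • x) u = 1 := by
  set S := ⨆ u, invRay φ p x u with hS
  have hS1 : S ≠ ∞ := hφ.iSup_invRay_ne_top p hx
  have hS0 : S ≠ 0 := by
    intro h
    refine h0 ?_
    rw [← lintegral_invRay]
    refine (lintegral_congr fun u => ?_).trans lintegral_zero
    exact le_antisymm (h ▸ le_iSup (invRay φ p x) u) zero_le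
  have hSr : 0 < S.toReal := ENNReal.toReal_pos hS0 hS1
  refine ⟨S.toReal ^ ((p + 2 : ℕ) : ℝ)⁻¹, by positivity, ?_⟩
  set l := S.toReal ^ ((p + 2 : ℕ) : ℝ)⁻¹ with hl
  have hl0 : 0 < l := by positivity
  have hlp : ENNReal.ofReal (l ^ (p + 2)) = S := by
    rw [hl, Real.rpow_inv_natCast_pow hSr.le (by omega), ENNReal.ofReal_toReal hS1]
  have h := iSup_invRay_smul (φ := φ) p hl0 x
  rw [hlp, ← hS] at h
  exact (ENNReal.mul_right_inj hS0 hS1).1 (by rw [mul_one, ← h])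

/-- Ball's theorem: the superlevel sets of the moments along rays of a log-concave density are
convex. -/
theorem convex_le_rayMoment (hφ : LogConcaveDensity φ) (p : ℕ) {κ : ℝ≥0∞} (hκ : κ ≠ 0) :
    Convex ℝ {x | κ ≤ rayMoment φ p x} := by
  have hsmul : ∀ y : E, κ ≤ rayMoment φ p y → ∀ b : ℝ, 0 < b → b ≤ 1 →
      κ ≤ rayMoment φ p (b • y) := by
    intro y hy b hb hb1
    rw [rayMoment_smul p hb] at hy
    refine hy.trans (mul_le_of_le_one_left zero_le ?_)
    exact ENNReal.ofReal_le_one.2 (pow_le_one₀ hb.le hb1)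
  refine convex_iff_forall_pos.2 fun x hx y hy a b ha hb hab => ?_
  rw [mem_ofPred_eq] at hx hy ⊢
  -- The ray through the origin is constant and its `invRay` may be unbounded, so the normalization
  -- below is unavailable. Shrinking a point towards the origin only increases its moment, which
  -- settles this case.
  rcases eq_or_ne x 0 with rfl | hx0
  · simpa using hsmul y hy b hb (by linarith)
  rcases eq_or_ne y 0 with rfl | hy0
  · simpa using hsmul x hx a ha (by linarith)
  -- Rescaling the two points equalizes the suprema of their `invRay` functions, as
  -- `mul_lintegral_add_mul_lintegral_le` demands.
  obtain ⟨l, hl, hlS⟩ := hφ.exists_smul_iSup_invRay_eq_one p hx0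
    ((pos_iff_ne_zero.2 hκ).trans_le hx).ne'
  obtain ⟨m, hm, hmS⟩ := hφ.exists_smul_iSup_invRay_eq_one p hy0
    ((pos_iff_ne_zero.2 hκ).trans_le hy).ne'
  have hli : 0 < l⁻¹ := inv_pos.2 hl
  have hmi : 0 < m⁻¹ := inv_pos.2 hm
  have hxl : rayMoment φ p (l • x) = ENNReal.ofReal (l⁻¹ ^ (p + 1)) * rayMoment φ p x := by
    rw [rayMoment_smul p hli (l • x), inv_smul_smul₀ hl.ne']
  have hym : rayMoment φ p (m • y) = ENNReal.ofReal (m⁻¹ ^ (p + 1)) * rayMoment φ p y := by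
    rw [rayMoment_smul p hmi (m • y), inv_smul_smul₀ hm.ne']
  -- The weights are proportional to `a / l` and `b / m`, so that the combination of `l • x` and `m
  -- • y` is a multiple of `a • x + b • y`.
  set σ := a * l⁻¹ + b * m⁻¹ with hσ
  have hσ0 : 0 < σ := by positivity
  have ha' : 0 < a * l⁻¹ / σ := by positivity
  have hb' : 0 < b * m⁻¹ / σ := by positivity
  have hab' : a * l⁻¹ / σ + b * m⁻¹ / σ = 1 := by rw [← add_div, ← hσ, div_self hσ0.ne']
  have key := mul_lintegral_add_mul_lintegral_le (hφ.measurable_invRay p (l • x))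
    (hφ.measurable_invRay p (m • y)) (hφ.measurable_invRay p _)
    (ordConnected_lt_invRay hφ.nonneg hφ.logConcave p _)
    (ordConnected_lt_invRay hφ.nonneg hφ.logConcave p _) (hlS.trans hmS.symm) ha' hb'
    (min_invRay_le hφ.nonneg hφ.logConcave p (l • x) (m • y) ha' hb' hab')
  simp only [lintegral_invRay] at key
  have hz : (a * l⁻¹ / σ) • l • x + (b * m⁻¹ / σ) • m • y = σ⁻¹ • (a • x + b • y) := by
    rw [smul_add, smul_smul, smul_smul, smul_smul, smul_smul]
    congr 2 <;> field_simp
  rw [hz, hxl, hym] at key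
  rw [rayMoment_smul p (inv_pos.2 hσ0)]
  refine le_trans ?_ (mul_le_mul_right key _)
  -- After undoing the rescalings by homogeneity, the claim is reduced to the convexity of `t ^ (p +
  -- 2)`.
  have hpow : σ ^ (p + 2) ≤ a * l⁻¹ ^ (p + 2) + b * m⁻¹ ^ (p + 2) := by
    have := (convexOn_pow (p + 2)).2 (mem_Ici.2 hli.le) (mem_Ici.2 hmi.le) ha.le hb.le hab
    simpa using this
  have hone : 1 ≤ σ⁻¹ ^ (p + 1) * (a * l⁻¹ / σ * l⁻¹ ^ (p + 1) + b * m⁻¹ / σ * m⁻¹ ^ (p + 1)) := by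
    calc (1 : ℝ) = σ⁻¹ ^ (p + 2) * σ ^ (p + 2) := by rw [← mul_pow, inv_mul_cancel₀ hσ0.ne', one_pow]
      _ ≤ σ⁻¹ ^ (p + 2) * (a * l⁻¹ ^ (p + 2) + b * m⁻¹ ^ (p + 2)) := by gcongr
      _ = _ := by rw [div_eq_mul_inv, div_eq_mul_inv]; ring
  calc κ ≤ ENNReal.ofReal (σ⁻¹ ^ (p + 1) *
        (a * l⁻¹ / σ * l⁻¹ ^ (p + 1) + b * m⁻¹ / σ * m⁻¹ ^ (p + 1))) * κ :=
        le_mul_of_one_le_left zero_le (ENNReal.one_le_ofReal.2 hone)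
    _ = ENNReal.ofReal (σ⁻¹ ^ (p + 1)) * (ENNReal.ofReal (a * l⁻¹ / σ) *
          (ENNReal.ofReal (l⁻¹ ^ (p + 1)) * κ) + ENNReal.ofReal (b * m⁻¹ / σ) *
          (ENNReal.ofReal (m⁻¹ ^ (p + 1)) * κ)) := by
        rw [ENNReal.ofReal_mul (by positivity), ENNReal.ofReal_add (by positivity) (by positivity),
          ENNReal.ofReal_mul (p := a * l⁻¹ / σ) (by positivity),
          ENNReal.ofReal_mul (p := b * m⁻¹ / σ) (by positivity)]
        ring
    _ ≤ _ := by gcongr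

-- Log-concavity keeps `φ` positive on the segment from the origin to `x`.
omit [(volume : Measure E).IsAddHaarMeasure] in
theorem rayMoment_ne_zero (hφ : LogConcaveDensity φ) (h0 : 0 < φ 0) (p : ℕ) {x : E}
    (hx : 0 < φ x) : rayMoment φ p x ≠ 0 := by
  intro h
  rw [rayMoment, lintegral_eq_zero_iff (hφ.measurable_rayIntegrand_apply p x)] at h
  have h1 : ∀ᵐ r ∂volume.restrict (Ioo (0 : ℝ) 1), False := by
    filter_upwards [ae_restrict_of_ae_restrict_of_subset Ioo_subset_Ioi_self h,
      ae_restrict_mem measurableSet_Ioo] with r hr hr1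
    have h2 := hφ.logConcave x 0 r (1 - r) hr1.1 (by linarith [hr1.2]) (by ring)
    rw [smul_zero, add_zero] at h2
    have h3 : 0 < φ (r • x) := lt_of_lt_of_le (by positivity) h2
    have h4 : 0 < r ^ p * φ (r • x) := mul_pos (pow_pos hr1.1 p) h3
    exact absurd hr (by simpa using h4)
  rw [ae_iff] at h1
  simp at h1

/-- The measure `dr / r` is invariant under scaling, so the value cannot depend on `N`. The
substitution `s = r ^ (p + 1) * N` identifies it as `(p + 1)⁻¹ * ∫ s ^ (-2) ds` over `s ≥ κ`. -/
theorem lintegral_Ioi_inv_mul_ite (p : ℕ) {κ : ℝ} (hκ : 0 < κ) {N : ℝ≥0∞} (hN0 : N ≠ 0)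
    (hN : N ≠ ∞) :
    ∫⁻ r in Ioi (0 : ℝ), ENNReal.ofReal r⁻¹ *
      (if ENNReal.ofReal κ ≤ ENNReal.ofReal (r ^ (p + 1)) * N then
        (ENNReal.ofReal (r ^ (p + 1)) * N)⁻¹ else 0) = ENNReal.ofReal (κ * (p + 1))⁻¹ := by
  obtain ⟨s, hs, rfl⟩ : ∃ s : ℝ, 0 < s ∧ N = ENNReal.ofReal s :=
    ⟨N.toReal, ENNReal.toReal_pos hN0 hN, (ENNReal.ofReal_toReal hN).symm⟩
  set ρ := (κ / s) ^ ((p + 1 : ℕ) : ℝ)⁻¹ with hρ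
  have hρ0 : 0 < ρ := by positivity
  have hρp : ρ ^ (p + 1) = κ / s := Real.rpow_inv_natCast_pow (by positivity) (by omega)
  have h1 : ∀ r ∈ Ioi (0 : ℝ), ENNReal.ofReal r⁻¹ *
      (if ENNReal.ofReal κ ≤ ENNReal.ofReal (r ^ (p + 1)) * ENNReal.ofReal s then
        (ENNReal.ofReal (r ^ (p + 1)) * ENNReal.ofReal s)⁻¹ else 0) =
      (Ici ρ).indicator (fun r => ENNReal.ofReal (s⁻¹ * r ^ (-(p + 2 : ℝ)))) r := by
    intro r hr
    have hr0 : (0 : ℝ) < r := hr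
    rw [← ENNReal.ofReal_mul (by positivity)]
    have hiff : ENNReal.ofReal κ ≤ ENNReal.ofReal (r ^ (p + 1) * s) ↔ r ∈ Ici ρ := by
      rw [ENNReal.ofReal_le_ofReal_iff (by positivity), mem_Ici, ← pow_le_pow_iff_left₀ hρ0.le hr0.le (Nat.succ_ne_zero p), Nat.succ_eq_add_one,
        hρp, div_le_iff₀ hs]
    by_cases hc : r ∈ Ici ρ
    · rw [if_pos (hiff.2 hc), indicator_of_mem hc, ← ENNReal.ofReal_inv_of_pos (by positivity),
        ← ENNReal.ofReal_mul (by positivity)]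
      congr 1
      rw [Real.rpow_neg hr0.le, show (p + 2 : ℝ) = ((p + 2 : ℕ) : ℝ) by push_cast; ring,
        Real.rpow_natCast]
      field_simp
      ring
    · rw [if_neg (fun h => hc (hiff.1 h)), indicator_of_notMem hc, mul_zero]
  rw [setLIntegral_congr_fun measurableSet_Ioi h1, lintegral_indicator measurableSet_Ici,
    Measure.restrict_restrict measurableSet_Ici,
    inter_eq_left.2 (Ici_subset_Ioi.2 hρ0),
    setLIntegral_congr Ioi_ae_eq_Ici.symm]
  have hlt : -(p + 2 : ℝ) < -1 := by have : (0 : ℝ) ≤ p := by positivity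
                                     linarith
  rw [← ofReal_integral_eq_lintegral_ofReal ((integrableOn_Ioi_rpow_of_lt hlt hρ0).const_mul _)
    ((ae_restrict_iff' measurableSet_Ioi).2 (ae_of_all _ fun r hr => by
      have hr0 : (0 : ℝ) < r := hρ0.trans hr
      simp only [Pi.zero_apply]
      positivity)), integral_const_mul, integral_Ioi_rpow_of_lt hlt hρ0]
  congr 1
  have e : -(p + 2 : ℝ) + 1 = -((p + 1 : ℕ) : ℝ) := by push_cast; ring
  rw [e, Real.rpow_neg hρ0.le, Real.rpow_natCast, hρp]
  push_cast
  field_simp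

/-- Integration of a homogeneous function over a superlevel set of the moments along rays. -/
theorem setLIntegral_le_rayMoment (hφ : LogConcaveDensity φ) (h0 : 0 < φ 0) {κ : ℝ} (hκ : 0 < κ)
    {q : E → ℝ≥0∞} (hq : Measurable q) {j p : ℕ}
    (hqj : ∀ r : ℝ, 0 < r → ∀ x, q (r • x) = ENNReal.ofReal (r ^ j) * q x)
    (hn : 0 < Module.finrank ℝ E) (hp : j + Module.finrank ℝ E = p + 1) :
    ∫⁻ x in {x | ENNReal.ofReal κ ≤ rayMoment φ p x}, q x =
      ENNReal.ofReal (κ * (p + 1))⁻¹ * ∫⁻ x, ENNReal.ofReal (φ x) * q x := by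
  have hN := hφ.measurable_rayMoment p
  have : Nontrivial E := Module.finrank_pos_iff.1 hn
  have hne : ∀ᵐ x : E, x ≠ 0 := by
    have h1 : (volume : Measure E) {0} = 0 := measure_singleton 0
    exact measure_eq_zero_iff_ae_notMem.1 h1
  -- On the superlevel set, 1 is the inverse of the ray moment times its defining integral.
  -- Inserting this and substituting `y = r • x` moves the weight `φ` to the whole space and leaves
  -- an integral in `r` that does not depend on `y`.
  let ψ : ℝ≥0∞ → ℝ≥0∞ := fun s => if ENNReal.ofReal κ ≤ s then s⁻¹ else 0
  have hψ : Measurable ψ := Measurable.ite measurableSet_Ici measurable_inv measurable_const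
  have hA : MeasurableSet {x | ENNReal.ofReal κ ≤ rayMoment φ p x} :=
    measurableSet_le measurable_const hN
  have hr := hφ.measurable_rayIntegrand p
  calc ∫⁻ x in {x | ENNReal.ofReal κ ≤ rayMoment φ p x}, q x
      = ∫⁻ x, ∫⁻ r in Ioi (0 : ℝ), ψ (rayMoment φ p x) * q x *
          ENNReal.ofReal (r ^ p * φ (r • x)) := by
        rw [← lintegral_indicator hA]
        refine lintegral_congr_ae (hne.mono fun x hx => ?_)
        simp only
        rw [lintegral_const_mul _ (hφ.measurable_rayIntegrand_apply p x)]
        change _ = _ * rayMoment φ p x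
        by_cases hc : ENNReal.ofReal κ ≤ rayMoment φ p x
        · rw [indicator_of_mem (show x ∈ {x | ENNReal.ofReal κ ≤ rayMoment φ p x} from hc)]
          simp only [ψ, if_pos hc]
          rw [mul_right_comm, ENNReal.inv_mul_cancel, one_mul]
          · exact ((ENNReal.ofReal_pos.2 hκ).trans_le hc).ne'
          · exact hφ.rayMoment_ne_top p hx
        · rw [indicator_of_notMem (show x ∉ {x | ENNReal.ofReal κ ≤ rayMoment φ p x} from hc)]
          simp only [ψ, if_neg hc, zero_mul]
    _ = ∫⁻ r in Ioi (0 : ℝ), ∫⁻ x, ψ (rayMoment φ p x) * q x *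
          ENNReal.ofReal (r ^ p * φ (r • x)) := by
        refine lintegral_lintegral_swap (Measurable.aemeasurable ?_)
        exact (((hψ.comp hN).mul hq).comp measurable_fst).mul hr
    _ = ∫⁻ r in Ioi (0 : ℝ), ∫⁻ y, (ENNReal.ofReal (φ y) * q y) *
          (ENNReal.ofReal r⁻¹ * ψ (ENNReal.ofReal (r ^ (p + 1)) * rayMoment φ p y)) := by
        refine setLIntegral_congr_fun measurableSet_Ioi fun r hr => ?_
        have hr0 : (0 : ℝ) < r := hr
        have hmap := Measure.map_addHaar_smul (volume : Measure E) (inv_pos.2 hr0).ne'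
        have hm2 : Measurable fun x => ψ (rayMoment φ p x) * q x *
            ENNReal.ofReal (r ^ p * φ (r • x)) :=
          ((hψ.comp hN).mul hq).mul ((measurable_const.mul
            (hφ.measurable.comp (measurable_const_smul r))).ennreal_ofReal)
        have h1 := lintegral_map (μ := (volume : Measure E)) hm2 (measurable_const_smul r⁻¹)
        rw [hmap, lintegral_smul_measure, smul_eq_mul] at h1
        have h2 : ∀ y, ψ (rayMoment φ p (r⁻¹ • y)) * q (r⁻¹ • y) *
            ENNReal.ofReal (r ^ p * φ (r • r⁻¹ • y)) =
            ENNReal.ofReal (r⁻¹ ^ j * r ^ p) * (ENNReal.ofReal (φ y) * q y *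
              ψ (ENNReal.ofReal (r ^ (p + 1)) * rayMoment φ p y)) := by
          intro y
          rw [rayMoment_smul p hr0 (r⁻¹ • y), smul_inv_smul₀ hr0.ne', hqj _ (inv_pos.2 hr0),
            ENNReal.ofReal_mul (by positivity), ENNReal.ofReal_mul (by positivity)]
          ring
        simp_rw [h2] at h1
        rw [lintegral_const_mul' _ _ ENNReal.ofReal_ne_top] at h1
        have h3 : ENNReal.ofReal |(r⁻¹ ^ Module.finrank ℝ E)⁻¹| ≠ 0 := by
          simp only [ne_eq, ENNReal.ofReal_eq_zero, not_le]; positivity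
        refine (ENNReal.mul_right_inj h3 ENNReal.ofReal_ne_top).1 (h1.trans ?_)
        simp_rw [mul_left_comm _ (ENNReal.ofReal r⁻¹)]
        rw [lintegral_const_mul' _ _ ENNReal.ofReal_ne_top, ← mul_assoc,
          ← ENNReal.ofReal_mul (by positivity)]
        congr 2
        rw [abs_of_pos (by positivity), inv_pow, inv_pow, inv_inv]
        -- The relation `j + dim = p + 1` makes the powers of `r` collapse to the single factor
        -- `r⁻¹`.
        have e : r ^ p * r = r ^ j * r ^ Module.finrank ℝ E := by
          rw [← pow_succ, ← pow_add, hp]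
        field_simp
        linarith
    _ = ∫⁻ y, ∫⁻ r in Ioi (0 : ℝ), (ENNReal.ofReal (φ y) * q y) *
          (ENNReal.ofReal r⁻¹ * ψ (ENNReal.ofReal (r ^ (p + 1)) * rayMoment φ p y)) := by
        refine lintegral_lintegral_swap (Measurable.aemeasurable ?_)
        refine ((hφ.measurable.ennreal_ofReal.mul hq).comp measurable_snd).mul
          ((measurable_fst.inv.ennreal_ofReal).mul (hψ.comp ?_))
        exact ((measurable_fst.pow_const (p + 1)).ennreal_ofReal).mul (hN.comp measurable_snd)
    _ = ∫⁻ y, ENNReal.ofReal (κ * (p + 1))⁻¹ * (ENNReal.ofReal (φ y) * q y) := by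
        refine lintegral_congr_ae (hne.mono fun y hy => ?_)
        simp only
        rcases (hφ.nonneg y).eq_or_lt with h | h
        · simp [← h]
        · rw [lintegral_const_mul, mul_comm]
          · congr 1
            exact lintegral_Ioi_inv_mul_ite p hκ (hφ.rayMoment_ne_zero h0 p h)
              (hφ.rayMoment_ne_top p hy)
          · exact (measurable_inv.ennreal_ofReal).mul (hψ.comp
              (((measurable_id.pow_const (p + 1)).ennreal_ofReal).mul measurable_const))
    _ = _ := lintegral_const_mul' _ _ ENNReal.ofReal_ne_top

end

end LogConcaveDensity

end

/-! ### Ball's body: second moments and volume. -/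

noncomputable section

open Set
open scoped ENNReal RealInnerProductSpace MatrixOrder

theorem exists_pos_eq_div_pow {A J : ℝ} (hA : 0 < A) (hJ : 0 < J) (p : ℕ) :
    ∃ a : ℝ, 0 < a ∧ J = A / a ^ (p + 1) := by
  refine ⟨(A / J) ^ ((p + 1 : ℕ) : ℝ)⁻¹, by positivity, ?_⟩
  rw [Real.rpow_inv_natCast_pow (by positivity) (by omega)]
  field_simp

namespace LogConcaveDensity

variable {E : Type*} [AddCommGroup E] [Module ℝ E] [MeasureSpace E] {φ : E → ℝ}

theorem le_apply_zero (hφ : LogConcaveDensity φ) (heven : ∀ x, φ (-x) = φ x) (x : E) :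
    φ x ≤ φ 0 := by
  have h := hφ.logConcave x (-x) (1 / 2) (1 / 2) (by norm_num) (by norm_num) (by norm_num)
  rw [heven, smul_neg, add_neg_cancel,
    ← Real.rpow_add_of_nonneg (hφ.nonneg x) (by norm_num) (by norm_num)] at h
  norm_num at h
  exact h

theorem apply_zero_pos (hφ : LogConcaveDensity φ) (heven : ∀ x, φ (-x) = φ x) : 0 < φ 0 := by
  refine lt_of_le_of_ne (hφ.nonneg 0) fun h => ?_
  have h1 : φ = 0 := funext fun x =>
    le_antisymm ((hφ.le_apply_zero heven x).trans h.ge) (hφ.nonneg x)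
  have := hφ.integral_eq_one
  simp [h1] at this

theorem div_rpow_le (hφ : LogConcaveDensity φ) (h0 : 0 < φ 0) (x : E) {r θ : ℝ} (hθ : 0 < θ)
    (hθ1 : θ < 1) : (φ (r • x) / φ 0) ^ θ ≤ φ ((θ * r) • x) / φ 0 := by
  have h := hφ.logConcave (r • x) 0 θ (1 - θ) hθ (by linarith) (by ring)
  rw [smul_zero, add_zero, smul_smul] at h
  rw [Real.div_rpow (hφ.nonneg _) h0.le, div_le_div_iff₀ (by positivity) h0]
  calc φ (r • x) ^ θ * φ 0 = φ (r • x) ^ θ * φ 0 ^ (1 - θ) * φ 0 ^ θ := by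
        rw [mul_assoc, ← Real.rpow_add h0, sub_add_cancel, Real.rpow_one]
    _ ≤ _ := by gcongr

end LogConcaveDensity

namespace LogConcaveDensity

variable {E : Type*} [NormedAddCommGroup E] [NormedSpace ℝ E] [FiniteDimensional ℝ E]
  [MeasureSpace E] [BorelSpace E] [(volume : Measure E).IsAddHaarMeasure] {φ : E → ℝ}

theorem ofReal_integral_pow_mul_smul (hφ : LogConcaveDensity φ) (p : ℕ) {x : E} (hx : x ≠ 0) :
    ENNReal.ofReal (∫ r in Ioi (0 : ℝ), r ^ p * φ (r • x)) = rayMoment φ p x :=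
  ofReal_integral_eq_lintegral_ofReal (hφ.integrableOn_pow_mul_smul p hx)
    ((ae_restrict_iff' measurableSet_Ioi).2 (ae_of_all _ fun _ hr =>
      mul_nonneg (pow_nonneg (le_of_lt hr) _) (hφ.nonneg _)))

theorem integral_pow_mul_smul_pos (hφ : LogConcaveDensity φ) (h0 : 0 < φ 0) (p : ℕ) {x : E}
    (hx : x ≠ 0) (hp : ∃ m, rayMoment φ m x ≠ 0) :
    0 < ∫ r in Ioi (0 : ℝ), r ^ p * φ (r • x) := by
  obtain ⟨m, hm⟩ := hp
  obtain ⟨s, hs, hsx⟩ : ∃ s : ℝ, 0 < s ∧ 0 < φ (s • x) := by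
    by_contra! hcon
    refine hm ?_
    rw [rayMoment]
    refine (setLIntegral_congr_fun measurableSet_Ioi fun r hr => ?_).trans lintegral_zero
    have h1 := le_antisymm (hcon r hr) (hφ.nonneg _)
    simp [h1]
  have h1 := hφ.rayMoment_ne_zero h0 p hsx
  have h2 := rayMoment_smul (φ := φ) p hs x
  have h3 : rayMoment φ p x ≠ 0 := by
    rw [h2]
    exact mul_ne_zero (by simpa using pow_pos hs (p + 1)) h1
  rw [← hφ.ofReal_integral_pow_mul_smul p hx] at h3
  simpa using h3

/-- Choose the exponential `exp (-(a * r))` with the same moment of order `p` as `φ (r • x) / φ 0`.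
Its moment of order `p + 2` is at least as large, so the assumed lower bound gives `a ^ (p + 3) ≤ (p
+ 3)!`. Thus `a ≤ B`, which bounds the moment of order `p` below. -/
theorem le_rayMoment_of_le_rayMoment_add_two (hφ : LogConcaveDensity φ) (h0 : 0 < φ 0) (p : ℕ)
    {x : E} (hx : x ≠ 0) {B : ℝ} (hB : 0 < B) (hBp : B ^ (p + 3) = (p + 3).factorial)
    (h : ENNReal.ofReal (φ 0 / (p + 3)) ≤ rayMoment φ (p + 2) x) :
    ENNReal.ofReal (φ 0 * p.factorial / B ^ (p + 1)) ≤ rayMoment φ p x := by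
  have hne : ∃ m, rayMoment φ m x ≠ 0 :=
    ⟨p + 2, ((ENNReal.ofReal_pos.2 (by positivity)).trans_le h).ne'⟩
  have hJ0 := hφ.integral_pow_mul_smul_pos h0 p hx hne
  rw [← hφ.ofReal_integral_pow_mul_smul (p + 2) hx,
    ENNReal.ofReal_le_ofReal_iff (hφ.integral_pow_mul_smul_pos h0 (p + 2) hx hne).le] at h
  rw [← hφ.ofReal_integral_pow_mul_smul p hx, ENNReal.ofReal_le_ofReal_iff hJ0.le]
  obtain ⟨a, ha, haJ⟩ := exists_pos_eq_div_pow (A := p.factorial)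
    (by positivity) (div_pos hJ0 h0) p
  have hdiv : ∀ m, (fun r : ℝ => r ^ m * (φ (r • x) / φ 0)) =
      fun r => r ^ m * φ (r • x) / φ 0 := fun m => funext fun r => by ring
  have key := integral_pow_add_two_mul_le (g := fun r => φ (r • x) / φ 0) p
    (fun _ _ _ hθ hθ1 => hφ.div_rpow_le h0 x hθ hθ1)
    (by rw [hdiv]; exact (hφ.integrableOn_pow_mul_smul p hx).div_const _)
    (by rw [hdiv]; exact (hφ.integrableOn_pow_mul_smul (p + 2) hx).div_const _) ha
    (by rw [hdiv, integral_div, haJ])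
  rw [hdiv, integral_div, div_le_iff₀ h0] at key
  have h1 := h.trans key
  have h2 : a ^ (p + 3) ≤ B ^ (p + 3) := by
    rw [hBp, Nat.factorial_succ]
    rw [div_le_iff₀ (by positivity)] at h1
    have h3 : (1 : ℝ) ≤ (p + 2).factorial / a ^ (p + 3) * (p + 3) := by
      refine le_of_mul_le_mul_left ?_ h0
      linarith
    rw [div_mul_eq_mul_div, le_div_iff₀ (by positivity)] at h3
    push_cast
    linarith
  have h3 : a ≤ B := (pow_le_pow_iff_left₀ ha.le hB.le (by omega)).1 h2
  rw [div_eq_iff h0.ne'] at haJ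
  rw [haJ, mul_comm, mul_div_right_comm]
  gcongr

end LogConcaveDensity

theorem Real.natCast_pow_self_le_exp_pow_mul_factorial (n : ℕ) :
    (n : ℝ) ^ n ≤ Real.exp 1 ^ n * n.factorial := by
  have h := Real.pow_div_factorial_le_exp (n : ℝ) (by positivity) n
  rw [div_le_iff₀ (by positivity)] at h
  rwa [← Real.exp_nat_mul, mul_one]

/-- The two extra factors are at most `6 n ^ 2` with `n = k + 1`, and `n ^ n ≤ e ^ n * n!` absorbs
the resulting power of `n`. -/
theorem factorial_add_two_pow_le (k : ℕ) :
    ((k + 3).factorial : ℝ) ^ (k + 1) ≤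
      (6 * Real.exp 1 ^ 2) ^ (k + 1) * ((k + 1).factorial : ℝ) ^ (k + 3) := by
  have h := Real.natCast_pow_self_le_exp_pow_mul_factorial (k + 1)
  have h1 : ((k + 3).factorial : ℝ) = (k + 3) * (k + 2) * (k + 1).factorial := by
    rw [Nat.factorial_succ (k + 2), Nat.factorial_succ (k + 1)]
    push_cast
    ring
  have h2 : ((k : ℝ) + 3) * (k + 2) ≤ 6 * ((k + 1 : ℕ) : ℝ) ^ 2 := by
    push_cast
    have : (0 : ℝ) ≤ k := by positivity
    nlinarith
  calc ((k + 3).factorial : ℝ) ^ (k + 1)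
      ≤ (6 * ((k + 1 : ℕ) : ℝ) ^ 2 * (k + 1).factorial) ^ (k + 1) := by
        rw [h1]; gcongr
    _ = 6 ^ (k + 1) * ((((k + 1 : ℕ) : ℝ) ^ (k + 1)) ^ 2) * (k + 1).factorial ^ (k + 1) := by
        rw [mul_pow, mul_pow, ← pow_mul, ← pow_mul, mul_comm 2 (k + 1)]
    _ ≤ 6 ^ (k + 1) * ((Real.exp 1 ^ (k + 1) * (k + 1).factorial) ^ 2) *
          (k + 1).factorial ^ (k + 1) := by gcongr
    _ = _ := by ring

/-- The convex body associated to a log-concave density. -/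
def ballBody {k : ℕ} (φ : EuclideanSpace ℝ (Fin (k + 1)) → ℝ) :
    Set (EuclideanSpace ℝ (Fin (k + 1))) :=
  {x | ENNReal.ofReal (φ 0 / (k + 3)) ≤ rayMoment φ (k + 2) x}

section BallBody

variable {k : ℕ} {φ : EuclideanSpace ℝ (Fin (k + 1)) → ℝ}

theorem convex_ballBody (hφ : LogConcaveDensity φ) (h0 : 0 < φ 0) : Convex ℝ (ballBody φ) :=
  hφ.convex_le_rayMoment _ (ENNReal.ofReal_pos.2 (by positivity)).ne'

theorem measurableSet_ballBody (hφ : LogConcaveDensity φ) : MeasurableSet (ballBody φ) :=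
  measurableSet_le measurable_const (hφ.measurable_rayMoment _)

theorem neg_mem_ballBody (heven : ∀ x, φ (-x) = φ x) {x : EuclideanSpace ℝ (Fin (k + 1))} :
    -x ∈ ballBody φ ↔ x ∈ ballBody φ := by
  have : rayMoment φ (k + 2) (-x) = rayMoment φ (k + 2) x := by
    simp [rayMoment, heven]
  exact iff_of_eq (congrArg (_ ≤ ·) this)

/-- The exponent `k + 2` in `ballBody` is the one adapted to weights homogeneous of degree 2 in
dimension `k + 1`. The threshold `φ 0 / (k + 3)` turns the constant `κ * (p + 1)` into `φ 0`. -/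
theorem lintegral_ballBody_inner_sq (hφ : LogConcaveDensity φ) (h0 : 0 < φ 0)
    (v : EuclideanSpace ℝ (Fin (k + 1))) :
    ∫⁻ x in ballBody φ, ENNReal.ofReal (⟪v, x⟫ ^ 2) =
      ENNReal.ofReal (φ 0)⁻¹ * ∫⁻ x, ENNReal.ofReal (φ x) * ENNReal.ofReal (⟪v, x⟫ ^ 2) := by
  have h := hφ.setLIntegral_le_rayMoment h0 (κ := φ 0 / (k + 3)) (by positivity) (j := 2)
    (p := k + 2) (q := fun x => ENNReal.ofReal (⟪v, x⟫ ^ 2)) (by fun_prop) (fun r hr x => by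
      rw [inner_smul_right, mul_pow, ENNReal.ofReal_mul (by positivity)]) (by simp)
    (by simp; ring)
  rw [ballBody, h]
  congr 3
  push_cast
  field_simp
  ring

/-- Volume is the integral of a weight of degree 0, for which the adapted exponent is `k`. The body
is therefore enclosed, up to the origin, in a superlevel set of the moment of order `k`, whose
volume is known exactly. Raising to the power `k + 3` clears the root in `B`. -/
theorem volume_ballBody (hφ : LogConcaveDensity φ) (h0 : 0 < φ 0) :
    volume (ballBody φ) ≠ ∞ ∧
      (φ 0 * (volume (ballBody φ)).toReal) ^ (k + 3) ≤ (6 * Real.exp 1 ^ 2) ^ (k + 1) := by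
  set B : ℝ := ((k + 3).factorial : ℝ) ^ ((k + 3 : ℕ) : ℝ)⁻¹ with hB
  have hB0 : 0 < B := by positivity
  have hBp : B ^ (k + 3) = (k + 3).factorial := Real.rpow_inv_natCast_pow (by positivity) (by omega)
  have hsub : ballBody φ ⊆
      {x | ENNReal.ofReal (φ 0 * k.factorial / B ^ (k + 1)) ≤ rayMoment φ k x} ∪ {0} := by
    intro x hx
    rcases eq_or_ne x 0 with rfl | hx0
    · exact Or.inr rfl
    · exact Or.inl (hφ.le_rayMoment_of_le_rayMoment_add_two h0 k hx0 hB0 hBp hx)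
  have hv := hφ.setLIntegral_le_rayMoment h0 (κ := φ 0 * k.factorial / B ^ (k + 1))
    (by positivity) (j := 0) (p := k) (q := fun _ => 1) measurable_const (fun r _ x => by simp)
    (by simp) (by simp)
  simp only [mul_one, lintegral_const, Measure.restrict_apply MeasurableSet.univ, univ_inter,
    one_mul, hφ.lintegral_eq_one] at hv
  have hle : volume (ballBody φ) ≤
      ENNReal.ofReal (φ 0 * k.factorial / B ^ (k + 1) * (k + 1))⁻¹ := by
    refine (measure_mono hsub).trans ((measure_union_le _ _).trans ?_)
    rw [hv, measure_singleton, add_zero]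
  refine ⟨ne_top_of_le_ne_top ENNReal.ofReal_ne_top hle, ?_⟩
  have h1 := ENNReal.toReal_mono ENNReal.ofReal_ne_top hle
  rw [ENNReal.toReal_ofReal (by positivity)] at h1
  have h2 : φ 0 * (volume (ballBody φ)).toReal ≤ B ^ (k + 1) / (k + 1).factorial := by
    calc φ 0 * (volume (ballBody φ)).toReal
        ≤ φ 0 * (φ 0 * k.factorial / B ^ (k + 1) * (k + 1))⁻¹ := by gcongr
      _ = _ := by
        rw [Nat.factorial_succ]
        push_cast
        field_simp
  calc (φ 0 * (volume (ballBody φ)).toReal) ^ (k + 3)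
      ≤ (B ^ (k + 1) / (k + 1).factorial) ^ (k + 3) := by
        gcongr
    _ = (k + 3).factorial ^ (k + 1) / (k + 1).factorial ^ (k + 3) := by
        rw [div_pow, ← pow_mul, mul_comm (k + 1), pow_mul, hBp]
    _ ≤ _ := by
        rw [div_le_iff₀ (by positivity)]
        exact factorial_add_two_pow_le k

end BallBody

end

/-! ### Sections, second moments and the isotropic constant of even densities. -/

noncomputable section

open Set EuclideanSpace
open scoped ENNReal RealInnerProductSpace MatrixOrder

theorem bodyCentroid_eq_zero_of_neg_mem {n : ℕ} {K : Set (EuclideanSpace ℝ (Fin n))}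
    (hm : MeasurableSet K) (hK : ∀ x, -x ∈ K ↔ x ∈ K) : bodyCentroid K = 0 := by
  have h := integral_neg_eq_self (K.indicator fun x : EuclideanSpace ℝ (Fin n) => x) volume
  have h1 : (fun x => K.indicator (fun x : EuclideanSpace ℝ (Fin n) => x) (-x)) =
      fun x => -K.indicator (fun x => x) x := by
    ext1 x
    by_cases hx : x ∈ K
    · rw [indicator_of_mem hx, indicator_of_mem ((hK x).2 hx)]
    · rw [indicator_of_notMem hx, indicator_of_notMem fun h => hx ((hK x).1 h), neg_zero]
  rw [h1, integral_neg, integral_indicator hm] at h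
  have h2 : (2 : ℝ) • ∫ x in K, x = 0 := by
    rw [two_smul]
    nth_rewrite 1 [← h]
    exact neg_add_cancel _
  rw [bodyCentroid, setAverage_eq, (smul_eq_zero.1 h2).resolve_left two_ne_zero, smul_zero]

theorem AffineSubspace.exists_unit_normal {k : ℕ}
    {H : AffineSubspace ℝ (EuclideanSpace ℝ (Fin (k + 1)))} (h0 : 0 ∈ H)
    (hH : Module.finrank ℝ H.direction + 1 = k + 1) :
    ∃ θ : EuclideanSpace ℝ (Fin (k + 1)), ‖θ‖ = 1 ∧ ∀ x ∈ H, ⟪θ, x⟫ = 0 := by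
  have h1 := H.direction.finrank_add_finrank_orthogonal
  rw [finrank_euclideanSpace_fin] at h1
  have : Nontrivial H.directionᗮ := Module.finrank_pos_iff (R := ℝ).1 (by omega)
  obtain ⟨⟨w, hw⟩, hw0⟩ := exists_ne (0 : H.directionᗮ)
  have hw0' : w ≠ 0 := fun h => hw0 (Subtype.ext h)
  refine ⟨‖w‖⁻¹ • w, ?_, fun x hx => ?_⟩
  · rw [norm_smul, norm_inv, norm_norm, inv_mul_cancel₀ (norm_ne_zero_iff.2 hw0')]
  have h2 : x ∈ H.direction := by
    have := H.vsub_mem_direction hx h0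
    rwa [vsub_eq_sub, sub_zero] at this
  rw [real_inner_smul_left, real_inner_comm, (Submodule.mem_orthogonal _ _).1 hw x h2, mul_zero]

theorem OrthonormalBasis.exists_apply_zero_eq {k : ℕ} {θ : EuclideanSpace ℝ (Fin (k + 1))}
    (hθ : ‖θ‖ = 1) :
    ∃ b : OrthonormalBasis (Fin (k + 1)) ℝ (EuclideanSpace ℝ (Fin (k + 1))), b 0 = θ := by
  have h : Orthonormal ℝ (({0} : Set (Fin (k + 1))).domRestrict fun _ => θ) := by
    refine ⟨fun i => hθ, fun i j hij => absurd (Subsingleton.elim i j) hij⟩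
  obtain ⟨b, hb⟩ := h.exists_orthonormalBasis_extension_of_card_eq (by simp)
  exact ⟨b, hb 0 rfl⟩

/-- The variance of an even log-concave density on the line in terms of its maximum. -/
theorem LogConcaveDensity.integral_sq_mul_le {g : ℝ → ℝ} (hg : LogConcaveDensity g)
    (heven : ∀ t, g (-t) = g t) : ∫ t, t ^ 2 * g t ≤ 1 / (2 * g 0 ^ 2) := by
  have h0 := hg.apply_zero_pos heven
  have habs : ∀ t, g |t| = g t := fun t => by
    rcases abs_choice t with h | h <;> rw [h]
    exact heven t
  have hdouble : ∀ p : ℕ, ∫ t, |t| ^ p * g t = 2 * ∫ t in Ioi (0 : ℝ), t ^ p * g t := by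
    intro p
    rw [← integral_comp_abs (f := fun t => t ^ p * g t)]
    simp_rw [habs]
  have h1 := hdouble 0
  simp only [pow_zero, one_mul, hg.integral_eq_one] at h1
  have h2 := hdouble 2
  simp only [sq_abs] at h2
  have hint : ∀ p, IntegrableOn (fun r : ℝ => r ^ p * (g r / g 0)) (Ioi 0) := by
    intro p
    have := (hg.integrableOn_pow_mul_smul p (one_ne_zero (α := ℝ))).div_const (g 0)
    simp only [smul_eq_mul, mul_one, mul_div_assoc] at this
    exact this
  -- By evenness half of the mass lies on the positive axis, so `g / g 0` has integral `1 / (2 * g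
  -- 0)` there, as does the exponential of rate `a = 2 * g 0`.
  have key := integral_pow_add_two_mul_le (g := fun r => g r / g 0) (a := 2 * g 0) 0
    (fun r _ θ hθ hθ1 => by
      simpa using hg.div_rpow_le h0 (1 : ℝ) (r := r) hθ hθ1) (hint 0) (hint 2) (by positivity) (by
      simp only [pow_zero, one_mul, integral_div]
      rw [Nat.factorial_zero, zero_add, pow_one, Nat.cast_one, show ∫ t in Ioi (0 : ℝ), g t = 1 / 2 by linarith]
      field_simp)
  simp only [zero_add, ← mul_div_assoc, integral_div] at key
  rw [div_le_iff₀ h0] at key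
  rw [h2]
  refine (mul_le_mul_of_nonneg_left key zero_le_two).trans (le_of_eq ?_)
  have : ((2 : ℕ).factorial : ℝ) = 2 := by norm_num [Nat.factorial]
  rw [this]
  field_simp

section Section

variable {k : ℕ} {K : Set (EuclideanSpace ℝ (Fin (k + 1)))}

/-- For a symmetric convex body of volume one, large hyperplane sections through the centroid
force a small second moment in the normal direction. -/
theorem lintegral_inner_sq_le_of_section (hK : Convex ℝ K) (hm : MeasurableSet K)
    (hv : volume K = 1) (hsymm : ∀ x, -x ∈ K ↔ x ∈ K) {c : ℝ} (hc : 0 < c)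
    (b : OrthonormalBasis (Fin (k + 1)) ℝ (EuclideanSpace ℝ (Fin (k + 1))))
    (hsec : ENNReal.ofReal c ≤
      Measure.euclideanHausdorffMeasure k (K ∩ {x | ⟪b 0, x⟫ = 0})) :
    ∫⁻ x in K, ENNReal.ofReal (⟪b 0, x⟫ ^ 2) ≤ ENNReal.ofReal (1 / (2 * c ^ 2)) := by
  set W := b.repr.symm ⁻¹' K with hW
  have hWm : MeasurableSet W := b.measurePreserving_repr_symm.measurable hm
  have hWv : volume W = 1 := by
    rw [hW, b.measurePreserving_repr_symm.measure_preimage hm.nullMeasurableSet, hv]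
  have hWc : Convex ℝ W := hK.linear_preimage b.repr.symm.toLinearMap
  have hf := isLogConcaveDensity_indicator hWc hWm hWv
  set f : EuclideanSpace ℝ (Fin (k + 1)) → ℝ := W.indicator 1 with hfdef
  set g := marginalDensity f 0 with hg
  have hgl : LogConcaveDensity g := hf.logConcaveDensity_marginalDensity 0
  have hfe : ∀ x, f (-x) = f x := by
    intro x
    have h1 : -x ∈ W ↔ x ∈ W := by
      rw [hW, mem_preimage, mem_preimage, map_neg, hsymm]
    by_cases hx : x ∈ W
    · rw [hfdef, indicator_of_mem hx, indicator_of_mem (h1.2 hx)]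
      rfl
    · rw [hfdef, indicator_of_notMem hx, indicator_of_notMem fun h => hx (h1.1 h)]
  have hge : ∀ t, g (-t) = g t := by
    intro t
    rw [hg, marginalDensity, marginalDensity, ← lintegral_neg_eq_self]
    congr 1
    refine lintegral_congr fun y => ?_
    have h1 : insertCoord 0 (-t) (-y) = -insertCoord 0 t y :=
      (insertCoordLinear (0 : Fin (k + 1))).map_neg (t, y)
    rw [h1, hfe]
  have hms : MeasurableSet {y : Fin k → ℝ | insertCoord (0 : Fin (k + 1)) 0 y ∈ W} :=
    ((measurable_insertCoord 0).comp measurable_prodMk_left) hWm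
  -- The value at 0 of the marginal in the normal direction is the volume of the central section.
  have hg0 : c ≤ g 0 := by
    rw [← ENNReal.ofReal_le_ofReal_iff (hgl.nonneg 0), hg, hf.ofReal_marginalDensity]
    refine hsec.trans (le_of_eq ?_)
    rw [← EuclideanSpace.volume_insertCoord_mem]
    refine (lintegral_indicator_one hms).symm.trans ?_
    refine lintegral_congr fun y => ?_
    by_cases hy : insertCoord (0 : Fin (k + 1)) 0 y ∈ W
    · rw [hfdef, indicator_of_mem hy, indicator_of_mem (by exact hy)]
      simp
    · rw [hfdef, indicator_of_notMem hy, indicator_of_notMem (by exact hy)]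
      simp
  have hgi : Integrable fun t => t ^ 2 * g t := by
    simpa using hgl.integrable_norm_pow_mul 2
  calc ∫⁻ x in K, ENNReal.ofReal (⟪b 0, x⟫ ^ 2)
      = ∫⁻ x in W, ENNReal.ofReal (x 0 ^ 2) := by
        rw [hW, ← b.measurePreserving_repr_symm.setLIntegral_comp_preimage hm (by fun_prop)]
        simp only [← b.repr_apply_apply, LinearIsometryEquiv.apply_symm_apply]
    _ = ∫⁻ x, ENNReal.ofReal (f x) * ENNReal.ofReal (x 0 ^ 2) := by
        rw [← lintegral_indicator hWm]
        refine lintegral_congr fun x => ?_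
        by_cases hx : x ∈ W <;> simp [hfdef, hx]
    _ = ∫⁻ t, ENNReal.ofReal (t ^ 2 * g t) := by
        rw [lintegral_eq_insertCoord 0
          (F := fun x => ENNReal.ofReal (f x) * ENNReal.ofReal (x 0 ^ 2))
          (hf.measurable.ennreal_ofReal.mul (by fun_prop))]
        refine lintegral_congr fun t => ?_
        simp only [insertCoord_same]
        rw [lintegral_mul_const' _ _ ENNReal.ofReal_ne_top, ← hf.ofReal_marginalDensity,
          ENNReal.ofReal_mul (sq_nonneg t), mul_comm]
    _ = ENNReal.ofReal (∫ t, t ^ 2 * g t) :=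
        (ofReal_integral_eq_lintegral_ofReal hgi (ae_of_all _ fun t =>
          mul_nonneg (sq_nonneg t) (hgl.nonneg t))).symm
    _ ≤ _ := by
        refine ENNReal.ofReal_le_ofReal ((hgl.integral_sq_mul_le hge).trans ?_)
        gcongr

/-- The constant `c` is admissible in the hyperplane conjecture. -/
def IsSlicingConstant (c : ℝ) : Prop :=
  ∀ n : ℕ, 1 ≤ n → ∀ K : Set (EuclideanSpace ℝ (Fin n)), Convex ℝ K → volume K = 1 →
    ∃ H : AffineSubspace ℝ (EuclideanSpace ℝ (Fin n)),
      bodyCentroid K ∈ H ∧ Module.finrank ℝ H.direction + 1 = n ∧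
        ENNReal.ofReal c ≤ Measure.euclideanHausdorffMeasure (n - 1)
          (K ∩ (H : Set (EuclideanSpace ℝ (Fin n))))

/-- The centroid of a symmetric body is the origin, so `θ` can be taken as the unit normal of the
hyperplane provided by the slicing constant. -/
theorem IsSlicingConstant.exists_lintegral_inner_sq_le {c : ℝ} (h : IsSlicingConstant c)
    (hc : 0 < c) (hK : Convex ℝ K) (hm : MeasurableSet K)
    (hv : volume K = 1) (hsymm : ∀ x, -x ∈ K ↔ x ∈ K) :
    ∃ θ : EuclideanSpace ℝ (Fin (k + 1)), ‖θ‖ = 1 ∧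
      ∫⁻ x in K, ENNReal.ofReal (⟪θ, x⟫ ^ 2) ≤ ENNReal.ofReal (1 / (2 * c ^ 2)) := by
  obtain ⟨H, hH0, hH1, hH2⟩ := h (k + 1) (by omega) K hK hv
  rw [bodyCentroid_eq_zero_of_neg_mem hm hsymm] at hH0
  obtain ⟨θ, hθ, hθH⟩ := AffineSubspace.exists_unit_normal hH0 hH1
  obtain ⟨b, rfl⟩ := OrthonormalBasis.exists_apply_zero_eq hθ
  exact ⟨b 0, hθ, lintegral_inner_sq_le_of_section hK hm hv hsymm hc b
    (hH2.trans (measure_mono fun x hx => ⟨hx.1, hθH x hx.2⟩))⟩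

end Section

section Determinant

variable {k : ℕ} {φ : EuclideanSpace ℝ (Fin (k + 1)) → ℝ}

/-- Evenness centres the measure, so second moments are covariances. -/
theorem IsLogConcaveDensity.lintegral_mul_inner_sq (hφ : IsLogConcaveDensity φ)
    (heven : ∀ x, φ (-x) = φ x) (v : EuclideanSpace ℝ (Fin (k + 1))) :
    ∫⁻ x, ENNReal.ofReal (φ x) * ENNReal.ofReal (⟪v, x⟫ ^ 2) =
      ENNReal.ofReal (v.ofLp ⬝ᵥ (covarianceMatrix (densityMeasure φ)).mulVec v.ofLp) := by
  have := hφ.isProbabilityMeasure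
  have hX : MemLp (fun x => ⟪v, x⟫) 2 (densityMeasure φ) := hφ.memLp_id.const_inner v
  have hmean : ∫ x, ⟪v, x⟫ ∂densityMeasure φ = 0 := by
    have h1 : ∫ x, ⟪v, x⟫ ∂densityMeasure φ = ∫ x, φ x * ⟪v, x⟫ :=
      integral_withDensity_ofReal hφ.measurable hφ.nonneg _
    have h2 := integral_neg_eq_self (fun x => φ x * ⟪v, x⟫) volume
    simp only [heven, inner_neg_right, mul_neg, integral_neg] at h2
    rw [h1]
    exact neg_eq_self.1 h2
  rw [← hφ.covariance_inner, covariance, hmean]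
  simp only [sub_zero, ← sq]
  rw [densityMeasure, integral_withDensity_ofReal hφ.measurable hφ.nonneg,
    ofReal_integral_eq_lintegral_ofReal
      ((integrable_withDensity_ofReal hφ.measurable hφ.nonneg).1 hX.integrable_sq)
      (ae_of_all _ fun x => mul_nonneg (hφ.nonneg x) (sq_nonneg _))]
  simp_rw [ENNReal.ofReal_mul (hφ.nonneg _)]

theorem Matrix.IsHermitian.inner_toEuclideanCLM {n : ℕ} {S : Matrix (Fin n) (Fin n) ℝ}
    (hS : S.IsHermitian) (x y : EuclideanSpace ℝ (Fin n)) :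
    ⟪Matrix.toEuclideanCLM (𝕜 := ℝ) S x, y⟫ = ⟪x, Matrix.toEuclideanCLM (𝕜 := ℝ) S y⟫ := by
  have h : star (Matrix.toEuclideanCLM (𝕜 := ℝ) S) = Matrix.toEuclideanCLM (𝕜 := ℝ) S := by
    rw [← map_star]
    exact congrArg _ hS
  rw [ContinuousLinearMap.star_eq_adjoint] at h
  nth_rewrite 1 [← h]
  exact ContinuousLinearMap.adjoint_inner_left _ _ _

/-- A bound on the isotropic constant of an even log-concave density. -/
theorem IsSlicingConstant.det_mul_sq_le_of_even {c : ℝ} (h : IsSlicingConstant c) (hc : 0 < c)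
    (hφ : IsLogConcaveDensity φ) (heven : ∀ x, φ (-x) = φ x) :
    (covarianceMatrix (densityMeasure φ)).det * φ 0 ^ 2 ≤
      (3 * Real.exp 1 ^ 2 / c ^ 2) ^ (k + 1) := by
  have hφ' := hφ.toLogConcaveDensity
  have h0 : 0 < φ 0 := hφ'.apply_zero_pos heven
  have hpos := hφ.posDef_covarianceMatrix
  have hquad := hφ.lintegral_mul_inner_sq heven
  set A := covarianceMatrix (densityMeasure φ) with hA
  set S := CFC.sqrt A with hS
  have hSS : S * S = A := CFC.sqrt_mul_sqrt_self A hpos.posSemidef.nonneg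
  have hdetsq : S.det * S.det = A.det := by rw [← Matrix.det_mul, hSS]
  have hdet : S.det ≠ 0 := by
    intro h
    have := hpos.det_pos
    rw [← hdetsq, h, zero_mul] at this
    exact lt_irrefl _ this
  have hSH : S.IsHermitian := (CFC.sqrt_nonneg A).isSelfAdjoint
  have hSunit : IsUnit S.det := isUnit_iff_ne_zero.2 hdet
  set K := ballBody φ with hK
  obtain ⟨hvtop, hvle⟩ := volume_ballBody hφ' h0
  have hmK := measurableSet_ballBody hφ'
  -- A null body would have zero second moments, whereas these are a positive multiple of a positive
  -- definite form.
  have hv0 : volume K ≠ 0 := by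
    intro hv
    have h1 := lintegral_ballBody_inner_sq hφ' h0 (EuclideanSpace.single 0 1)
    rw [← hK, Measure.restrict_eq_zero.2 hv, lintegral_zero_measure, hquad,
      ← ENNReal.ofReal_mul (by positivity)] at h1
    have h2 := hpos.dotProduct_mulVec_pos (x := Pi.single (0 : Fin (k + 1)) (1 : ℝ)) (by simp)
    rw [star_trivial] at h2
    exact absurd h1.symm (ENNReal.ofReal_pos.2 (mul_pos (inv_pos.2 h0) h2)).ne'
  set ν := (volume K).toReal with hν
  have hν0 : 0 < ν := ENNReal.toReal_pos hv0 hvtop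
  have hνK : volume K = ENNReal.ofReal ν := (ENNReal.ofReal_toReal hvtop).symm
  have hd0 : 0 < |S.det| := abs_pos.2 hdet
  -- The map `β • S` pulls the body back to isotropic position: `S`, the root of the covariance
  -- matrix, equalizes the second moments, and `β` normalizes the volume to 1.
  set β := (ν / |S.det|) ^ ((k + 1 : ℕ) : ℝ)⁻¹ with hβ
  have hβ0 : 0 < β := by positivity
  have hβp : β ^ (k + 1) = ν / |S.det| := Real.rpow_inv_natCast_pow (by positivity) (by omega)
  set T := β • S with hT
  have hTdet : T.det = β ^ (k + 1) * S.det := by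
    rw [hT, Matrix.det_smul, Fintype.card_fin]
  have hTdet0 : T.det ≠ 0 := by rw [hTdet]; positivity
  have hTabs : |T.det⁻¹| = ν⁻¹ := by
    rw [abs_inv, hTdet, abs_mul, abs_of_pos (by positivity : 0 < β ^ (k + 1)), hβp,
      div_mul_cancel₀ _ hd0.ne']
  set L := Matrix.toEuclideanCLM (𝕜 := ℝ) T with hL
  set K' := L ⁻¹' K with hK'
  have hmK' : MeasurableSet K' := L.measurable hmK
  have hvK' : volume K' = 1 := by
    have h1 := lintegral_comp_toEuclideanCLM hTdet0
      (measurable_one.indicator hmK : Measurable (K.indicator (1 : EuclideanSpace ℝ (Fin (k + 1)) → ℝ≥0∞)))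
    rw [lintegral_indicator_one hmK, hTabs, hνK, ← ENNReal.ofReal_mul (by positivity),
      inv_mul_cancel₀ hν0.ne', ENNReal.ofReal_one] at h1
    rw [← lintegral_indicator_one hmK', ← h1]
    rfl
  have hcK' : Convex ℝ K' := (convex_ballBody hφ' h0).linear_preimage L.toLinearMap
  have hsK' : ∀ x, -x ∈ K' ↔ x ∈ K' := fun x => by
    rw [hK', mem_preimage, mem_preimage, map_neg]
    exact neg_mem_ballBody heven
  obtain ⟨θ, hθ, hle⟩ := h.exists_lintegral_inner_sq_le hc hcK' hmK' hvK' hsK'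
  set w := Matrix.toEuclideanCLM (𝕜 := ℝ) S⁻¹ θ with hw
  have hSw : Matrix.toEuclideanCLM (𝕜 := ℝ) S w = θ := by
    rw [hw, ← ContinuousLinearMap.comp_apply, ← ContinuousLinearMap.mul_def, ← map_mul,
      Matrix.mul_nonsing_inv _ hSunit, map_one, one_apply_eq_self]
  have hwA : w.ofLp ⬝ᵥ A.mulVec w.ofLp = 1 := by
    have h1 : ⟪w, Matrix.toEuclideanCLM (𝕜 := ℝ) S (Matrix.toEuclideanCLM (𝕜 := ℝ) S w)⟫ = 1 := by
      rw [← hSH.inner_toEuclideanCLM, hSw, real_inner_self_eq_norm_sq, hθ, one_pow]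
    rw [EuclideanSpace.inner_eq_star_dotProduct, Matrix.ofLp_toEuclideanCLM,
      Matrix.ofLp_toEuclideanCLM, Matrix.mulVec_mulVec, hSS, star_trivial, dotProduct_comm] at h1
    exact h1
  have hinner : ∀ x, ⟪θ, x⟫ = β⁻¹ * ⟪w, L x⟫ := by
    intro x
    rw [hL, hT, map_smul, smul_apply, inner_smul_right,
      ← hSH.inner_toEuclideanCLM, hSw, inv_mul_cancel_left₀ hβ0.ne']
  -- The value does not depend on the unit vector `θ`, so the one direction supplied by the slicing
  -- constant is enough.
  have hmom : ∫⁻ x in K', ENNReal.ofReal (⟪θ, x⟫ ^ 2) =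
      ENNReal.ofReal (ν⁻¹ * (β⁻¹ ^ 2 * (φ 0)⁻¹)) := by
    have hmF : Measurable (K.indicator fun y : EuclideanSpace ℝ (Fin (k + 1)) =>
        ENNReal.ofReal (⟪w, y⟫ ^ 2)) := Measurable.indicator (by fun_prop) hmK
    have h1 := lintegral_comp_toEuclideanCLM hTdet0 hmF
    rw [lintegral_indicator hmK, lintegral_ballBody_inner_sq hφ' h0, hquad, hwA,
      ENNReal.ofReal_one, mul_one, hTabs] at h1
    rw [ENNReal.ofReal_mul (by positivity), ENNReal.ofReal_mul (by positivity), mul_left_comm, ← h1,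
      ← lintegral_const_mul' _ _ ENNReal.ofReal_ne_top, ← lintegral_indicator hmK']
    refine lintegral_congr fun x => ?_
    by_cases hx : x ∈ K'
    · rw [indicator_of_mem hx, indicator_of_mem (show L x ∈ K from hx), hinner, mul_pow,
        ENNReal.ofReal_mul (by positivity)]
    · rw [indicator_of_notMem hx, indicator_of_notMem (show L x ∉ K from hx), mul_zero]
  rw [hmom, ENNReal.ofReal_le_ofReal_iff (by positivity)] at hle
  have hβ2 : (β ^ 2)⁻¹ ≤ φ 0 * ν / (2 * c ^ 2) := by
    have h1 : (β ^ 2)⁻¹ = ν⁻¹ * (β⁻¹ ^ 2 * (φ 0)⁻¹) * (φ 0 * ν) := by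
      field_simp
    rw [h1]
    calc ν⁻¹ * (β⁻¹ ^ 2 * (φ 0)⁻¹) * (φ 0 * ν) ≤ 1 / (2 * c ^ 2) * (φ 0 * ν) := by gcongr
      _ = _ := by ring
  have hdetA : A.det = (ν / β ^ (k + 1)) ^ 2 := by
    rw [hβp, div_div_cancel₀ hν0.ne', sq_abs, sq, hdetsq]
  -- Each factor `β ^ (-2)` costs one power of `φ 0 * ν`; altogether there are `k + 3` of them, the
  -- exponent in `volume_ballBody`.
  calc A.det * φ 0 ^ 2 = (φ 0 * ν) ^ 2 * ((β ^ 2)⁻¹) ^ (k + 1) := by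
        rw [hdetA, inv_pow, div_pow, ← pow_mul, ← pow_mul, mul_comm 2 (k + 1)]
        ring
    _ ≤ (φ 0 * ν) ^ 2 * (φ 0 * ν / (2 * c ^ 2)) ^ (k + 1) := by gcongr
    _ = (φ 0 * ν) ^ (k + 3) / (2 * c ^ 2) ^ (k + 1) := by
        rw [div_pow, ← mul_div_assoc, ← pow_add]
        congr 2
        ring
    _ ≤ (6 * Real.exp 1 ^ 2) ^ (k + 1) / (2 * c ^ 2) ^ (k + 1) := by gcongr
    _ = _ := by
        rw [← div_pow]
        congr 1
        field_simp
        norm_num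

end Determinant

end

/-! ### Symmetrization by differences: from the hyperplane conjecture to the entropic form. -/

noncomputable section

open Set EuclideanSpace
open scoped ENNReal RealInnerProductSpace

/-- The density of the difference of two independent random vectors with density `f`, as an
extended nonnegative function. -/
def differenceLIntegral {n : ℕ} (f : EuclideanSpace ℝ (Fin n) → ℝ)
    (z : EuclideanSpace ℝ (Fin n)) : ℝ≥0∞ :=
  ∫⁻ x, ENNReal.ofReal (f x) * ENNReal.ofReal (f (x + z))

/-- The density of the difference of two independent random vectors with density `f`. -/
def differenceDensity {n : ℕ} (f : EuclideanSpace ℝ (Fin n) → ℝ)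
    (z : EuclideanSpace ℝ (Fin n)) : ℝ :=
  (differenceLIntegral f z).toReal

namespace IsLogConcaveDensity

variable {n : ℕ} {f : EuclideanSpace ℝ (Fin n) → ℝ}

theorem measurable_mul_add (hf : IsLogConcaveDensity f) :
    Measurable fun p : EuclideanSpace ℝ (Fin n) × EuclideanSpace ℝ (Fin n) =>
      ENNReal.ofReal (f p.2) * ENNReal.ofReal (f (p.2 + p.1)) :=
  (hf.measurable.comp measurable_snd).ennreal_ofReal.mul
    (hf.measurable.comp (measurable_snd.add measurable_fst)).ennreal_ofReal

theorem measurable_differenceLIntegral (hf : IsLogConcaveDensity f) :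
    Measurable (differenceLIntegral f) :=
  hf.measurable_mul_add.lintegral_prod_right'

theorem differenceLIntegral_ne_top (hf : IsLogConcaveDensity f) (z : EuclideanSpace ℝ (Fin n)) :
    differenceLIntegral f z ≠ ∞ := by
  obtain ⟨C, c, hC, hc, h⟩ := hf.toLogConcaveDensity.exists_le_exp
  have hle : ∀ x, f x ≤ C := fun x => (h x).trans <| by
    refine mul_le_of_le_one_right hC.le (Real.exp_le_one_iff.2 ?_)
    have := norm_nonneg x
    nlinarith
  refine ne_top_of_le_ne_top (b := 1 * ENNReal.ofReal C) (by simp) ?_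
  rw [← hf.toLogConcaveDensity.lintegral_eq_one,
    ← lintegral_mul_const' _ _ ENNReal.ofReal_ne_top]
  exact lintegral_mono fun x => mul_le_mul_right (ENNReal.ofReal_le_ofReal (hle _)) _

theorem lintegral_differenceLIntegral_mul (hf : IsLogConcaveDensity f)
    {q : EuclideanSpace ℝ (Fin n) → ℝ≥0∞} (hq : Measurable q) :
    ∫⁻ z, differenceLIntegral f z * q z =
      ∫⁻ x, ∫⁻ y, ENNReal.ofReal (f x) * (ENNReal.ofReal (f y) * q (y - x)) := by
  calc ∫⁻ z, differenceLIntegral f z * q z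
      = ∫⁻ z, ∫⁻ x, ENNReal.ofReal (f x) * ENNReal.ofReal (f (x + z)) * q z := by
        refine lintegral_congr fun z => ?_
        rw [differenceLIntegral, lintegral_mul_const]
        exact hf.measurable_mul_add.comp (measurable_prodMk_left (x := z))
    _ = ∫⁻ x, ∫⁻ z, ENNReal.ofReal (f x) * ENNReal.ofReal (f (x + z)) * q z := by
        refine lintegral_lintegral_swap (Measurable.aemeasurable ?_)
        exact hf.measurable_mul_add.mul (hq.comp measurable_fst)
    _ = _ := by
        refine lintegral_congr fun x => ?_
        rw [← lintegral_add_left_eq_self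
          (fun y => ENNReal.ofReal (f x) * (ENNReal.ofReal (f y) * q (y - x))) x]
        refine lintegral_congr fun z => ?_
        rw [add_sub_cancel_left, mul_assoc]

/-- The function `f x * f (x + z)` is jointly log-concave in `(z, x)`, and Prékopa's theorem
integrates out `x`. -/
theorem isLogConcave_differenceLIntegral (hf : IsLogConcaveDensity f) :
    IsLogConcave (differenceLIntegral f) := by
  have hl := hf.toLogConcaveDensity.isLogConcave
  let e : (Fin n → ℝ) →ₗ[ℝ] EuclideanSpace ℝ (Fin n) :=
    (WithLp.linearEquiv 2 ℝ (Fin n → ℝ)).symm.toLinearMap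
  let L₁ : EuclideanSpace ℝ (Fin n) × (Fin n → ℝ) →ₗ[ℝ] EuclideanSpace ℝ (Fin n) :=
    e ∘ₗ LinearMap.snd ℝ _ _
  let L₂ : EuclideanSpace ℝ (Fin n) × (Fin n → ℝ) →ₗ[ℝ] EuclideanSpace ℝ (Fin n) :=
    e ∘ₗ LinearMap.snd ℝ _ _ + LinearMap.fst ℝ _ _
  have h := IsLogConcave.lintegral_pi ((hl.comp_linearMap L₁).mul (hl.comp_linearMap L₂)) fun z =>
    (hf.measurable_mul_add.comp (measurable_prodMk_left (x := z))).comp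
      (WithLp.measurable_toLp 2 (Fin n → ℝ))
  convert h using 1
  ext1 z
  exact ((PiLp.volume_preserving_toLp (Fin n)).lintegral_comp
    (hf.measurable_mul_add.comp (measurable_prodMk_left (x := z)))).symm

theorem isLogConcaveDensity_differenceDensity (hf : IsLogConcaveDensity f) :
    IsLogConcaveDensity (differenceDensity f) := by
  have h1 : ∫⁻ z, differenceLIntegral f z = 1 := by
    have h := hf.lintegral_differenceLIntegral_mul (q := fun _ => 1) measurable_const
    simp only [mul_one] at h
    rw [h]
    simp_rw [lintegral_const_mul' _ _ ENNReal.ofReal_ne_top,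
      hf.toLogConcaveDensity.lintegral_eq_one, mul_one]
    exact hf.toLogConcaveDensity.lintegral_eq_one
  obtain ⟨a, b, c, d⟩ := LogConcaveDensity.of_isLogConcave hf.isLogConcave_differenceLIntegral
    hf.measurable_differenceLIntegral hf.differenceLIntegral_ne_top h1
  exact ⟨a, b, c, d⟩

theorem differenceDensity_neg (f : EuclideanSpace ℝ (Fin n) → ℝ) (z : EuclideanSpace ℝ (Fin n)) :
    differenceDensity f (-z) = differenceDensity f z := by
  rw [differenceDensity, differenceDensity, differenceLIntegral, differenceLIntegral,
    ← lintegral_add_right_eq_self _ z]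
  congr 1
  refine lintegral_congr fun x => ?_
  rw [add_neg_cancel_right, mul_comm]

theorem densityMeasure_differenceDensity (hf : IsLogConcaveDensity f) :
    densityMeasure (differenceDensity f) =
      ((densityMeasure f).prod (densityMeasure f)).map fun p => p.2 - p.1 := by
  have := hf.isProbabilityMeasure
  ext s hs
  have hsub : Measurable fun p : EuclideanSpace ℝ (Fin n) × EuclideanSpace ℝ (Fin n) =>
    p.2 - p.1 := measurable_snd.sub measurable_fst
  have hq : Measurable (s.indicator (1 : EuclideanSpace ℝ (Fin n) → ℝ≥0∞)) :=
    measurable_one.indicator hs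
  have hf' := hf.measurable.ennreal_ofReal
  have h := hf.lintegral_differenceLIntegral_mul hq
  have h1 : densityMeasure (differenceDensity f) s =
      ∫⁻ z, differenceLIntegral f z * s.indicator 1 z := by
    rw [densityMeasure, withDensity_apply _ hs, ← lintegral_indicator hs]
    refine lintegral_congr fun z => ?_
    by_cases hz : z ∈ s
    · simp [hz, differenceDensity, ENNReal.ofReal_toReal (hf.differenceLIntegral_ne_top z)]
    · simp [hz]
  rw [h1, h, Measure.map_apply hsub hs, ← lintegral_indicator_one (hsub hs),
    lintegral_prod _ (measurable_one.indicator (hsub hs)).aemeasurable]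
  simp only [densityMeasure]
  have hin : Measurable fun x => ∫⁻ y, ((fun p : EuclideanSpace ℝ (Fin n) ×
      EuclideanSpace ℝ (Fin n) => p.2 - p.1) ⁻¹' s).indicator
        (1 : EuclideanSpace ℝ (Fin n) × EuclideanSpace ℝ (Fin n) → ℝ≥0∞) (x, y)
      ∂volume.withDensity fun x => ENNReal.ofReal (f x) := by
    have : SFinite (volume.withDensity fun x => ENNReal.ofReal (f x)) := inferInstance
    exact (measurable_one.indicator (hsub hs)).lintegral_prod_right'
  rw [lintegral_withDensity_eq_lintegral_mul _ hf' hin]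
  refine lintegral_congr fun x => ?_
  rw [lintegral_const_mul' _ _ ENNReal.ofReal_ne_top, Pi.mul_apply]
  congr 1
  exact (lintegral_withDensity_eq_lintegral_mul _ hf'
    ((measurable_one.indicator (hsub hs)).comp measurable_prodMk_left)).symm

theorem covarianceMatrix_differenceDensity (hf : IsLogConcaveDensity f) :
    covarianceMatrix (densityMeasure (differenceDensity f)) =
      (2 : ℝ) • covarianceMatrix (densityMeasure f) := by
  have := hf.isProbabilityMeasure
  ext i j
  rw [hf.densityMeasure_differenceDensity, Matrix.smul_apply, covarianceMatrix, covarianceMatrix,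
    Matrix.of_apply, Matrix.of_apply]
  set μ := densityMeasure f with hμ
  have hmc : ∀ i, Measurable fun x : EuclideanSpace ℝ (Fin n) => x i := fun i => by fun_prop
  have hX := hf.memLp_coord
  have hfst : ∀ i, MemLp (fun p : EuclideanSpace ℝ (Fin n) × EuclideanSpace ℝ (Fin n) => p.1 i) 2
      (μ.prod μ) := fun i => (hX i).comp_measurePreserving measurePreserving_fst
  have hsnd : ∀ i, MemLp (fun p : EuclideanSpace ℝ (Fin n) × EuclideanSpace ℝ (Fin n) => p.2 i) 2
      (μ.prod μ) := fun i => (hX i).comp_measurePreserving measurePreserving_snd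
  have hcf : cov[fun p => p.1 i, fun p => p.1 j; μ.prod μ] = cov[fun x => x i, fun x => x j; μ] := by
    have h := covariance_map_fun (μ := μ.prod μ) (Z := Prod.fst) (hmc i).aestronglyMeasurable
      (hmc j).aestronglyMeasurable measurable_fst.aemeasurable
    rw [measurePreserving_fst.map_eq] at h
    exact h.symm
  have hcs : cov[fun p => p.2 i, fun p => p.2 j; μ.prod μ] = cov[fun x => x i, fun x => x j; μ] := by
    have h := covariance_map_fun (μ := μ.prod μ) (Z := Prod.snd) (hmc i).aestronglyMeasurable
      (hmc j).aestronglyMeasurable measurable_snd.aemeasurable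
    rw [measurePreserving_snd.map_eq] at h
    exact h.symm
  have hfs : ∀ i j, cov[fun p => p.1 i, fun p => p.2 j; μ.prod μ] = 0 := fun i j =>
    (indepFun_prod (hmc i) (hmc j)).covariance_eq_zero (hfst i) (hsnd j)
  have hsf : ∀ i j, cov[fun p => p.2 i, fun p => p.1 j; μ.prod μ] = 0 := fun i j =>
    (covariance_comm _ _).trans (hfs j i)
  rw [covariance_map_fun 
    (Z := fun p : EuclideanSpace ℝ (Fin n) × EuclideanSpace ℝ (Fin n) => p.2 - p.1)
    (hmc i).aestronglyMeasurable
    (hmc j).aestronglyMeasurable (measurable_snd.sub measurable_fst).aemeasurable]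
  simp only [PiLp.sub_apply]
  rw [covariance_fun_sub_left (Z := fun p => p.2 j - p.1 j) (hsnd i) (hfst i) ((hsnd j).sub (hfst j)),
    covariance_fun_sub_right (hsnd i) (hsnd j) (hfst j),
    covariance_fun_sub_right (hfst i) (hsnd j) (hfst j), hcf, hcs, hfs, hsf]
  simp only [smul_eq_mul]
  ring

/-- At the origin the difference density is `∫ f ^ 2`. Log-concavity gives `f y * f x ≤ f ((x + y) /
2) ^ 2`; integration over `y` leaves `f x` on the left, and the change of variables produces `2 ^ n`
on the right. -/
theorem le_differenceDensity_zero (hf : IsLogConcaveDensity f) (x : EuclideanSpace ℝ (Fin n)) :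
    f x ≤ 2 ^ n * differenceDensity f 0 := by
  have hm : Measurable fun y => ENNReal.ofReal (f y) * ENNReal.ofReal (f y) :=
    hf.measurable.ennreal_ofReal.mul hf.measurable.ennreal_ofReal
  have hmap := Measure.map_addHaar_smul (volume : Measure (EuclideanSpace ℝ (Fin n)))
    (r := (1 / 2 : ℝ)) (by norm_num)
  have h1 := lintegral_map (μ := (volume : Measure (EuclideanSpace ℝ (Fin n))))
    (hm.comp (measurable_add_const ((1 / 2 : ℝ) • x))) (measurable_const_smul (1 / 2 : ℝ))
  rw [hmap, lintegral_smul_measure, smul_eq_mul] at h1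
  simp only [Function.comp_apply] at h1
  rw [lintegral_add_right_eq_self (fun y => ENNReal.ofReal (f y) * ENNReal.ofReal (f y))] at h1
  have h2 : ENNReal.ofReal (f x) ≤ ENNReal.ofReal (2 ^ n) * differenceLIntegral f 0 := by
    calc ENNReal.ofReal (f x) = ∫⁻ y, ENNReal.ofReal (f y) * ENNReal.ofReal (f x) := by
          rw [lintegral_mul_const' _ _ ENNReal.ofReal_ne_top,
            hf.toLogConcaveDensity.lintegral_eq_one, one_mul]
      _ ≤ ∫⁻ y, ENNReal.ofReal (f ((1 / 2 : ℝ) • y + (1 / 2 : ℝ) • x)) *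
            ENNReal.ofReal (f ((1 / 2 : ℝ) • y + (1 / 2 : ℝ) • x)) := by
          refine lintegral_mono fun y => ?_
          rw [← ENNReal.ofReal_mul (hf.nonneg _), ← ENNReal.ofReal_mul (hf.nonneg _)]
          refine ENNReal.ofReal_le_ofReal ?_
          have h3 := hf.logConcave y x (1 / 2) (1 / 2) (by norm_num) (by norm_num) (by norm_num)
          rw [← Real.sqrt_eq_rpow, ← Real.sqrt_eq_rpow, ← Real.sqrt_mul (hf.nonneg y)] at h3
          calc f y * f x = √(f y * f x) * √(f y * f x) :=
                (Real.mul_self_sqrt (mul_nonneg (hf.nonneg _) (hf.nonneg _))).symm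
            _ ≤ _ := mul_self_le_mul_self (Real.sqrt_nonneg _) h3
      _ = ENNReal.ofReal (2 ^ n) * differenceLIntegral f 0 := by
          rw [← h1, differenceLIntegral]
          simp only [add_zero, finrank_euclideanSpace_fin]
          congr 2
          rw [one_div, inv_pow, inv_inv, abs_of_pos (by positivity)]
  have h0 := hf.isLogConcaveDensity_differenceDensity.nonneg 0
  rw [← ENNReal.ofReal_le_ofReal_iff (by positivity), ENNReal.ofReal_mul (by positivity),
    differenceDensity, ENNReal.ofReal_toReal (hf.differenceLIntegral_ne_top 0)]
  exact h2

end IsLogConcaveDensity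

/-- A bound on the isotropic constant of a log-concave density. -/
theorem IsSlicingConstant.det_mul_sq_le {c : ℝ} (h : IsSlicingConstant c) (hc : 0 < c) {k : ℕ}
    {f : EuclideanSpace ℝ (Fin (k + 1)) → ℝ} (hf : IsLogConcaveDensity f)
    (x : EuclideanSpace ℝ (Fin (k + 1))) :
    (covarianceMatrix (densityMeasure f)).det * f x ^ 2 ≤
      (6 * Real.exp 1 ^ 2 / c ^ 2) ^ (k + 1) := by
  have h1 := h.det_mul_sq_le_of_even hc hf.isLogConcaveDensity_differenceDensity
    (IsLogConcaveDensity.differenceDensity_neg f)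
  rw [hf.covarianceMatrix_differenceDensity, Matrix.det_smul, Fintype.card_fin] at h1
  have h2 := hf.le_differenceDensity_zero x
  have h3 := hf.posDef_covarianceMatrix.det_pos
  have h4 := hf.nonneg x
  -- The supremum bound costs `4 ^ (k + 1)` and the doubled covariance matrix returns `2 ^ (k + 1)`,
  -- so 3 becomes 6 in the constant.
  calc (covarianceMatrix (densityMeasure f)).det * f x ^ 2
      ≤ (covarianceMatrix (densityMeasure f)).det * (2 ^ (k + 1) * differenceDensity f 0) ^ 2 := by
        gcongr
    _ = 2 ^ (k + 1) * (2 ^ (k + 1) * (covarianceMatrix (densityMeasure f)).det *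
          differenceDensity f 0 ^ 2) := by ring
    _ ≤ 2 ^ (k + 1) * (3 * Real.exp 1 ^ 2 / c ^ 2) ^ (k + 1) := by gcongr
    _ = _ := by
        rw [← mul_pow]
        congr 1
        ring

/-- The isotropic bound reads `2 log f + log det ≤ n log C` wherever `f` is positive. Integrated
against `f`, its determinant term cancels the one in `entropyFromGaussianity_eq`, and only multiples
of `n` remain. -/
theorem entropicHyperplaneConjecture_of_hyperplaneConjecture (h : HyperplaneConjecture) :
    EntropicHyperplaneConjecture := by
  obtain ⟨c, hc, h⟩ := h
  have h : IsSlicingConstant c := h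
  set C := 6 * Real.exp 1 ^ 2 / c ^ 2 with hC
  have hC0 : 0 < C := by positivity
  refine ⟨(Real.log C + Real.log (2 * Real.pi) + 1) / 2, fun n hn f hf => ?_⟩
  obtain ⟨k, rfl⟩ : ∃ k, n = k + 1 := ⟨n - 1, by omega⟩
  rw [hf.entropyFromGaussianity_eq]
  refine ENNReal.ofReal_le_ofReal ?_
  set d := (covarianceMatrix (densityMeasure f)).det with hd
  have hd0 : 0 < d := hf.posDef_covarianceMatrix.det_pos
  set b := (((k + 1 : ℕ) : ℝ) * Real.log C - Real.log d) / 2 with hb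
  have hlog : ∀ x, f x * Real.log (f x) ≤ f x * b := by
    intro x
    rcases (hf.nonneg x).eq_or_lt with h0 | h0
    · simp [← h0]
    · refine mul_le_mul_of_nonneg_left ?_ h0.le
      have h1 := Real.log_le_log (by positivity) (h.det_mul_sq_le hc hf x)
      rw [← hd, Real.log_mul hd0.ne' (by positivity), Real.log_pow, Real.log_pow] at h1
      rw [hb]
      push_cast at h1 ⊢
      linarith
  have hint : ∫ x, f x * Real.log (f x) ≤ b := by
    calc ∫ x, f x * Real.log (f x) ≤ ∫ x, f x * b :=
          integral_mono hf.toLogConcaveDensity.integrable_mul_log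
            (hf.toLogConcaveDensity.integrable.mul_const b) hlog
      _ = b := by rw [integral_mul_const, hf.integral_eq_one, one_mul]
  rw [hb] at hint
  linarith

end

theorem mainTheorem5 :
    (HyperplaneConjecture ↔ EntropicHyperplaneConjecture) ∧
      (HyperplaneConjecture ↔ EntropicIndependenceConjecture) :=
  ⟨⟨entropicHyperplaneConjecture_of_hyperplaneConjecture, fun h =>
      hyperplaneConjecture_of_entropicIndependenceConjecture
        (entropicIndependenceConjecture_of_entropicHyperplaneConjecture h)⟩,
    ⟨fun h => entropicIndependenceConjecture_of_entropicHyperplaneConjecture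
      (entropicHyperplaneConjecture_of_hyperplaneConjecture h),
      hyperplaneConjecture_of_entropicIndependenceConjecture⟩⟩
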